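/- Let $m\ge 1$, let $\alpha=(\alpha_1,\dots,\alpha_m)$ be a composition of $n$ into $m$ positive parts, let $\pi\in S_n$ have cycle type $\alpha$ (fixed points counted as cycles of length $1$), let $\beta=(\beta_2,\beta_3,\dots)$ be a finitely supported list of nonnegative integers, and let $g\ge 0$. A cycle factorization of $\pi$ is a tuple $f=(\sigma_1,\dots,\sigma_r)$, $r\ge 0$, of cycles in $S_n$, each of length at least $2$, with $\sigma_1\cdots\sigma_r=\pi$ (products composed from right to left). It has signature $\beta$ if exactly $\beta_k$ of the factors are $k$-cycles, for every $k\ge 2$. It has genus $g$ if the group generated by its factors acts transitively on $\{1,\dots,n\}$ and $\sum_{k\ge 2}(k-1)\beta_k=n+m-2+2g$; the factorizations of genus $0$ are called minimal (transitive). Two factorizations are equivalent if one is obtained from the other by repeatedly swapping adjacent disjoint factors; the equivalence classes are called inequivalent factorizations. A map is a $2$-cell embedding of a finite connected graph, with loops and multiple edges allowed, in an oriented closed surface, whose genus is the genus of the map. Maps are considered up to orientation-preserving isomorphism respecting the face labels and the distinguished leaf. If a walk in a map enters a vertex along an edge $e$ and leaves along $e'$, the corner $(e,e')$ is odd if the number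 of edge-ends at this vertex lying strictly between $e$ and $e'$ on the right of the walk is odd. A cycle is a closed walk that repeats no vertex and no edge (loops and pairs of parallel edges give cycles); its corners are taken cyclically. Then the inequivalent genus $g$ cycle factorizations of $\pi$ with signature $\beta$ are in $\alpha_2\cdots\alpha_m$-to-one correspondence with the genus $g$ maps with $m$ faces, labelled $1,\dots,m$, in which (a) every vertex is a leaf (has degree $1$) or has even degree $\ge 4$; (b) face $i$ contains exactly $2\alpha_i$ leaves, for $1\le i\le m$; (c) one leaf in face $1$ is distinguished; (d) there are exactly $\beta_k$ vertices of degree $2k$, for every $k\ge 2$; (e) every cycle has a positive even number of odd corners. That is, there is a function from the former set to the latter under which every map has exactly $\alpha_2\cdots\alpha_m$ preimages. In particular ($g=0$), minimal inequivalent cycle factorizations of $\pi$ with signature $\beta$ are in such a correspondence with planar maps. -/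

import Mathlib

namespace CycleMaps

/-! ### Cycle factorizations -/

section Factorizations

variable {n : ℕ}

/-- The permutation `π` has cycle type `α = (α₁, …, α_m)`: the lengths of its disjoint cycles,
fixed points being counted as cycles of length one, are the parts of `α` in some order. -/
def HasCycleType {m : ℕ} (π : Equiv.Perm (Fin n)) (α : Fin m → ℕ) : Prop :=
  π.partition.parts = Finset.univ.val.map α

/-- The number `ℓ(π)` of cycles of `π`, fixed points included. -/
def numCycles (π : Equiv.Perm (Fin n)) : ℕ :=
  π.partition.parts.card

/-- The tuple `f = (σ₁, …, σ_r)` is a cycle factorization of `π`: each factor is a `k`-cycle for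
some `k ≥ 2`, and `σ₁ ⋯ σ_r = π`. -/
structure IsCycleFactorization (π : Equiv.Perm (Fin n)) (f : List (Equiv.Perm (Fin n))) :
    Prop where
  isCycle : ∀ σ ∈ f, σ.IsCycle
  prod_eq : f.prod = π

/-- The `k`-th entry of the signature of `f`, for `k ≥ 2`: the total number of `k`-cycles amongst
all factors of `f`. -/
def signature (f : List (Equiv.Perm (Fin n))) (k : ℕ) : ℕ :=
  (f.map fun σ => σ.cycleType.count k).sum

/-- The depth of `f`: the sum of `j - 1` over all cycles, `j ≥ 2` being the length of the cycle,
of all factors of `f`. (The entries of `Equiv.Perm.cycleType` are all at least two.) -/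
def depth (f : List (Equiv.Perm (Fin n))) : ℕ :=
  (f.map fun σ => (σ.cycleType.map fun j => j - 1).sum).sum

/-- The factorization `f` is transitive: the group generated by its factors acts transitively. -/
def IsTransitive (f : List (Equiv.Perm (Fin n))) : Prop :=
  ∀ x y : Fin n, ∃ ρ ∈ Subgroup.closure {σ | σ ∈ f}, ρ x = y

/-- The factorization `f` of `π` is transitive of genus `g`: `depth f = n + ℓ(π) - 2 + 2 g`.
The minimal transitive factorizations are those of genus `0`. -/
def HasGenus (π : Equiv.Perm (Fin n)) (f : List (Equiv.Perm (Fin n))) (g : ℕ) : Prop :=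
  IsTransitive f ∧ depth f + 2 = n + numCycles π + 2 * g

/-- `f'` results from `f` by swapping two adjacent disjoint factors. -/
inductive SwapStep : List (Equiv.Perm (Fin n)) → List (Equiv.Perm (Fin n)) → Prop
  | swap (l₁ l₂ : List (Equiv.Perm (Fin n))) (σ τ : Equiv.Perm (Fin n)) (h : σ.Disjoint τ) :
      SwapStep (l₁ ++ σ :: τ :: l₂) (l₁ ++ τ :: σ :: l₂)

/-- The genus `g` cycle factorizations of `π` with signature `β = (β₂, β₃, …)`
(the values `β 0`, `β 1` play no role). -/
def Factorization (π : Equiv.Perm (Fin n)) (β : ℕ →₀ ℕ) (g : ℕ) : Type :=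
  {f : List (Equiv.Perm (Fin n)) //
    IsCycleFactorization π f ∧ HasGenus π f g ∧ ∀ k, 2 ≤ k → signature f k = β k}

/-- Two factorizations are equivalent if one can be obtained from the other by iteratively swapping
adjacent disjoint factors. (Swaps preserve the product, the signature and the genus.) -/
def factorizationSetoid (π : Equiv.Perm (Fin n)) (β : ℕ →₀ ℕ) (g : ℕ) :
    Setoid (Factorization π β g) :=
  (Relation.EqvGen.setoid SwapStep).comap Subtype.val

/-- Inequivalent genus `g` cycle factorizations of `π` with signature `β`. -/
def InequivalentFactorization (π : Equiv.Perm (Fin n)) (β : ℕ →₀ ℕ) (g : ℕ) : Type :=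
  Quotient (factorizationSetoid π β g)

end Factorizations

/-! ### Maps on orientable surfaces -/

/-- A map: a finite connected graph (loops and multiple edges allowed, at least one edge) embedded
with cells as faces in an oriented closed surface, given by its rotation system on the set of darts
(half-edges, or directed edges leaving their initial vertex). -/
structure SurfaceMap where
  Dart : Type
  [finite : Finite Dart]
  [nonempty : Nonempty Dart]
  /-- the next dart in counterclockwise order around the same vertex -/
  next : Equiv.Perm Dart
  /-- the other dart of the same edge -/
  opp : Equiv.Perm Dart
  opp_opp : ∀ x, opp (opp x) = x
  opp_ne : ∀ x, opp x ≠ x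
  connected : ∀ x y, ∃ ρ ∈ Subgroup.closure {next, opp}, ρ x = y

namespace SurfaceMap

variable (M : SurfaceMap)

/-- Walk along `x` to its other end, then leave by the next dart counterclockwise. This follows the
boundary of the face on the right of `x`, keeping the face on the right. -/
def faceNext : Equiv.Perm M.Dart := M.next * M.opp

/-- The vertices are the orbits of the rotation. -/
def Vertex : Type := Quotient (Equiv.Perm.SameCycle.setoid M.next)

/-- The edges are the pairs of opposite darts. -/
def Edge : Type := Quotient (Equiv.Perm.SameCycle.setoid M.opp)

/-- The faces are the boundary walks, that is, the orbits of `faceNext`. -/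
def Face : Type := Quotient (Equiv.Perm.SameCycle.setoid M.faceNext)

/-- The vertex at which a dart starts. -/
def vertexOf (x : M.Dart) : M.Vertex := Quotient.mk _ x

/-- The edge of a dart. -/
def edgeOf (x : M.Dart) : M.Edge := Quotient.mk _ x

/-- The face on the right of a dart. If the dart starts at a leaf, this is the face that contains
the leaf. -/
def faceOf (x : M.Dart) : M.Face := Quotient.mk _ x

/-- The degree of a vertex; a loop counts twice. -/
noncomputable def degree (v : M.Vertex) : ℕ := Nat.card {x : M.Dart // M.vertexOf x = v}

/-- `M` has genus `g`: `V - E + F = 2 - 2 g`. Planar maps are those of genus `0`. -/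
def HasGenus (g : ℕ) : Prop :=
  Nat.card M.Vertex + Nat.card M.Face + 2 * g = Nat.card M.Edge + 2

/-- The dart `x` starts at a leaf, a vertex of degree one. Leaves correspond to such darts. -/
def IsLeafDart (x : M.Dart) : Prop := M.degree (M.vertexOf x) = 1

/-- A walk that reaches a vertex along the edge of the dart `x` at this vertex (walking against `x`)
and leaves along the dart `y` has an odd corner there: the number `k` of darts strictly between `x`
and `y` in counterclockwise order, which are the ones on the right of the walk, is odd. -/
def IsOddCorner (x y : M.Dart) : Prop :=
  ∃ k : ℕ, Odd k ∧ (M.next ^ (k + 1)) x = y ∧ ∀ i < k, (M.next ^ (i + 1)) x ≠ y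

/-- The darts `c 0, …, c (l - 1)` form a cycle of length `l ≥ 1`: each ends where the cyclically
next one starts, and no vertex and no edge is repeated. Loops are cycles of length one, and pairs of
parallel edges are cycles of length two. (Addition in `Fin l` is modulo `l`.) -/
structure IsCycle {l : ℕ} [NeZero l] (c : Fin l → M.Dart) : Prop where
  walk : ∀ i, M.vertexOf (M.opp (c i)) = M.vertexOf (c (i + 1))
  vertex_injective : Function.Injective fun i => M.vertexOf (c i)
  edge_injective : Function.Injective fun i => M.edgeOf (c i)

/-- The number of odd corners of the closed walk `c 0, …, c (l - 1)`. -/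
noncomputable def numOddCorners {l : ℕ} [NeZero l] (c : Fin l → M.Dart) : ℕ :=
  Nat.card {i : Fin l // M.IsOddCorner (M.opp (c i)) (c (i + 1))}

end SurfaceMap

/-- A map with `m ≥ 1` faces labelled `0, …, m - 1`, and a distinguished leaf in face `0`
(the *first* face). -/
structure LabelledMap (m : ℕ) [NeZero m] extends SurfaceMap where
  faceLabel : toSurfaceMap.Face ≃ Fin m
  root : Dart
  root_leaf : toSurfaceMap.IsLeafDart root
  root_face : faceLabel (toSurfaceMap.faceOf root) = 0

namespace LabelledMap

variable {m : ℕ} [NeZero m]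

/-- Isomorphism of maps: orientation-preserving, and compatible with the labels of the faces and
with the distinguished leaf. -/
structure Iso (M N : LabelledMap m) where
  toEquiv : M.Dart ≃ N.Dart
  map_next : ∀ x, toEquiv (M.next x) = N.next (toEquiv x)
  map_opp : ∀ x, toEquiv (M.opp x) = N.opp (toEquiv x)
  map_face : ∀ x, N.faceLabel (N.faceOf (toEquiv x)) = M.faceLabel (M.faceOf x)
  map_root : toEquiv M.root = N.root

/-- Being isomorphic is an equivalence relation. -/
def isoSetoid (m : ℕ) [NeZero m] : Setoid (LabelledMap m) where
  r M N := Nonempty (Iso M N)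
  iseqv :=
    { refl := fun _ => ⟨⟨Equiv.refl _, fun _ => rfl, fun _ => rfl, fun _ => rfl, rfl⟩⟩
      symm := by
        rintro M N ⟨e⟩
        refine ⟨⟨e.toEquiv.symm, fun x => ?_, fun x => ?_, fun x => ?_, ?_⟩⟩
        · rw [Equiv.symm_apply_eq, e.map_next, Equiv.apply_symm_apply]
        · rw [Equiv.symm_apply_eq, e.map_opp, Equiv.apply_symm_apply]
        · rw [← e.map_face, Equiv.apply_symm_apply]
        · rw [Equiv.symm_apply_eq, e.map_root]
      trans := by
        rintro M N P ⟨e⟩ ⟨e'⟩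
        refine ⟨⟨e.toEquiv.trans e'.toEquiv, fun x => ?_, fun x => ?_, fun x => ?_, ?_⟩⟩
        · simp [e.map_next, e'.map_next]
        · simp [e.map_opp, e'.map_opp]
        · simp [e.map_face, e'.map_face]
        · simp [e.map_root, e'.map_root] }

/-- The conditions on a genus `g` map, with labelled faces and a distinguished leaf in the first
face, that are imposed by `α = (α₁, …, α_m)` and `β = (β₂, β₃, …)`. -/
structure IsAdmissible (M : LabelledMap m) (α : Fin m → ℕ) (β : ℕ →₀ ℕ) (g : ℕ) : Prop where
  genus : M.HasGenus g
  degrees : ∀ v : M.Vertex, M.degree v = 1 ∨ (Even (M.degree v) ∧ 4 ≤ M.degree v)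
  leaves : ∀ i : Fin m,
    Nat.card {x : M.Dart // M.IsLeafDart x ∧ M.faceLabel (M.faceOf x) = i} = 2 * α i
  vertices : ∀ k, 2 ≤ k → Nat.card {v : M.Vertex // M.degree v = 2 * k} = β k
  cycles : ∀ (l : ℕ) [NeZero l] (c : Fin l → M.Dart), M.IsCycle c →
    0 < M.numOddCorners c ∧ Even (M.numOddCorners c)

end LabelledMap

/-- Isomorphism classes of admissible maps. -/
def MapClass {m : ℕ} [NeZero m] (α : Fin m → ℕ) (β : ℕ →₀ ℕ) (g : ℕ) : Type 1 :=
  Quotient ((LabelledMap.isoSetoid m).comap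
    (Subtype.val : {M : LabelledMap m // M.IsAdmissible α β g} → LabelledMap m))

/-- The function `F` is a `k`-to-one correspondence: every element of the codomain is the image of
exactly `k` elements. -/
def IsToOne {X : Type*} {Y : Type*} (k : ℕ) (F : X → Y) : Prop :=
  ∀ y, (F ⁻¹' {y}).Finite ∧ (F ⁻¹' {y}).ncard = k

end CycleMaps

/-!
The map of a cycle factorization `f = (σ₁, …, σ_r)` of `π` is obtained from a diagram of lines.
Every point `i` is a directed line from a source to a sink, which runs, in the order of the indices,
through one vertex for each factor that moves `i`. A `k`-cycle thus becomes a vertex of degree `2k`,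
at which lines arrive and leave alternately, arranged so that the walk along a face leads from the
source `i` to the sink `π⁻¹ i` in the direction of the lines, and from there back along the line to
the source `π⁻¹ i`. Hence the faces correspond to the cycles of `π`, and the genus of the map is
that of `f`. `Drawing` describes such diagrams by giving each dart a time, a position and a
direction.

Swapping disjoint neighbours only changes times (`Drawing.exists_swap`). Conversely the lines
determine the class of `f`, since this class is determined by the sequences of factors that move
each point (`eqvGen_of_word_eq`, `Drawing.eqvGen_of_pos_eq`), and a factorization has only one
drawing up to isomorphism (`Drawing.exists_equiv`).

The condition on cycles says that directions can be chosen consistently, and without directed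
cycles. A corner between two darts at a vertex is odd if and only if the alternating directions of
these darts agree, that is, if the walk changes there between following and opposing the directions.
So a consistent orientation makes the number of odd corners of a cycle even, and this number is zero
only for a directed cycle (`Drawing.cycles`). Conversely, an alternating choice around each vertex
fails along certain edges, an even number of them on each cycle, so it can be corrected by reversing
it at suitable vertices (`SurfaceMap.exists_isOrientation`); the reduction from closed walks to
cycles is `SurfaceMap.exists_isCycle`. An orientation without directed cycles allows the vertices to
be ordered in time, and if the sources are labelled so that the faces induce `π⁻¹`, this gives a
factorization of `π` (`SurfaceMap.exists_drawing`).

Fix a labelling of the cycles of `π` and a point `i₀` in the first one, to be the label of the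
distinguished leaf, which is taken to be a source. The preimages of a map correspond to the
labellings of its darts that follow the faces: different labellings give different classes, since a
connected map has no nontrivial automorphism that fixes the distinguished leaf
(`LabelledMap.IsDrawn.label_unique`). A labelling can be prescribed at one dart of each face, except
in the first face, where it is fixed by `i₀`; this gives the factor `α₂ ⋯ α_m`
(`natCard_twisted`, `LabelledMap.IsAdmissible.card_labellings`).
-/

namespace CycleMaps

open Equiv.Perm

/-! ### Words and swaps of disjoint factors -/

section Words

variable {n : ℕ}

/-- The factors of `f` that move `i`, in order. -/
def word (f : List (Equiv.Perm (Fin n))) (i : Fin n) : List (Equiv.Perm (Fin n)) :=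
  f.filter fun σ => σ i ≠ i

theorem exists_ne_of_ne_one {σ : Equiv.Perm (Fin n)} (h : σ ≠ 1) : ∃ i, σ i ≠ i := by
  by_contra! hh
  exact h (Equiv.ext hh)

theorem eqvGen_cons {f f' : List (Equiv.Perm (Fin n))} (σ : Equiv.Perm (Fin n))
    (h : Relation.EqvGen SwapStep f f') : Relation.EqvGen SwapStep (σ :: f) (σ :: f') := by
  induction h with
  | rel x y h =>
    obtain ⟨l₁, l₂, a, b, hd⟩ := h
    exact .rel _ _ (SwapStep.swap (σ :: l₁) l₂ a b hd)
  | refl x => exact .refl _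
  | symm x y _ ih => exact ih.symm
  | trans x y z _ _ ih₁ ih₂ => exact ih₁.trans _ _ _ ih₂

/-- A factor can be moved to the front past factors disjoint from it. -/
theorem eqvGen_move_front (A B : List (Equiv.Perm (Fin n))) (σ : Equiv.Perm (Fin n))
    (h : ∀ τ ∈ A, τ.Disjoint σ) :
    Relation.EqvGen SwapStep (A ++ σ :: B) (σ :: (A ++ B)) := by
  induction A with
  | nil => exact .refl _
  | cons τ A ih =>
    refine (eqvGen_cons τ (ih fun τ' h' => h τ' (List.mem_cons_of_mem _ h'))).trans _ _ _ ?_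
    exact .rel _ _ (SwapStep.swap [] (A ++ B) τ σ (h τ List.mem_cons_self))

/-- Lists of nontrivial permutations are related by swaps of disjoint neighbours as soon as, for
every point, the same factors move it in the same order. This is the projection criterion for
partially commutative words. -/
theorem eqvGen_of_word_eq (f f' : List (Equiv.Perm (Fin n))) (hf : ∀ σ ∈ f, σ ≠ 1)
    (hf' : ∀ σ ∈ f', σ ≠ 1) (h : ∀ i, word f i = word f' i) :
    Relation.EqvGen SwapStep f f' := by
  induction f generalizing f' with
  | nil =>
    rcases f' with _ | ⟨τ, f'⟩
    · exact .refl _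
    · obtain ⟨i, hi⟩ := exists_ne_of_ne_one (hf' τ List.mem_cons_self)
      have := h i
      simp [word, hi] at this
  | cons σ f ih =>
    -- `σ` comes first in the word of each point it moves, so it occurs in `f'`, and everything
    -- before its first occurrence is disjoint from it.
    have hmem : σ ∈ f' := by
      obtain ⟨i, hi⟩ := exists_ne_of_ne_one (hf σ List.mem_cons_self)
      have : σ ∈ word f' i := by
        rw [← h i]; simp [word, hi]
      exact (List.mem_filter.1 this).1
    obtain ⟨A, B, rfl, hA⟩ := List.eq_append_cons_of_mem hmem
    have hdis : ∀ j, σ j ≠ j → word A j = [] := by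
      intro j hj
      have := h j
      rcases hw : word A j with _ | ⟨τ, w⟩
      · rfl
      · have hτ : τ ∈ word A j := by rw [hw]; exact List.mem_cons_self
        have hτA : τ ∈ A := (List.mem_filter.1 hτ).1
        simp only [word] at hw this
        rw [List.filter_append, hw, List.filter_cons_of_pos (by simpa using hj)] at this
        simp only [List.cons_append, List.cons.injEq] at this
        exact absurd (this.1 ▸ hτA) hA
    have hd : ∀ τ ∈ A, τ.Disjoint σ := by
      intro τ hτ j
      by_contra! hc
      have : τ ∈ word A j := List.mem_filter.2 ⟨hτ, by simpa using hc.1⟩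
      rw [hdis j hc.2] at this
      exact absurd this (by simp)
    refine (eqvGen_cons σ (ih (A ++ B) (fun τ ht => hf τ (List.mem_cons_of_mem _ ht))
      (fun τ ht => hf' τ (by grind)) ?_)).trans _ _ _ (eqvGen_move_front A B σ hd).symm
    intro i
    have := h i
    by_cases hi : σ i = i
    · simpa [word, hi] using this
    · have h1 := hdis i hi
      simp only [word] at h1 this ⊢
      rw [List.filter_append, h1, List.filter_cons_of_pos (by simpa using hi),
        List.filter_cons_of_pos (by simpa using hi)] at this
      rw [List.filter_append, h1]
      simpa using this

/-- The factor with index `s`, counted from `1`; the identity for all other `s`. -/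
def factorAt (f : List (Equiv.Perm (Fin n))) (s : ℕ) : Equiv.Perm (Fin n) :=
  (1 :: f).getD s 1

@[simp] theorem factorAt_zero (f : List (Equiv.Perm (Fin n))) : factorAt f 0 = 1 := rfl

theorem factorAt_succ (f : List (Equiv.Perm (Fin n))) (s : ℕ) :
    factorAt f (s + 1) = f.getD s 1 := rfl

theorem factorAt_of_lt (f : List (Equiv.Perm (Fin n))) (s : ℕ) (h : s < f.length) :
    factorAt f (s + 1) = f[s] := by
  rw [factorAt_succ, List.getD_eq_getElem _ _ h]

theorem factorAt_of_length_lt (f : List (Equiv.Perm (Fin n))) (s : ℕ) (h : f.length < s) :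
    factorAt f s = 1 := by
  rcases s with _ | s
  · rfl
  · rw [factorAt_succ, List.getD_eq_default _ _ (by omega)]

theorem pos_of_factorAt_ne {f : List (Equiv.Perm (Fin n))} {s : ℕ} {i : Fin n}
    (h : factorAt f s i ≠ i) : 0 < s ∧ s ≤ f.length := by
  constructor
  · rcases s with _ | s
    · simp at h
    · omega
  · by_contra! hs
    rw [factorAt_of_length_lt f s hs] at h
    simp at h

theorem factorAt_mem {f : List (Equiv.Perm (Fin n))} {s : ℕ} (h0 : 0 < s) (h : s ≤ f.length) :
    factorAt f s ∈ f := by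
  obtain ⟨s, rfl⟩ : ∃ k, s = k + 1 := ⟨s - 1, by omega⟩
  rw [factorAt_of_lt f s (by omega)]
  exact List.getElem_mem _

theorem take_factorAt (f : List (Equiv.Perm (Fin n))) {s : ℕ} (h0 : 0 < s) (h : s ≤ f.length) :
    f.take s = f.take (s - 1) ++ [factorAt f s] := by
  obtain ⟨s, rfl⟩ : ∃ k, s = k + 1 := ⟨s - 1, by omega⟩
  rw [factorAt_of_lt f s (by omega), Nat.add_sub_cancel, List.take_concat_get' f s (by omega)]

/-- Factors between the indices `s` and `s'` that fix `i` do not change the word of `i`. -/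
theorem word_take_eq (f : List (Equiv.Perm (Fin n))) (i : Fin n) {s s' : ℕ} (hs : s ≤ s')
    (h : ∀ u, s < u → u ≤ s' → factorAt f u i = i) :
    word (f.take s') i = word (f.take s) i := by
  induction s', hs using Nat.le_induction with
  | base => rfl
  | succ k hk ih =>
    rw [← ih fun u h1 h2 => h u h1 (by omega)]
    by_cases hl : k + 1 ≤ f.length
    · rw [take_factorAt f (by omega) hl, word, List.filter_append]
      simp [h (k + 1) (by omega) le_rfl, word]
    · rw [List.take_of_length_le (by omega), List.take_of_length_le (by omega)]

/-- Factors between the indices `s` and `s'` that fix `i` do not change the value at `i` of the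
partial product. -/
theorem prod_take_eq (f : List (Equiv.Perm (Fin n))) (i : Fin n) {s s' : ℕ} (hs : s ≤ s')
    (h : ∀ u, s < u → u ≤ s' → factorAt f u i = i) :
    (f.take s').prod i = (f.take s).prod i := by
  induction s', hs using Nat.le_induction with
  | base => rfl
  | succ k hk ih =>
    rw [← ih fun u h1 h2 => h u h1 (by omega)]
    by_cases hl : k + 1 ≤ f.length
    · rw [take_factorAt f (by omega) hl]
      simp [h (k + 1) (by omega) le_rfl]
    · rw [List.take_of_length_le (by omega), List.take_of_length_le (by omega)]

end Words

/-! ### Drawings of factorizations -/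

/-- A drawing of the factorization `f = (σ₁, …, σ_r)` on the rotation system `(nx, op)`. Every point
`i` becomes a directed line, which leaves a source at time `0`, visits at time `s` the vertex of
each factor `σ_s` that moves `i`, and ends in a sink at time `r + 1`. A dart is described by the
time of its vertex, the position of its line, and its direction: `out` holds if the line leaves the
vertex along the dart. Around the vertex of `σ`, the dart by which the line `i` leaves is followed
by the one by which it arrives, and this is followed by the dart by which the line `σ⁻¹ i` leaves.
Sources and sinks are fixed by `nx`. -/
structure Drawing {D : Type} {n : ℕ} (nx op : Equiv.Perm D) (f : List (Equiv.Perm (Fin n))) where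
  time : D → ℕ
  pos : D → Fin n
  out : D → Bool
  op_op : ∀ x, op (op x) = x
  out_op : ∀ x, out (op x) = !out x
  pos_op : ∀ x, pos (op x) = pos x
  time_lt : ∀ x, out x = true → time x < time (op x)
  time_nx : ∀ x, time (nx x) = time x
  nx_of_out : ∀ x, out x = true → (time x = 0 ∧ nx x = x) ∨
    (factorAt f (time x) (pos x) ≠ pos x ∧ out (nx x) = false ∧ pos (nx x) = pos x)
  nx_of_in : ∀ x, out x = false → (time x = f.length + 1 ∧ nx x = x) ∨
    (factorAt f (time x) (pos x) ≠ pos x ∧ out (nx x) = true ∧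
      factorAt f (time x) (pos (nx x)) = pos x)
  inj : ∀ x y, time x = time y → pos x = pos y → out x = out y → x = y
  source : ∀ i, ∃ x, out x = true ∧ time x = 0 ∧ pos x = i
  sink : ∀ i, ∃ x, out x = false ∧ time x = f.length + 1 ∧ pos x = i
  inner : ∀ s i, factorAt f s i ≠ i → ∃ x, out x = false ∧ time x = s ∧ pos x = i

namespace Drawing

section Basic

variable {D : Type} {n : ℕ} {nx op : Equiv.Perm D} {f : List (Equiv.Perm (Fin n))}
  (d : Drawing nx op f)

theorem out_op_of_in {x : D} (h : d.out x = false) : d.out (op x) = true := by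
  rw [d.out_op, h]; rfl

theorem out_op_of_out {x : D} (h : d.out x = true) : d.out (op x) = false := by
  rw [d.out_op, h]; rfl

theorem time_op_lt {x : D} (h : d.out x = false) : d.time (op x) < d.time x := by
  have := d.time_lt (op x) (d.out_op_of_in h)
  rwa [d.op_op] at this

theorem time_le (x : D) : d.time x ≤ f.length + 1 := by
  rcases hx : d.out x
  · rcases d.nx_of_in x hx with h | h
    · exact h.1.le
    · exact (pos_of_factorAt_ne h.1).2.trans (Nat.le_succ _)
  · rcases d.nx_of_out x hx with h | h
    · omega
    · exact (pos_of_factorAt_ne h.1).2.trans (Nat.le_succ _)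

theorem time_le_of_out {x : D} (h : d.out x = true) : d.time x ≤ f.length := by
  have := d.time_lt x h
  have := d.time_le (op x)
  omega

theorem time_pos_of_in {x : D} (h : d.out x = false) : 0 < d.time x :=
  (Nat.zero_le _).trans_lt (d.time_op_lt h)

theorem out_inner {x : D} (h : d.out x = true) (h0 : d.time x ≠ 0) :
    factorAt f (d.time x) (d.pos x) ≠ d.pos x ∧ d.out (nx x) = false ∧ d.pos (nx x) = d.pos x := by
  rcases d.nx_of_out x h with h' | h'
  · exact absurd h'.1 h0
  · exact h'

theorem in_inner {x : D} (h : d.out x = false) (h0 : d.time x ≠ f.length + 1) :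
    factorAt f (d.time x) (d.pos x) ≠ d.pos x ∧ d.out (nx x) = true ∧
      factorAt f (d.time x) (d.pos (nx x)) = d.pos x := by
  rcases d.nx_of_in x h with h' | h'
  · exact absurd h'.1 h0
  · exact h'

theorem nx_source {x : D} (h0 : d.time x = 0) : nx x = x := by
  rcases hx : d.out x
  · have := d.time_pos_of_in hx
    omega
  · rcases d.nx_of_out x hx with h | h
    · exact h.2
    · exact absurd (pos_of_factorAt_ne h.1).1 (by omega)

theorem nx_sink {x : D} (h0 : d.time x = f.length + 1) : nx x = x := by
  rcases hx : d.out x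
  · rcases d.nx_of_in x hx with h | h
    · exact h.2
    · exact absurd (pos_of_factorAt_ne h.1).2 (by omega)
  · have := d.time_le_of_out hx
    omega

theorem out_of_time_zero {x : D} (h0 : d.time x = 0) : d.out x = true := by
  rcases hx : d.out x
  · have := d.time_pos_of_in hx
    omega
  · rfl

theorem in_of_time_last {x : D} (h0 : d.time x = f.length + 1) : d.out x = false := by
  rcases hx : d.out x
  · rfl
  · have := d.time_le_of_out hx
    omega

theorem out_nx {x : D} (h0 : d.time x ≠ 0) (h1 : d.time x ≠ f.length + 1) :
    d.out (nx x) = !d.out x := by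
  rcases hx : d.out x
  · rw [(d.in_inner hx h1).2.1]; rfl
  · rw [(d.out_inner hx h0).2.1]; rfl

theorem nx_eq_self_iff (x : D) : nx x = x ↔ d.time x = 0 ∨ d.time x = f.length + 1 := by
  constructor
  · intro h
    by_contra! hc
    have := d.out_nx hc.1 hc.2
    rw [h] at this
    simp at this
  · rintro (h | h)
    · exact d.nx_source h
    · exact d.nx_sink h

theorem moved {x : D} (h0 : d.time x ≠ 0) (h1 : d.time x ≠ f.length + 1) :
    factorAt f (d.time x) (d.pos x) ≠ d.pos x := by
  rcases hx : d.out x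
  · exact (d.in_inner hx h1).1
  · exact (d.out_inner hx h0).1

theorem time_symm (x : D) : d.time (nx.symm x) = d.time x := by
  have := d.time_nx (nx.symm x)
  rwa [Equiv.apply_symm_apply, eq_comm] at this

/-- Before the dart by which a line arrives at an inner vertex comes the dart by which the same line
leaves. -/
theorem symm_of_in {x : D} (h : d.out x = false) (h1 : d.time x ≠ f.length + 1) :
    d.out (nx.symm x) = true ∧ d.pos (nx.symm x) = d.pos x := by
  have h0 := d.time_pos_of_in h
  have ht := d.time_symm x
  have h2 := d.out_nx (x := nx.symm x) (by omega) (by omega)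
  rw [Equiv.apply_symm_apply, h] at h2
  have h3 : d.out (nx.symm x) = true := by simpa using h2.symm
  refine ⟨h3, ?_⟩
  have := (d.out_inner h3 (by omega)).2.2
  rw [Equiv.apply_symm_apply] at this
  exact this.symm

theorem exists_out {s : ℕ} {i : Fin n} (h : factorAt f s i ≠ i) :
    ∃ x, d.out x = true ∧ d.time x = s ∧ d.pos x = i := by
  obtain ⟨x, hx, rfl, rfl⟩ := d.inner s i h
  have h1 : d.time x ≠ f.length + 1 := by
    have := (pos_of_factorAt_ne h).2
    omega
  exact ⟨nx.symm x, (d.symm_of_in hx h1).1, d.time_symm x, (d.symm_of_in hx h1).2⟩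

theorem exists_of (s : ℕ) (i : Fin n) (b : Bool) (h : factorAt f s i ≠ i ∨ (b = true ∧ s = 0) ∨
    (b = false ∧ s = f.length + 1)) : ∃ x, d.time x = s ∧ d.pos x = i ∧ d.out x = b := by
  rcases h with h | ⟨rfl, rfl⟩ | ⟨rfl, rfl⟩
  · rcases b
    · obtain ⟨x, h1, h2, h3⟩ := d.inner s i h
      exact ⟨x, h2, h3, h1⟩
    · obtain ⟨x, h1, h2, h3⟩ := d.exists_out h
      exact ⟨x, h2, h3, h1⟩
  · obtain ⟨x, h1, h2, h3⟩ := d.source i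
    exact ⟨x, h2, h3, h1⟩
  · obtain ⟨x, h1, h2, h3⟩ := d.sink i
    exact ⟨x, h2, h3, h1⟩

theorem coord (x : D) : factorAt f (d.time x) (d.pos x) ≠ d.pos x ∨
    (d.out x = true ∧ d.time x = 0) ∨ (d.out x = false ∧ d.time x = f.length + 1) := by
  by_cases h0 : d.time x = 0
  · exact .inr (.inl ⟨d.out_of_time_zero h0, h0⟩)
  by_cases h1 : d.time x = f.length + 1
  · exact .inr (.inr ⟨d.in_of_time_last h1, h1⟩)
  exact .inl (d.moved h0 h1)

/-- An edge leads from a vertex to the next vertex on its line: a shortest counterexample gives rise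
to a shorter one, since the edge that arrives at a skipped vertex must itself skip one. -/
theorem no_dart_between (x y : D) (hx : d.out x = true) (hy : d.out y = false)
    (hp : d.pos y = d.pos x) (h1 : d.time x < d.time y) : d.time (op x) ≤ d.time y := by
  induction hτ : d.time y using Nat.strong_induction_on generalizing x y with
  | _ τ ih =>
    subst hτ
    by_contra! h2
    have hz := d.out_op_of_in hy
    have hzt := d.time_op_lt hy
    rcases lt_trichotomy (d.time (op y)) (d.time x) with hlt | heq | hgt
    · obtain ⟨-, ho, hpn⟩ := d.out_inner hx (by omega)
      have := ih (d.time x) (by omega) (op y) (nx x) hz ho (by rw [hpn, d.pos_op, hp])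
        (by rw [d.time_nx]; omega) (d.time_nx x)
      rw [d.op_op] at this
      omega
    · have := d.inj (op y) x heq (by rw [d.pos_op, hp]) (by rw [hz, hx])
      rw [← this, d.op_op] at h2
      exact lt_irrefl _ h2
    · obtain ⟨-, ho, hpn⟩ := d.out_inner hz (by omega)
      have := ih (d.time (op y)) (by omega) x (nx (op y)) hx ho (by rw [hpn, d.pos_op, hp])
        (by rw [d.time_nx]; omega) (d.time_nx _)
      omega

theorem fixed_between {x : D} (hx : d.out x = true) {s : ℕ} (h1 : d.time x < s)
    (h2 : s < d.time (op x)) : factorAt f s (d.pos x) = d.pos x := by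
  by_contra h
  obtain ⟨y, hy, hs, hp⟩ := d.inner s _ h
  have := d.no_dart_between x y hx hy hp (by omega)
  omega

end Basic

section Iso

variable {D E : Type} {n : ℕ} {nx op : Equiv.Perm D} {nx' op' : Equiv.Perm E}
  {f : List (Equiv.Perm (Fin n))} (d : Drawing nx op f) (e : Drawing nx' op' f)

/-- The time of the next vertex on a line is the same in any two drawings of `f`; here, one of the
two inequalities. -/
theorem time_op_le (x : D) (y : E) (hx : d.out x = true) (ht : e.time y = d.time x)
    (hp : e.pos y = d.pos x) (ho : e.out y = d.out x) :
    d.time (op x) ≤ e.time (op' y) := by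
  by_contra! h
  rw [hx] at ho
  have h1 := e.time_lt y ho
  have h2 := d.fixed_between hx (ht ▸ h1) h
  rcases e.coord (op' y) with h3 | h3 | h3
  · rw [e.pos_op, hp] at h3
    exact h3 h2
  · omega
  · have := d.time_le (op x)
    omega

/-- A factorization can be drawn in at most one way. -/
theorem exists_equiv : ∃ φ : D ≃ E, (∀ x, φ (nx x) = nx' (φ x)) ∧ (∀ x, φ (op x) = op' (φ x)) ∧
    (∀ x, e.time (φ x) = d.time x) ∧ (∀ x, e.pos (φ x) = d.pos x) ∧
    (∀ x, e.out (φ x) = d.out x) := by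
  choose φ ht hp ho using fun x => e.exists_of _ _ _ (d.coord x)
  have hb : Function.Bijective φ := by
    constructor
    · intro x y h
      exact d.inj _ _ (by rw [← ht, h, ht]) (by rw [← hp, h, hp]) (by rw [← ho, h, ho])
    · intro y
      obtain ⟨x, h1, h2, h3⟩ := d.exists_of _ _ _ (e.coord y)
      exact ⟨x, e.inj _ _ ((ht x).trans h1) ((hp x).trans h2) ((ho x).trans h3)⟩
  have hout : ∀ x, d.out x = true → φ (op x) = op' (φ x) := by
    intro x hx
    refine e.inj _ _ ?_ ?_ ?_
    · rw [ht]
      refine le_antisymm (d.time_op_le e x (φ x) hx (ht x) (hp x) (ho x)) ?_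
      exact e.time_op_le d (φ x) x ((ho x).trans hx) (ht x).symm (hp x).symm (ho x).symm
    · rw [hp, d.pos_op, e.pos_op, hp]
    · rw [ho, d.out_op, e.out_op, ho]
  refine ⟨Equiv.ofBijective φ hb, fun x => ?_, fun x => ?_, ht, hp, ho⟩
  · change φ (nx x) = nx' (φ x)
    by_cases h0 : nx x = x
    · have h1 := (d.nx_eq_self_iff x).1 h0
      rw [← ht, ← e.nx_eq_self_iff] at h1
      rw [h0, h1]
    · have h1 : ¬ (d.time x = 0 ∨ d.time x = f.length + 1) := fun h => h0 ((d.nx_eq_self_iff x).2 h)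
      push Not at h1
      have h2 := h1
      rw [← ht] at h2
      refine e.inj _ _ (by rw [ht, d.time_nx, e.time_nx, ht]) ?_
        (by rw [ho, d.out_nx h1.1 h1.2, e.out_nx h2.1 h2.2, ho])
      rcases hx : d.out x
      · have h3 := (d.in_inner hx h1.2).2.2
        have h4 := (e.in_inner ((ho x).trans hx) h2.2).2.2
        rw [ht, hp, ← h3] at h4
        rw [hp]
        exact ((factorAt f (d.time x)).injective h4).symm
      · rw [hp, (d.out_inner hx h1.1).2.2, (e.out_inner ((ho x).trans hx) h2.1).2.2, hp]
  · change φ (op x) = op' (φ x)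
    rcases hx : d.out x
    · have := hout (op x) (d.out_op_of_in hx)
      rw [d.op_op] at this
      rw [this, e.op_op]
    · exact hout x hx

/-- A drawing is carried along an isomorphism. -/
def map (φ : D ≃ E) (hnx : ∀ x, φ (nx x) = nx' (φ x)) (hop : ∀ x, φ (op x) = op' (φ x)) :
    Drawing nx' op' f := by
  have hnx' : ∀ y, φ.symm (nx' y) = nx (φ.symm y) := fun y => by
    rw [Equiv.symm_apply_eq, hnx, Equiv.apply_symm_apply]
  have hop' : ∀ y, φ.symm (op' y) = op (φ.symm y) := fun y => by
    rw [Equiv.symm_apply_eq, hop, Equiv.apply_symm_apply]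
  refine
    { time := fun y => d.time (φ.symm y)
      pos := fun y => d.pos (φ.symm y)
      out := fun y => d.out (φ.symm y)
      op_op := fun y => ?_
      out_op := fun y => by rw [hop', d.out_op]
      pos_op := fun y => by rw [hop', d.pos_op]
      time_lt := fun y hy => by rw [hop']; exact d.time_lt _ hy
      time_nx := fun y => by rw [hnx', d.time_nx]
      nx_of_out := fun y hy => ?_
      nx_of_in := fun y hy => ?_
      inj := fun x y h1 h2 h3 => φ.symm.injective (d.inj _ _ h1 h2 h3)
      source := fun i => ?_
      sink := fun i => ?_
      inner := fun s i h => ?_ }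
  · apply φ.symm.injective
    rw [hop', hop', d.op_op]
  · rw [hnx', ← φ.symm.injective.eq_iff, hnx']
    exact d.nx_of_out _ hy
  · rw [hnx', ← φ.symm.injective.eq_iff, hnx']
    exact d.nx_of_in _ hy
  · obtain ⟨x, h⟩ := d.source i
    exact ⟨φ x, by simpa using h⟩
  · obtain ⟨x, h⟩ := d.sink i
    exact ⟨φ x, by simpa using h⟩
  · obtain ⟨x, h'⟩ := d.inner s i h
    exact ⟨φ x, by simpa using h'⟩

end Iso

section Swap

variable {D : Type} {n : ℕ} {nx op : Equiv.Perm D}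

theorem factorAt_swap (l₁ l₂ : List (Equiv.Perm (Fin n))) (σ τ : Equiv.Perm (Fin n)) (s : ℕ) :
    factorAt (l₁ ++ τ :: σ :: l₂) (Equiv.swap (l₁.length + 1) (l₁.length + 2) s) =
      factorAt (l₁ ++ σ :: τ :: l₂) s := by
  rcases eq_or_ne s (l₁.length + 1) with rfl | h1
  · rw [Equiv.swap_apply_left, factorAt_succ, factorAt_succ]
    simp
  rcases eq_or_ne s (l₁.length + 2) with rfl | h2
  · rw [Equiv.swap_apply_right, factorAt_succ, factorAt_succ]
    simp
  rw [Equiv.swap_apply_of_ne_of_ne h1 h2]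
  rcases s with _ | s
  · rfl
  rw [factorAt_succ, factorAt_succ]
  rcases lt_or_ge s l₁.length with h | h
  · rw [List.getD_append _ _ _ _ h, List.getD_append _ _ _ _ h]
  · obtain ⟨k, rfl⟩ : ∃ k, s = l₁.length + (k + 2) := ⟨s - l₁.length - 2, by omega⟩
    rw [List.getD_append_right _ _ _ _ h, List.getD_append_right _ _ _ _ h]
    simp

/-- Swapping adjacent disjoint factors only exchanges the times of their vertices, as no edge joins
these. -/
theorem exists_swap {f f' : List (Equiv.Perm (Fin n))} (h : SwapStep f f') (d : Drawing nx op f) :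
    ∃ d' : Drawing nx op f', d'.pos = d.pos ∧ d'.out = d.out := by
  obtain ⟨l₁, l₂, σ, τ, hd⟩ := h
  set a := l₁.length + 1 with ha
  have hsw : ∀ s, factorAt (l₁ ++ τ :: σ :: l₂) (Equiv.swap a (a + 1) s) =
      factorAt (l₁ ++ σ :: τ :: l₂) s := factorAt_swap l₁ l₂ σ τ
  have hσ : factorAt (l₁ ++ σ :: τ :: l₂) a = σ := by
    rw [ha, factorAt_succ]; simp
  have hτ : factorAt (l₁ ++ σ :: τ :: l₂) (a + 1) = τ := by
    rw [ha, factorAt_succ]; simp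
  have hlen : (l₁ ++ τ :: σ :: l₂).length = (l₁ ++ σ :: τ :: l₂).length := by simp
  have hlen' : a + 1 ≤ (l₁ ++ σ :: τ :: l₂).length := by simp [ha]
  have h0 : Equiv.swap a (a + 1) 0 = 0 :=
    Equiv.swap_apply_of_ne_of_ne (by omega) (by omega)
  have h1 : Equiv.swap a (a + 1) ((l₁ ++ σ :: τ :: l₂).length + 1) =
      (l₁ ++ σ :: τ :: l₂).length + 1 :=
    Equiv.swap_apply_of_ne_of_ne (by omega) (by omega)
  have hi0 : ∀ s, Equiv.swap a (a + 1) s = 0 ↔ s = 0 := fun s => by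
    rw [← Equiv.apply_eq_iff_eq (Equiv.swap a (a + 1)) (x := s), h0]
  have hi1 : ∀ s, Equiv.swap a (a + 1) s = (l₁ ++ τ :: σ :: l₂).length + 1 ↔
      s = (l₁ ++ σ :: τ :: l₂).length + 1 := fun s => by
    rw [← Equiv.apply_eq_iff_eq (Equiv.swap a (a + 1)) (x := s), h1, hlen]
  refine ⟨
    { time := fun x => Equiv.swap a (a + 1) (d.time x)
      pos := d.pos
      out := d.out
      op_op := d.op_op
      out_op := d.out_op
      pos_op := d.pos_op
      time_lt := fun x hx => ?_
      time_nx := fun x => by rw [d.time_nx]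
      nx_of_out := fun x hx => by rw [hsw, hi0]; exact d.nx_of_out x hx
      nx_of_in := fun x hx => by rw [hsw, hi1]; exact d.nx_of_in x hx
      inj := fun x y h => d.inj x y (by simpa using h)
      source := fun i => by simp only [hi0]; exact d.source i
      sink := fun i => by simp only [hi1]; exact d.sink i
      inner := fun s i h => ?_ }, rfl, rfl⟩
  · have hlt := d.time_lt x hx
    -- The swap reverses the order of `a` and `a + 1` only, and a line through both vertices would
    -- have a position moved by both factors.
    have hne : ¬ (d.time x = a ∧ d.time (op x) = a + 1) := by
      rintro ⟨h2, h3⟩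
      have m1 := (d.out_inner hx (by omega)).1
      have m2 := (d.in_inner (d.out_op_of_out hx) (by omega)).1
      rw [h2, hσ] at m1
      rw [h3, hτ, d.pos_op] at m2
      rcases hd (d.pos x) with h | h
      · exact m1 h
      · exact m2 h
    simp only [Equiv.swap_apply_def]
    split_ifs <;> omega
  · rw [← Equiv.swap_apply_self a (a + 1) s, hsw] at h
    obtain ⟨x, h2, h3, h4⟩ := d.inner _ i h
    exact ⟨x, h2, by rw [h3, Equiv.swap_apply_self], h4⟩

end Swap

end Drawing

/-! ### Orbits -/

/-- The points `x` and `y` lie in the same orbit of the group generated by `S`. -/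
def Linked {X : Type*} (S : Set (Equiv.Perm X)) (x y : X) : Prop :=
  ∃ ρ ∈ Subgroup.closure S, ρ x = y

namespace Linked

variable {X : Type*} {S : Set (Equiv.Perm X)}

theorem refl (x : X) : Linked S x x := ⟨1, one_mem _, rfl⟩

theorem symm {x y : X} (h : Linked S x y) : Linked S y x := by
  obtain ⟨ρ, hρ, rfl⟩ := h
  exact ⟨ρ⁻¹, inv_mem hρ, by simp⟩

theorem trans {x y z : X} (h : Linked S x y) (h' : Linked S y z) : Linked S x z := by
  obtain ⟨ρ, hρ, rfl⟩ := h
  obtain ⟨τ, hτ, rfl⟩ := h'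
  exact ⟨τ * ρ, mul_mem hτ hρ, rfl⟩

theorem of_mem {ρ : Equiv.Perm X} (h : ρ ∈ S) (x : X) : Linked S x (ρ x) :=
  ⟨ρ, Subgroup.subset_closure h, rfl⟩

/-- An equivalence relation that contains the steps by generators contains `Linked`. -/
theorem induct {r : X → X → Prop} (hr : Equivalence r) (h : ∀ ρ ∈ S, ∀ x, r x (ρ x)) {x y : X}
    (hxy : Linked S x y) : r x y := by
  obtain ⟨ρ, hρ, rfl⟩ := hxy
  induction hρ using Subgroup.closure_induction generalizing x with
  | mem ρ hm => exact h ρ hm x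
  | one => exact hr.refl _
  | mul a b _ _ ha hb => exact hr.trans hb ha
  | inv a _ ha =>
    have := ha (x := a⁻¹ x)
    rw [show a (a⁻¹ x) = x by simp] at this
    exact hr.symm this

theorem of_sameCycle {ρ : Equiv.Perm X} {x y : X} (h : ρ.SameCycle x y) : Linked {ρ} x y := by
  obtain ⟨k, hk⟩ := h
  exact ⟨ρ ^ k, zpow_mem (Subgroup.subset_closure (Set.mem_singleton ρ)) k, hk⟩

end Linked

theorem sameCycle_induct {X : Type*} {ρ : Equiv.Perm X} {r : X → X → Prop} (hr : Equivalence r)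
    (h : ∀ x, r x (ρ x)) {x y : X} (hxy : ρ.SameCycle x y) : r x y :=
  Linked.induct hr (fun τ hτ x => by rw [Set.mem_singleton_iff.1 hτ]; exact h x)
    (Linked.of_sameCycle hxy)

/-- The classes of a setoid are counted by a system of representatives. -/
theorem natCard_quotient_eq {X T : Type*} (s : Setoid X) (Ψ : T → X)
    (hinj : ∀ a b, s (Ψ a) (Ψ b) → a = b) (hsurj : ∀ x, ∃ a, s (Ψ a) x) :
    Nat.card (Quotient s) = Nat.card T := by
  refine (Nat.card_congr (Equiv.ofBijective (fun a => Quotient.mk s (Ψ a)) ⟨?_, ?_⟩)).symm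
  · intro a b h
    exact hinj a b (Quotient.exact h)
  · intro q
    induction q using Quotient.inductionOn with
    | h x =>
      obtain ⟨a, ha⟩ := hsurj x
      exact ⟨a, Quotient.sound ha⟩

theorem natCard_sameCycle {X : Type*} [Finite X] (ρ : Equiv.Perm X) (x : X) :
    Nat.card {y // ρ.SameCycle y x} = Function.minimalPeriod ρ x := by
  have := Fintype.ofFinite X
  classical
  change _ = Function.minimalPeriod (ρ • ·) x
  rw [MulAction.minimalPeriod_eq_card, ← Nat.card_eq_fintype_card]
  refine Nat.card_congr (Equiv.subtypeEquivRight fun y => ?_)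
  rw [MulAction.mem_orbit_iff]
  constructor
  · intro h
    obtain ⟨k, hk⟩ := h.symm
    exact ⟨⟨ρ ^ k, k, rfl⟩, hk⟩
  · rintro ⟨⟨_, k, rfl⟩, hk⟩
    exact SameCycle.symm ⟨k, hk⟩

section Signature

variable {n : ℕ}

theorem signature_eq_card (f : List (Equiv.Perm (Fin n))) (hc : ∀ σ ∈ f, σ.IsCycle) (k : ℕ) :
    signature f k = Nat.card {s : Fin f.length // f[s].support.card = k} := by
  have h1 : signature f k = ∑ s : Fin f.length, f[s].cycleType.count k := by
    rw [signature, ← Fin.sum_univ_fun_getElem]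
    rfl
  rw [h1, Nat.card_eq_fintype_card, Fintype.card_subtype, Finset.card_filter]
  refine Finset.sum_congr rfl fun s _ => ?_
  rw [(hc f[s] (List.getElem_mem _)).cycleType, Multiset.count_singleton]
  simp [eq_comm]

theorem depth_eq_sum (f : List (Equiv.Perm (Fin n))) (hc : ∀ σ ∈ f, σ.IsCycle) :
    depth f + f.length = ∑ s : Fin f.length, f[s].support.card := by
  have h1 : depth f = ∑ s : Fin f.length, (f[s].support.card - 1) := by
    have : ∀ s : Fin f.length, f[s].support.card - 1 = (f[s].cycleType.map fun j => j - 1).sum := by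
      intro s
      rw [(hc f[s] (List.getElem_mem _)).cycleType]
      simp
    rw [Finset.sum_congr rfl fun s _ => this s, depth, ← Fin.sum_univ_fun_getElem]
    rfl
  rw [h1]
  have h2 : f.length = ∑ _s : Fin f.length, 1 := by simp
  conv_lhs => rhs; rw [h2]
  rw [← Finset.sum_add_distrib]
  refine Finset.sum_congr rfl fun s _ => ?_
  have := (hc f[s] (List.getElem_mem _)).two_le_card_support
  omega

end Signature

namespace Drawing

variable {D : Type} {n : ℕ} {nx op : Equiv.Perm D} {f : List (Equiv.Perm (Fin n))}
  (d : Drawing nx op f)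

theorem nx_nx_of_in {x : D} (h : d.out x = false) (h1 : d.time x ≠ f.length + 1) :
    d.out (nx (nx x)) = false ∧ d.pos (nx (nx x)) = (factorAt f (d.time x))⁻¹ (d.pos x) := by
  obtain ⟨-, h2, h3⟩ := d.in_inner h h1
  have := d.time_pos_of_in h
  obtain ⟨-, h4, h5⟩ := d.out_inner h2 (by rw [d.time_nx]; omega)
  exact ⟨h4, by rw [h5, Equiv.Perm.eq_inv_iff_eq, h3]⟩

theorem nx_pow_of_in {x : D} (h : d.out x = false) (h1 : d.time x ≠ f.length + 1) (k : ℕ) :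
    d.out ((nx ^ (2 * k)) x) = false ∧ d.time ((nx ^ (2 * k)) x) = d.time x ∧
      d.pos ((nx ^ (2 * k)) x) = ((factorAt f (d.time x))⁻¹ ^ k) (d.pos x) := by
  induction k with
  | zero => simp [h]
  | succ k ih =>
    obtain ⟨i1, i2, i3⟩ := ih
    have : (nx ^ (2 * (k + 1))) x = nx (nx ((nx ^ (2 * k)) x)) := by
      rw [show 2 * (k + 1) = 1 + 1 + 2 * k by ring, pow_add, pow_add]; rfl
    rw [this, d.time_nx, d.time_nx]
    obtain ⟨j1, j2⟩ := d.nx_nx_of_in i1 (by rw [i2]; exact h1)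
    refine ⟨j1, i2, ?_⟩
    rw [j2, i2, i3, pow_succ', Equiv.Perm.mul_apply]

theorem sameCycle_nx_of_time_eq (hc : ∀ σ ∈ f, σ.IsCycle) {x y : D} (h : d.time x = d.time y)
    (h0 : d.time x ≠ 0) (h1 : d.time x ≠ f.length + 1) : nx.SameCycle x y := by
  have key : ∀ x y, d.out x = false → d.out y = false → d.time x = d.time y →
      d.time x ≠ f.length + 1 → nx.SameCycle x y := by
    intro x y hx hy h h1
    have m1 := (d.in_inner hx h1).1
    have m2 := (d.in_inner hy (h ▸ h1)).1
    rw [← h] at m2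
    have hcyc := hc _ (factorAt_mem (d.time_pos_of_in hx) (pos_of_factorAt_ne m1).2)
    obtain ⟨k, -, hk⟩ := (hcyc.sameCycle m1 m2).inv.exists_pow_eq''
    obtain ⟨-, hk⟩ := hk
    obtain ⟨i1, i2, i3⟩ := d.nx_pow_of_in hx h1 k
    refine ⟨(2 * k : ℕ), d.inj _ _ ?_ ?_ ?_⟩
    · rw [zpow_natCast, i2, h]
    · rw [zpow_natCast, i3, hk]
    · rw [zpow_natCast, i1, hy]
  have toIn : ∀ x, d.time x ≠ 0 → d.time x ≠ f.length + 1 →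
      ∃ y, d.out y = false ∧ d.time y = d.time x ∧ nx.SameCycle x y := by
    intro x h0 h1
    rcases hx : d.out x
    · exact ⟨x, hx, rfl, SameCycle.refl _ _⟩
    · exact ⟨nx x, (d.out_inner hx h0).2.1, d.time_nx x, (sameCycle_apply_right).2 (.refl _ _)⟩
  obtain ⟨x', a1, a2, a3⟩ := toIn x h0 h1
  obtain ⟨y', b1, b2, b3⟩ := toIn y (h ▸ h0) (h ▸ h1)
  exact a3.trans ((key x' y' a1 b1 (by rw [a2, b2, h]) (by rw [a2]; exact h1)).trans b3.symm)

theorem time_eq_of_sameCycle {x y : D} (h : nx.SameCycle x y) : d.time x = d.time y :=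
  sameCycle_induct (r := fun x y => d.time x = d.time y) ⟨fun _ => rfl, Eq.symm, Eq.trans⟩
    (fun x => (d.time_nx x).symm) h

theorem sameCycle_nx_iff (hc : ∀ σ ∈ f, σ.IsCycle) (x y : D) : nx.SameCycle x y ↔
    x = y ∨ (d.time x = d.time y ∧ d.time x ≠ 0 ∧ d.time x ≠ f.length + 1) := by
  constructor
  · intro h
    by_cases hx : nx x = x
    · obtain ⟨k, rfl⟩ := h
      exact .inl (zpow_apply_eq_self_of_apply_eq_self hx k).symm
    · rw [d.nx_eq_self_iff] at hx
      push Not at hx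
      exact .inr ⟨d.time_eq_of_sameCycle h, hx⟩
  · rintro (rfl | ⟨h, h0, h1⟩)
    · exact .refl _ _
    · exact d.sameCycle_nx_of_time_eq hc h h0 h1

theorem sameCycle_op_iff (d : Drawing nx op f) (x y : D) : op.SameCycle x y ↔ x = y ∨ op x = y := by
  constructor
  · rintro ⟨k, rfl⟩
    have h2 : op ^ (2 : ℤ) = 1 := by
      ext z; rw [zpow_two]; exact d.op_op z
    rcases Int.even_or_odd' k with ⟨j, rfl | rfl⟩
    · left; rw [zpow_mul, h2, one_zpow]; rfl
    · right; rw [zpow_add, zpow_mul, h2, one_zpow, one_mul, zpow_one]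
  · rintro (rfl | rfl)
    · exact .refl _ _
    · exact sameCycle_apply_right.2 (.refl _ _)

/-! ### Orbits of positions and of darts -/

/-- Every dart can be linked to the source of its line, by following the line backwards. -/
theorem linked_source (x : D) : ∃ y, d.time y = 0 ∧ d.pos y = d.pos x ∧ Linked {nx, op} x y := by
  induction ht : d.time x using Nat.strong_induction_on generalizing x with
  | _ t ih =>
    subst ht
    rcases hx : d.out x
    · obtain ⟨y, h1, h2, h3⟩ := ih _ (d.time_op_lt hx) (op x) rfl
      exact ⟨y, h1, h2.trans (d.pos_op x), (Linked.of_mem (by simp) x).trans h3⟩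
    · by_cases h0 : d.time x = 0
      · exact ⟨x, h0, rfl, .refl _⟩
      · obtain ⟨-, h1, h2⟩ := d.out_inner hx h0
        obtain ⟨y, h3, h4, h5⟩ := ih (d.time (op (nx x))) (by
          have := d.time_op_lt h1
          rwa [d.time_nx] at this) _ rfl
        refine ⟨y, h3, by rw [h4, d.pos_op, h2], ?_⟩
        exact ((Linked.of_mem (by simp) x).trans (Linked.of_mem (by simp) (nx x))).trans h5

theorem linked_of_pos_eq {x y : D} (h : d.pos x = d.pos y) : Linked {nx, op} x y := by
  obtain ⟨x', h1, h2, h3⟩ := d.linked_source x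
  obtain ⟨y', h4, h5, h6⟩ := d.linked_source y
  have : x' = y' := d.inj _ _ (h1.trans h4.symm) (by rw [h2, h5, h])
    (by rw [d.out_of_time_zero h1, d.out_of_time_zero h4])
  exact h3.trans (this ▸ h6.symm)

theorem connected_of_isTransitive (d : Drawing nx op f) (ht : IsTransitive f) (x y : D) :
    Linked {nx, op} x y := by
  have key : ∀ i j, Linked {σ | σ ∈ f} i j → ∀ x y, d.pos x = i → d.pos y = j →
      Linked {nx, op} x y := by
    intro i j hij
    refine Linked.induct (r := fun i j => ∀ x y, d.pos x = i → d.pos y = j →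
      Linked {nx, op} x y) ⟨?_, ?_, ?_⟩ ?_ hij
    · intro i x y hx hy
      exact d.linked_of_pos_eq (hx.trans hy.symm)
    · intro i j h x y hx hy
      exact (h y x hy hx).symm
    · intro i j k h h' x y hx hy
      obtain ⟨z, -, -, hz⟩ := d.source j
      exact (h x z hx hz).trans (h' z y hz hy)
    · intro σ hσ i x y hx hy
      by_cases hi : σ i = i
      · exact d.linked_of_pos_eq (by rw [hx, hy, hi])
      obtain ⟨s, hs, rfl⟩ := List.mem_iff_getElem.1 hσ
      rw [← factorAt_of_lt f s hs] at hi hy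
      have hi' : factorAt f (s + 1) (factorAt f (s + 1) i) ≠ factorAt f (s + 1) i :=
        fun h => hi ((factorAt f (s + 1)).injective h)
      obtain ⟨z, z1, z2, z3⟩ := d.inner _ _ hi'
      have hz := d.in_inner z1 (by omega)
      rw [z2, z3] at hz
      have hp : d.pos (nx z) = d.pos x := by
        rw [hx]; exact (factorAt f (s + 1)).injective hz.2.2
      exact ((d.linked_of_pos_eq hp.symm).trans (Linked.of_mem (by simp) z).symm).trans
        (d.linked_of_pos_eq (z3.trans hy.symm))
  exact key _ _ (ht (d.pos x) (d.pos y)) x y rfl rfl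

theorem isTransitive_of_connected (d : Drawing nx op f) (h : ∀ x y : D, Linked {nx, op} x y) :
    IsTransitive f := by
  intro i j
  obtain ⟨x, -, -, rfl⟩ := d.source i
  obtain ⟨y, -, -, rfl⟩ := d.source j
  change Linked {σ | σ ∈ f} (d.pos x) (d.pos y)
  refine Linked.induct (r := fun x y => Linked {σ | σ ∈ f} (d.pos x) (d.pos y))
    ⟨fun _ => .refl _, fun h => h.symm, fun h h' => h.trans h'⟩ ?_ (h x y)
  rintro ρ hρ x
  rcases hρ with rfl | rfl
  · by_cases hx : ρ x = x
    · rw [hx]; exact .refl _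
    rw [d.nx_eq_self_iff] at hx
    push Not at hx
    rcases ho : d.out x
    · have h1 := d.in_inner ho hx.2
      have h2 := Linked.of_mem (S := {σ | σ ∈ f})
        (factorAt_mem (by omega) (pos_of_factorAt_ne h1.1).2) (d.pos (ρ x))
      rw [h1.2.2] at h2
      exact h2.symm
    · rw [(d.out_inner ho hx.1).2.2]; exact .refl _
  · rw [d.pos_op]; exact .refl _

/-! ### Faces -/

/-- The label of a dart: its position, if it is directed into its vertex, and otherwise the position
of the source from which the face on its right is reached by following the directions. -/
def label (x : D) : Fin n := if d.out x then (f.take (d.time x)).prod (d.pos x) else d.pos x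

theorem label_of_in {x : D} (h : d.out x = false) : d.label x = d.pos x := by
  simp [label, h]

theorem label_of_out {x : D} (h : d.out x = true) :
    d.label x = (f.take (d.time x)).prod (d.pos x) := by
  simp [label, h]

theorem label_source {x : D} (h : d.time x = 0) : d.label x = d.pos x := by
  rw [d.label_of_out (d.out_of_time_zero h), h]; simp

theorem label_op_of_in {x : D} (h : d.out x = false) :
    d.label (op x) = (f.take (d.time x - 1)).prod (d.pos x) := by
  have h1 := d.out_op_of_in h
  have h2 := d.time_op_lt h
  rw [d.label_of_out h1, d.pos_op]
  symm
  refine prod_take_eq f _ (by omega) fun u h3 h4 => ?_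
  have := d.fixed_between h1 h3 (by rw [d.op_op]; omega)
  rwa [d.pos_op] at this

theorem out_face_of_in {x : D} (h : d.out x = false) (h0 : d.time (op x) ≠ 0) :
    d.out (nx (op x)) = false :=
  (d.out_inner (d.out_op_of_in h) h0).2.1

theorem label_face_of_in {x : D} (h : d.out x = false) : d.label (nx (op x)) = d.label x := by
  have h1 := d.out_op_of_in h
  by_cases h0 : d.time (op x) = 0
  · rw [d.nx_source h0, d.label_source h0, d.pos_op, d.label_of_in h]
  · rw [d.label_of_in (d.out_face_of_in h h0), (d.out_inner h1 h0).2.2, d.pos_op, d.label_of_in h]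

theorem label_nx_of_in {x : D} (h : d.out x = false) (h1 : d.time x ≠ f.length + 1) :
    d.label (nx x) = d.label (op x) := by
  obtain ⟨m, h2, h3⟩ := d.in_inner h h1
  rw [d.label_op_of_in h, d.label_of_out h2, d.time_nx,
    take_factorAt f (d.time_pos_of_in h) (pos_of_factorAt_ne m).2]
  simp [h3]

theorem label_op_sink {x : D} (h : d.time x = f.length + 1) :
    d.label (op x) = f.prod (d.label x) := by
  have := d.in_of_time_last h
  rw [d.label_op_of_in this, d.label_of_in this, h]
  simp

theorem label_face_of_out {x : D} (h : d.out x = true) (h1 : d.time (op x) ≠ f.length + 1) :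
    d.label (nx (op x)) = d.label x := by
  rw [d.label_nx_of_in (d.out_op_of_out h) h1, d.op_op]

/-- Along a face the label changes only at the sinks, where `π⁻¹` is applied. -/
theorem label_eq (x : D) : d.label x =
    if d.out x = true ∧ d.out (nx (op x)) = false then f.prod (d.label (nx (op x)))
    else d.label (nx (op x)) := by
  rcases hx : d.out x
  · simp [d.label_face_of_in hx]
  · by_cases h1 : d.time (op x) = f.length + 1
    · have h2 := d.label_op_sink h1
      rw [d.op_op] at h2
      simp [d.nx_sink h1, d.out_op_of_out hx, h2]
    · simp [(d.in_inner (d.out_op_of_out hx) h1).2.1, d.label_face_of_out hx h1]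

theorem sameCycle_label_of_sameCycle {x y : D} (h : (nx * op).SameCycle x y) :
    f.prod.SameCycle (d.label x) (d.label y) := by
  refine sameCycle_induct (r := fun x y => f.prod.SameCycle (d.label x) (d.label y))
    ⟨fun _ => .refl _ _, fun h => h.symm, fun h h' => h.trans h'⟩ (fun x => ?_) h
  rw [d.label_eq x, Equiv.Perm.mul_apply]
  split_ifs
  · exact sameCycle_apply_left.2 (.refl _ _)
  · exact .refl _ _

/-- Every face walk passes through the source that has the same label. -/
theorem sameCycle_face_source (x : D) :
    ∃ y, d.time y = 0 ∧ d.label y = d.label x ∧ (nx * op).SameCycle x y := by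
  have step : ∀ x, (nx * op).SameCycle x (nx (op x)) := fun x =>
    sameCycle_apply_right.2 (.refl _ _)
  induction ht : d.time x using Nat.strong_induction_on generalizing x with
  | _ t ih =>
    subst ht
    rcases hx : d.out x
    · by_cases h0 : d.time (op x) = 0
      · refine ⟨op x, h0, ?_, ?_⟩
        · rw [d.label_source h0, d.pos_op, d.label_of_in hx]
        · have := step x
          rwa [d.nx_source h0] at this
      · obtain ⟨y, h1, h2, h3⟩ := ih (d.time (nx (op x)))
          (by rw [d.time_nx]; exact d.time_op_lt hx) _ rfl
        exact ⟨y, h1, h2.trans (d.label_face_of_in hx), (step x).trans h3⟩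
    · by_cases h0 : d.time x = 0
      · exact ⟨x, h0, rfl, .refl _ _⟩
      · set z := nx.symm x with hz
        have hxz : x = nx z := by simp [hz]
        have hl := d.time_le_of_out hx
        have hzt : d.time z = d.time x := d.time_symm x
        have hzi : d.out z = false := by
          have := d.out_nx (x := z) (by omega) (by omega)
          rw [← hxz, hx] at this
          simpa using this.symm
        obtain ⟨y, h1, h2, h3⟩ := ih (d.time (op z)) (hzt ▸ d.time_op_lt hzi) _ rfl
        refine ⟨y, h1, ?_, ?_⟩
        · rw [h2, hxz, d.label_nx_of_in hzi (by omega)]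
        · refine SameCycle.trans ?_ h3
          have := step (op z)
          rw [d.op_op, ← hxz] at this
          exact this.symm

theorem sameCycle_face_of_label_eq {x y : D} (h : d.label x = d.label y) :
    (nx * op).SameCycle x y := by
  obtain ⟨x', h1, h2, h3⟩ := d.sameCycle_face_source x
  obtain ⟨y', h4, h5, h6⟩ := d.sameCycle_face_source y
  have : x' = y' := d.inj _ _ (h1.trans h4.symm)
    (by rw [← d.label_source h1, ← d.label_source h4, h2, h5, h])
    (by rw [d.out_of_time_zero h1, d.out_of_time_zero h4])
  exact h3.trans (this ▸ h6.symm)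

/-- The faces of a drawing correspond to the cycles of the product. -/
theorem sameCycle_face_iff (x y : D) :
    (nx * op).SameCycle x y ↔ f.prod.SameCycle (d.label x) (d.label y) := by
  refine ⟨d.sameCycle_label_of_sameCycle, fun h => ?_⟩
  have key : ∀ i j, f.prod.SameCycle i j → ∀ x y, d.label x = i → d.label y = j →
      (nx * op).SameCycle x y := by
    intro i j hij
    refine sameCycle_induct (r := fun i j => ∀ x y, d.label x = i → d.label y = j →
      (nx * op).SameCycle x y) ⟨?_, ?_, ?_⟩ ?_ hij
    · intro i x y hx hy
      exact d.sameCycle_face_of_label_eq (hx.trans hy.symm)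
    · intro i j h x y hx hy
      exact (h y x hy hx).symm
    · intro i j k h h' x y hx hy
      obtain ⟨z, -, hz0, hz⟩ := d.source j
      rw [← d.label_source hz0] at hz
      exact (h x z hx hz).trans (h' z y hz hy)
    · intro i x y hx hy
      obtain ⟨z, hz, hz0, hzi⟩ := d.sink i
      have h1 : d.label z = i := by rw [d.label_of_in hz, hzi]
      have h2 := d.label_op_sink hz0
      have h3 : (nx * op).SameCycle (op z) z := by
        have : (nx * op) (op z) = z := by
          change nx (op (op z)) = z
          rw [d.op_op, d.nx_sink hz0]
        rw [← sameCycle_apply_left, this]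
      exact ((d.sameCycle_face_of_label_eq (hx.trans h1.symm)).trans h3.symm).trans
        (d.sameCycle_face_of_label_eq (by rw [h2, hy, h1]))
  exact key _ _ h x y rfl rfl

theorem exists_label_eq (i : Fin n) : ∃ x, d.time x = 0 ∧ d.label x = i := by
  obtain ⟨x, -, h0, hx⟩ := d.source i
  exact ⟨x, h0, by rw [d.label_source h0, hx]⟩

end Drawing

/-! ### Vertices, edges and faces of the map of a drawing -/

namespace SurfaceMap

variable (M : SurfaceMap)

theorem vertexOf_eq_iff {x y : M.Dart} :
    M.vertexOf x = M.vertexOf y ↔ M.next.SameCycle x y := Quotient.eq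

theorem edgeOf_eq_iff {x y : M.Dart} : M.edgeOf x = M.edgeOf y ↔ M.opp.SameCycle x y :=
  Quotient.eq

theorem faceOf_eq_iff {x y : M.Dart} :
    M.faceOf x = M.faceOf y ↔ M.faceNext.SameCycle x y := Quotient.eq

theorem vertexOf_next (x : M.Dart) : M.vertexOf (M.next x) = M.vertexOf x :=
  M.vertexOf_eq_iff.2 (sameCycle_apply_left.2 (.refl _ _))

theorem exists_vertexOf (v : M.Vertex) : ∃ x, M.vertexOf x = v := Quotient.exists_rep v

theorem exists_faceOf (v : M.Face) : ∃ x, M.faceOf x = v := Quotient.exists_rep v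

theorem isLeafDart_iff (x : M.Dart) : M.IsLeafDart x ↔ M.next x = x := by
  have := M.finite
  rw [IsLeafDart, degree, Nat.card_eq_one_iff_unique]
  constructor
  · rintro ⟨h, -⟩
    have := h.elim ⟨M.next x, M.vertexOf_next x⟩ ⟨x, rfl⟩
    simpa using this
  · intro h
    refine ⟨⟨?_⟩, ⟨⟨x, rfl⟩⟩⟩
    have key : ∀ y, M.vertexOf y = M.vertexOf x → y = x := by
      intro y hy
      obtain ⟨k, hk⟩ := (M.vertexOf_eq_iff.1 hy).symm
      rw [← hk, zpow_apply_eq_self_of_apply_eq_self h]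
    rintro ⟨y, hy⟩ ⟨z, hz⟩
    simp [key y hy, key z hz]

instance : Finite M.Vertex := by
  have := M.finite
  exact Quotient.finite _

end SurfaceMap

namespace Drawing

variable {M : SurfaceMap} {n : ℕ} {f : List (Equiv.Perm (Fin n))} (d : Drawing M.next M.opp f)

theorem isLeafDart_iff (x : M.Dart) :
    M.IsLeafDart x ↔ d.time x = 0 ∨ d.time x = f.length + 1 := by
  rw [M.isLeafDart_iff, d.nx_eq_self_iff]

theorem degree_inner (hc : ∀ σ ∈ f, σ.IsCycle) (x : M.Dart) (h0 : d.time x ≠ 0)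
    (h1 : d.time x ≠ f.length + 1) :
    M.degree (M.vertexOf x) = 2 * (factorAt f (d.time x)).support.card := by
  have key : ∀ y, M.vertexOf y = M.vertexOf x ↔ d.time y = d.time x := by
    intro y
    rw [M.vertexOf_eq_iff]
    exact ⟨fun h => d.time_eq_of_sameCycle h,
      fun h => d.sameCycle_nx_of_time_eq hc h (h ▸ h0) (h ▸ h1)⟩
  have hmv : ∀ y, M.vertexOf y = M.vertexOf x → d.pos y ∈ (factorAt f (d.time x)).support := by
    intro y hy
    rw [key] at hy
    rw [Equiv.Perm.mem_support, ← hy]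
    exact d.moved (hy ▸ h0) (hy ▸ h1)
  rw [SurfaceMap.degree, Nat.card_eq_of_bijective
    (fun y : {y : M.Dart // M.vertexOf y = M.vertexOf x} =>
      ((d.out y.1, ⟨d.pos y.1, hmv y.1 y.2⟩) : Bool × (factorAt f (d.time x)).support)) ⟨?_, ?_⟩]
  · rw [Nat.card_prod, Nat.card_eq_fintype_card, Fintype.card_bool, Nat.card_eq_fintype_card,
      Fintype.card_coe]
  · rintro ⟨y, hy⟩ ⟨z, hz⟩ h
    simp only [Prod.mk.injEq, Subtype.mk.injEq] at h
    rw [Subtype.mk.injEq]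
    exact d.inj y z (((key y).1 hy).trans ((key z).1 hz).symm) h.2 h.1
  · rintro ⟨b, i, hi⟩
    rw [Equiv.Perm.mem_support] at hi
    obtain ⟨y, h2, h3, h4⟩ := d.exists_of _ i b (.inl hi)
    exact ⟨⟨y, (key y).2 h2⟩, by simp [h3, h4]⟩

theorem degrees (d : Drawing M.next M.opp f) (hc : ∀ σ ∈ f, σ.IsCycle) (v : M.Vertex) :
    M.degree v = 1 ∨ (Even (M.degree v) ∧ 4 ≤ M.degree v) := by
  obtain ⟨x, rfl⟩ := M.exists_vertexOf v
  by_cases hx : M.IsLeafDart x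
  · exact .inl hx
  · rw [d.isLeafDart_iff] at hx
    push Not at hx
    have h := d.degree_inner hc x hx.1 hx.2
    have h2 := (hc _ (factorAt_mem (Nat.pos_of_ne_zero hx.1)
      (by have := d.time_le x; omega))).two_le_card_support
    exact .inr ⟨⟨_, h.trans (two_mul _)⟩, by omega⟩

theorem exists_time_eq (hc : ∀ σ ∈ f, σ.IsCycle) (s : Fin f.length) :
    ∃ x, d.out x = true ∧ d.time x = s + 1 := by
  obtain ⟨i, hi⟩ := exists_ne_of_ne_one (hc f[s] (List.getElem_mem _)).ne_one
  have h : factorAt f (s + 1) i ≠ i := by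
    rw [factorAt_of_lt f s s.2]; exact hi
  obtain ⟨x, h1, h2, -⟩ := d.exists_out h
  exact ⟨x, h1, h2⟩

theorem card_vertex (d : Drawing M.next M.opp f) (hc : ∀ σ ∈ f, σ.IsCycle) :
    Nat.card M.Vertex = 2 * n + f.length := by
  choose a ha1 ha2 ha3 using d.source
  choose b hb1 hb2 hb3 using d.sink
  choose c hc1 hc2 using d.exists_time_eq hc
  have key := d.sameCycle_nx_iff hc
  rw [SurfaceMap.Vertex, natCard_quotient_eq (T := (Fin n ⊕ Fin n) ⊕ Fin f.length) _
    (Sum.elim (Sum.elim a b) c)]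
  · simp only [Nat.card_eq_fintype_card, Fintype.card_sum, Fintype.card_fin]
    ring
  · intro u v h
    change M.next.SameCycle _ _ at h
    have ht := d.time_eq_of_sameCycle h
    rw [key] at h
    rcases u with (i | i) | s <;> rcases v with (j | j) | s' <;>
      simp only [Sum.elim_inl, Sum.elim_inr, ha2, hb2, hc2] at ht h
    · simp only [not_true_eq_false, ne_eq, false_and, and_false, or_false] at h
      rw [← ha3 i, ← ha3 j, h]
    · omega
    · omega
    · omega
    · simp only [not_true_eq_false, ne_eq, and_false, or_false] at h
      rw [← hb3 i, ← hb3 j, h]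
    · omega
    · omega
    · omega
    · rw [Fin.ext (show (s : ℕ) = s' by omega)]
  · intro x
    change ∃ u, M.next.SameCycle _ x
    by_cases h0 : d.time x = 0
    · refine ⟨.inl (.inl (d.pos x)), (key _ _).2 (.inl (d.inj _ _ ?_ ?_ ?_))⟩
      · exact (ha2 _).trans h0.symm
      · exact ha3 _
      · exact (ha1 _).trans (d.out_of_time_zero h0).symm
    by_cases h1 : d.time x = f.length + 1
    · refine ⟨.inl (.inr (d.pos x)), (key _ _).2 (.inl (d.inj _ _ ?_ ?_ ?_))⟩
      · exact (hb2 _).trans h1.symm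
      · exact hb3 _
      · exact (hb1 _).trans (d.in_of_time_last h1).symm
    · have := d.time_le x
      refine ⟨.inr ⟨d.time x - 1, by omega⟩, (key _ _).2 (.inr ?_)⟩
      simp only [Sum.elim_inr, hc2]
      omega

theorem card_edge (d : Drawing M.next M.opp f) (hc : ∀ σ ∈ f, σ.IsCycle) :
    Nat.card M.Edge = n + (depth f + f.length) := by
  choose a ha1 ha2 ha3 using d.source
  have hm : ∀ t : (s : Fin f.length) × f[s].support,
      factorAt f (t.1 + 1) t.2.1 ≠ t.2.1 := by
    rintro ⟨s, i, hi⟩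
    rw [factorAt_of_lt f s s.2]
    exact Equiv.Perm.mem_support.1 hi
  choose c hc1 hc2 hc3 using fun t => d.exists_out (hm t)
  have key := d.sameCycle_op_iff
  rw [SurfaceMap.Edge, natCard_quotient_eq (T := Fin n ⊕ (s : Fin f.length) × f[s].support) _
    (Sum.elim a c)]
  · rw [Nat.card_eq_fintype_card, Fintype.card_sum, Fintype.card_sigma, depth_eq_sum f hc]
    simp only [Fintype.card_fin, Fintype.card_coe]
  · intro u v h
    have ho : ∀ u, d.out (Sum.elim a c u) = true := by
      rintro (i | s)
      · exact ha1 i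
      · exact hc1 s
    have h' : Sum.elim a c u = Sum.elim a c v := by
      rcases (key _ _).1 h with h | h
      · exact h
      · have h2 := d.out_op_of_out (ho u)
        rw [h, ho] at h2
        simp at h2
    rcases u with i | t <;> rcases v with j | t' <;>
      simp only [Sum.elim_inl, Sum.elim_inr] at h'
    · rw [← ha3 i, ← ha3 j, h']
    · have := ha2 i
      rw [h', hc2] at this
      omega
    · have := ha2 j
      rw [← h', hc2] at this
      omega
    · have h1 := hc2 t
      have h2 := hc3 t
      rw [h', hc2] at h1
      rw [h', hc3] at h2
      obtain ⟨s, i, hi⟩ := t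
      obtain ⟨s', i', hi'⟩ := t'
      simp only [Nat.add_right_cancel_iff, Fin.val_inj] at h1 h2
      subst h1
      subst h2
      rfl
  · have hout : ∀ x, d.out x = true → ∃ u, Sum.elim a c u = x := by
      intro x hx
      by_cases h0 : d.time x = 0
      · exact ⟨.inl (d.pos x), d.inj _ _ ((ha2 _).trans h0.symm) (ha3 _) ((ha1 _).trans hx.symm)⟩
      · have h1 := d.time_le_of_out hx
        have h2 := (d.out_inner hx h0).1
        have h3 : d.time x - 1 + 1 = d.time x := by omega
        refine ⟨.inr ⟨⟨d.time x - 1, by omega⟩, d.pos x, ?_⟩, d.inj _ _ ?_ ?_ ?_⟩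
        · rw [← h3, factorAt_of_lt f _ (by omega)] at h2
          exact Equiv.Perm.mem_support.2 h2
        · simp only [Sum.elim_inr, hc2, h3]
        · simp only [Sum.elim_inr, hc3]
        · simp only [Sum.elim_inr, hc1, hx]
    intro x
    rcases hx : d.out x
    · obtain ⟨u, hu⟩ := hout _ (d.out_op_of_in hx)
      exact ⟨u, (key _ _).2 (.inr (by rw [hu, d.op_op]))⟩
    · obtain ⟨u, hu⟩ := hout _ hx
      exact ⟨u, (key _ _).2 (.inl hu)⟩

theorem card_vertex_degree (d : Drawing M.next M.opp f) (hc : ∀ σ ∈ f, σ.IsCycle) (k : ℕ)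
    (hk : 2 ≤ k) :
    Nat.card {v : M.Vertex // M.degree v = 2 * k} = signature f k := by
  choose c hc1 hc2 using d.exists_time_eq hc
  rw [signature_eq_card f hc]
  have hdeg : ∀ s, M.degree (M.vertexOf (c s)) = 2 * f[s].support.card := by
    intro s
    have := s.2
    rw [d.degree_inner hc _ (by rw [hc2]; omega) (by rw [hc2]; omega), hc2,
      factorAt_of_lt f s s.2]
    rfl
  have hmem : ∀ s : {s : Fin f.length // f[s].support.card = k},
      M.degree (M.vertexOf (c s)) = 2 * k := fun s => by rw [hdeg, s.2]
  refine (Nat.card_eq_of_bijective (fun s => ⟨M.vertexOf (c s.1), hmem s⟩) ⟨?_, ?_⟩).symm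
  · rintro ⟨s, hs⟩ ⟨s', hs'⟩ h
    rw [Subtype.mk.injEq] at h ⊢
    have := d.time_eq_of_sameCycle (M.vertexOf_eq_iff.1 h)
    simp only [hc2] at this
    exact Fin.ext (by omega)
  · rintro ⟨v, hv⟩
    obtain ⟨x, rfl⟩ := M.exists_vertexOf v
    have hx : ¬ M.IsLeafDart x := by
      intro h
      exact absurd (hv.symm.trans h) (by omega)
    rw [d.isLeafDart_iff] at hx
    push Not at hx
    have := d.time_le x
    have hv' : M.vertexOf (c ⟨d.time x - 1, by omega⟩) = M.vertexOf x := by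
      rw [M.vertexOf_eq_iff, d.sameCycle_nx_iff hc]
      right
      rw [hc2]
      simp only
      omega
    refine ⟨⟨⟨d.time x - 1, by omega⟩, ?_⟩, Subtype.ext hv'⟩
    have h := hdeg ⟨d.time x - 1, by omega⟩
    rw [hv', hv] at h
    omega

section Faces

variable {m : ℕ} {lam : Fin n → Fin m}

theorem faceOf_eq_iff (hlam : ∀ i j, lam i = lam j ↔ f.prod.SameCycle i j) (x y : M.Dart) :
    M.faceOf x = M.faceOf y ↔ lam (d.label x) = lam (d.label y) := by
  rw [hlam, ← d.sameCycle_face_iff, M.faceOf_eq_iff]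
  rfl

/-- The labelling of the faces by the cycles of the product. -/
noncomputable def faceEquiv (hlam : ∀ i j, lam i = lam j ↔ f.prod.SameCycle i j)
    (hs : Function.Surjective lam) : M.Face ≃ Fin m :=
  Equiv.ofBijective (Quotient.lift (s := SameCycle.setoid M.faceNext) (fun x => lam (d.label x))
    fun x y h => (d.faceOf_eq_iff hlam x y).1 (Quotient.sound h)) (by
  constructor
  · intro p q
    induction p using Quotient.inductionOn with | h x => ?_
    induction q using Quotient.inductionOn with | h y => ?_
    exact fun h => (d.faceOf_eq_iff hlam x y).2 h
  · intro j
    obtain ⟨i, rfl⟩ := hs j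
    obtain ⟨x, -, hx⟩ := d.exists_label_eq i
    exact ⟨M.faceOf x, congrArg lam hx⟩)

theorem faceEquiv_faceOf (hlam : ∀ i j, lam i = lam j ↔ f.prod.SameCycle i j)
    (hs : Function.Surjective lam) (x : M.Dart) :
    d.faceEquiv hlam hs (M.faceOf x) = lam (d.label x) := rfl

theorem card_leaves (j : Fin m) :
    Nat.card {x : M.Dart // M.IsLeafDart x ∧ lam (d.label x) = j} =
      2 * Nat.card {i // lam i = j} := by
  rw [Nat.card_eq_of_bijective
    (fun x : {x : M.Dart // M.IsLeafDart x ∧ lam (d.label x) = j} =>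
      ((d.out x.1, ⟨d.label x.1, x.2.2⟩) : Bool × {i // lam i = j})) ⟨?_, ?_⟩]
  · simp
  · have hl : ∀ x, M.IsLeafDart x → d.label x = d.pos x := by
      intro x hx
      rcases (d.isLeafDart_iff x).1 hx with h | h
      · exact d.label_source h
      · exact d.label_of_in (d.in_of_time_last h)
    rintro ⟨x, hx, hx'⟩ ⟨y, hy, hy'⟩ h
    simp only [Prod.mk.injEq, Subtype.mk.injEq] at h
    rw [Subtype.mk.injEq]
    rw [hl x hx, hl y hy] at h
    refine d.inj _ _ ?_ h.2 h.1
    rcases (d.isLeafDart_iff x).1 hx with h1 | h1 <;>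
      rcases (d.isLeafDart_iff y).1 hy with h2 | h2
    · rw [h1, h2]
    · rw [d.out_of_time_zero h1, d.in_of_time_last h2] at h
      simp at h
    · rw [d.out_of_time_zero h2, d.in_of_time_last h1] at h
      simp at h
    · rw [h1, h2]
  · rintro ⟨b, i, hi⟩
    rcases b
    · obtain ⟨x, h1, h2, h3⟩ := d.sink i
      have h4 : d.label x = i := by rw [d.label_of_in h1, h3]
      exact ⟨⟨x, (d.isLeafDart_iff x).2 (.inr h2), by rw [h4, hi]⟩, by simp [h4, h1]⟩
    · obtain ⟨x, h1, h2, h3⟩ := d.source i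
      have h4 : d.label x = i := by rw [d.label_source h2, h3]
      exact ⟨⟨x, (d.isLeafDart_iff x).2 (.inl h2), by rw [h4, hi]⟩, by simp [h4, h1]⟩

/-- The genus of the map is that of the factorization. -/
theorem hasGenus_iff (d : Drawing M.next M.opp f) (hc : ∀ σ ∈ f, σ.IsCycle)
    (hF : Nat.card M.Face = numCycles f.prod) (g : ℕ) :
    M.HasGenus g ↔ HasGenus f.prod f g := by
  have ht : IsTransitive f := d.isTransitive_of_connected M.connected
  rw [SurfaceMap.HasGenus, HasGenus, d.card_vertex hc, d.card_edge hc, hF]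
  constructor
  · intro h
    exact ⟨ht, by omega⟩
  · rintro ⟨-, h⟩
    omega

end Faces

end Drawing

/-! ### The standard drawing -/

namespace Drawing

section Model

variable {n : ℕ} (f : List (Equiv.Perm (Fin n)))

/-- The triples of a time, a position and a direction that occur in a drawing of `f`. -/
def IsCoord (p : ℕ × Fin n × Bool) : Prop :=
  factorAt f p.1 p.2.1 ≠ p.2.1 ∨ (p.2.2 = true ∧ p.1 = 0) ∨ (p.2.2 = false ∧ p.1 = f.length + 1)

/-- The darts of the standard drawing of `f`. -/
abbrev ModelDart : Type := {p : ℕ × Fin n × Bool // IsCoord f p}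

variable {f}

theorem IsCoord.le {p : ℕ × Fin n × Bool} (h : IsCoord f p) : p.1 ≤ f.length + 1 := by
  rcases h with h | h | h
  · have := (pos_of_factorAt_ne h).2
    omega
  · omega
  · omega

theorem IsCoord.moved {p : ℕ × Fin n × Bool} (h : IsCoord f p)
    (h1 : ¬ (p.1 = 0 ∨ p.1 = f.length + 1)) : factorAt f p.1 p.2.1 ≠ p.2.1 := by
  rcases h with h | h | h
  · exact h
  · exact absurd (.inl h.2) h1
  · exact absurd (.inr h.2) h1

instance : Finite (ModelDart f) :=
  Finite.of_injective (β := Fin (f.length + 2) × Fin n × Bool)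
    (fun x => (⟨x.1.1, by have := x.2.le; omega⟩, x.1.2.1, x.1.2.2)) (by
      rintro ⟨⟨s, i, b⟩, h⟩ ⟨⟨s', i', b'⟩, h'⟩ hh
      simpa using hh)

variable (f)

/-- The rotation of the standard drawing. -/
def modelNext : Equiv.Perm (ModelDart f) where
  toFun x := if h : x.1.1 = 0 ∨ x.1.1 = f.length + 1 then x else
    if x.1.2.2 = true then ⟨(x.1.1, x.1.2.1, false), .inl (x.2.moved h)⟩
    else ⟨(x.1.1, (factorAt f x.1.1)⁻¹ x.1.2.1, true), .inl fun hh => x.2.moved h (by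
      have h2 : factorAt f x.1.1 ((factorAt f x.1.1)⁻¹ x.1.2.1) = (factorAt f x.1.1)⁻¹ x.1.2.1 := hh
      have h3 := congrArg (factorAt f x.1.1) h2
      simpa using h3)⟩
  invFun x := if h : x.1.1 = 0 ∨ x.1.1 = f.length + 1 then x else
    if x.1.2.2 = true then ⟨(x.1.1, factorAt f x.1.1 x.1.2.1, false), .inl fun hh =>
      x.2.moved h ((factorAt f x.1.1).injective hh)⟩
    else ⟨(x.1.1, x.1.2.1, true), .inl (x.2.moved h)⟩
  left_inv := by
    rintro ⟨⟨s, i, b⟩, hx⟩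
    by_cases h : s = 0 ∨ s = f.length + 1
    · simp [h]
    · rcases b <;> simp [h]
  right_inv := by
    rintro ⟨⟨s, i, b⟩, hx⟩
    by_cases h : s = 0 ∨ s = f.length + 1
    · simp [h]
    · rcases b <;> simp [h]

variable {f}

/-- The dart `x` leads along its line to the dart `y` at the next vertex. -/
def LeadsTo (x y : ModelDart f) : Prop :=
  x.1.2.2 = true ∧ y.1.2.2 = false ∧ x.1.2.1 = y.1.2.1 ∧ x.1.1 < y.1.1 ∧
    ∀ u, x.1.1 < u → u < y.1.1 → factorAt f u x.1.2.1 = x.1.2.1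

theorem exists_leadsTo (x : ModelDart f) (hx : x.1.2.2 = true) : ∃ y, LeadsTo x y := by
  classical
  obtain ⟨⟨s, i, b⟩, hc⟩ := x
  obtain rfl : b = true := hx
  have hs : s ≤ f.length := by
    rcases hc with h | h | h
    · exact (pos_of_factorAt_ne h).2
    · have : s = 0 := h.2
      omega
    · simp at h
  have hex : ∃ u, s < u ∧ (factorAt f u i ≠ i ∨ u = f.length + 1) :=
    ⟨f.length + 1, by omega, .inr rfl⟩
  obtain ⟨h1, h2⟩ := Nat.find_spec hex
  refine ⟨⟨(Nat.find hex, i, false), ?_⟩, rfl, rfl, rfl, h1, fun u hu hu' => ?_⟩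
  · rcases h2 with h2 | h2
    · exact .inl h2
    · exact .inr (.inr ⟨rfl, h2⟩)
  · by_contra hne
    exact Nat.find_min hex hu' ⟨hu, .inl hne⟩

theorem exists_leadsTo_left (y : ModelDart f) (hy : y.1.2.2 = false) : ∃ x, LeadsTo x y := by
  classical
  obtain ⟨⟨s, i, b⟩, hc⟩ := y
  obtain rfl : b = false := hy
  have hs : 0 < s := by
    rcases hc with h | h | h
    · exact (pos_of_factorAt_ne h).1
    · simp at h
    · have : s = f.length + 1 := h.2
      omega
  let P : ℕ → Prop := fun u => factorAt f u i ≠ i ∨ u = 0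
  have h1 : P (Nat.findGreatest P (s - 1)) :=
    Nat.findGreatest_spec (m := 0) (Nat.zero_le _) (.inr rfl)
  have h2 := Nat.findGreatest_le (P := P) (s - 1)
  refine ⟨⟨(Nat.findGreatest P (s - 1), i, true), ?_⟩, rfl, rfl, rfl,
    lt_of_le_of_lt h2 (by simp only; omega), fun u hu hu' => ?_⟩
  · rcases h1 with h1 | h1
    · exact .inl h1
    · exact .inr (.inl ⟨rfl, h1⟩)
  · by_contra hne
    exact Nat.findGreatest_is_greatest hu (by simp only at hu'; omega) (.inl hne)

theorem LeadsTo.unique {x y z : ModelDart f} (h : LeadsTo x y) (h' : LeadsTo x z) : y = z := by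
  have key : ∀ y z, LeadsTo x y → LeadsTo x z → z.1.1 ≤ y.1.1 := by
    rintro y z ⟨-, b1, c1, d1, -⟩ ⟨-, b2, c2, d2, e2⟩
    by_contra! hlt
    have := e2 _ d1 hlt
    rw [c1] at this
    rcases y.2 with h | h | h
    · exact h this
    · rw [b1] at h
      simp at h
    · have := z.2.le
      omega
  obtain ⟨-, b1, c1, -⟩ := id h
  obtain ⟨-, b2, c2, -⟩ := id h'
  exact Subtype.ext (Prod.ext (le_antisymm (key _ _ h' h) (key _ _ h h'))
    (Prod.ext (c1.symm.trans c2) (b1.trans b2.symm)))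

theorem LeadsTo.unique_left {x y z : ModelDart f} (h : LeadsTo y x) (h' : LeadsTo z x) :
    y = z := by
  have key : ∀ y z, LeadsTo y x → LeadsTo z x → z.1.1 ≤ y.1.1 := by
    rintro y z ⟨a1, -, c1, d1, e1⟩ ⟨a2, -, c2, d2, e2⟩
    by_contra! hlt
    have := e1 _ hlt d2
    rw [c1, ← c2] at this
    rcases z.2 with h | h | h
    · exact h this
    · omega
    · rw [a2] at h
      simp at h
  obtain ⟨a1, -, c1, -⟩ := id h
  obtain ⟨a2, -, c2, -⟩ := id h'
  exact Subtype.ext (Prod.ext (le_antisymm (key _ _ h' h) (key _ _ h h'))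
    (Prod.ext (c1.trans c2.symm) (a1.trans a2.symm)))

theorem exists_opposite (x : ModelDart f) : ∃ y, LeadsTo x y ∨ LeadsTo y x := by
  rcases hx : x.1.2.2
  · obtain ⟨y, hy⟩ := exists_leadsTo_left x hx
    exact ⟨y, .inr hy⟩
  · obtain ⟨y, hy⟩ := exists_leadsTo x hx
    exact ⟨y, .inl hy⟩

theorem opposite_unique {x y z : ModelDart f} (h : LeadsTo x y ∨ LeadsTo y x)
    (h' : LeadsTo x z ∨ LeadsTo z x) : y = z := by
  rcases h with h | h <;> rcases h' with h' | h'
  · exact h.unique h'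
  · exact absurd (h.1.symm.trans h'.2.1) (by simp)
  · exact absurd (h'.1.symm.trans h.2.1) (by simp)
  · exact h.unique_left h'

/-- The involution of the standard drawing. -/
noncomputable def modelOpp (f : List (Equiv.Perm (Fin n))) : Equiv.Perm (ModelDart f) :=
  Function.Involutive.toPerm (fun x => (exists_opposite x).choose) fun x =>
    opposite_unique (exists_opposite _).choose_spec (exists_opposite x).choose_spec.symm

theorem modelOpp_spec (x : ModelDart f) : LeadsTo x (modelOpp f x) ∨ LeadsTo (modelOpp f x) x :=
  (exists_opposite x).choose_spec

theorem modelNext_leaf (x : ModelDart f) (h : x.1.1 = 0 ∨ x.1.1 = f.length + 1) :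
    modelNext f x = x := by
  simp only [modelNext, Equiv.coe_fn_mk, h, dite_true]

theorem modelNext_out (x : ModelDart f) (h : ¬ (x.1.1 = 0 ∨ x.1.1 = f.length + 1))
    (hx : x.1.2.2 = true) : (modelNext f x).1 = (x.1.1, x.1.2.1, false) := by
  simp only [modelNext, Equiv.coe_fn_mk, h, dite_false, hx, if_true]

theorem modelNext_in (x : ModelDart f) (h : ¬ (x.1.1 = 0 ∨ x.1.1 = f.length + 1))
    (hx : x.1.2.2 = false) :
    (modelNext f x).1 = (x.1.1, (factorAt f x.1.1)⁻¹ x.1.2.1, true) := by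
  simp only [modelNext, Equiv.coe_fn_mk, h, dite_false, hx]
  rfl

/-- The standard drawing of a factorization. -/
noncomputable def model (f : List (Equiv.Perm (Fin n))) : Drawing (modelNext f) (modelOpp f) f where
  time x := x.1.1
  pos x := x.1.2.1
  out x := x.1.2.2
  op_op x := Function.Involutive.toPerm_involutive _ x
  out_op x := by
    rcases modelOpp_spec x with h | h
    · rw [h.1, h.2.1]; rfl
    · rw [h.1, h.2.1]; rfl
  pos_op x := by
    rcases modelOpp_spec x with h | h
    · exact h.2.2.1.symm
    · exact h.2.2.1
  time_lt x hx := by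
    rcases modelOpp_spec x with h | h
    · exact h.2.2.2.1
    · rw [h.2.1] at hx
      simp at hx
  time_nx x := by
    by_cases h : x.1.1 = 0 ∨ x.1.1 = f.length + 1
    · rw [modelNext_leaf x h]
    · rcases hx : x.1.2.2
      · rw [modelNext_in x h hx]
      · rw [modelNext_out x h hx]
  nx_of_out x hx := by
    by_cases h : x.1.1 = 0 ∨ x.1.1 = f.length + 1
    · rcases x.2 with h' | h' | h'
      · have := pos_of_factorAt_ne h'
        omega
      · exact .inl ⟨h'.2, modelNext_leaf x h⟩
      · rw [hx] at h'
        simp at h'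
    · exact .inr ⟨x.2.moved h, by rw [modelNext_out x h hx], by rw [modelNext_out x h hx]⟩
  nx_of_in x hx := by
    by_cases h : x.1.1 = 0 ∨ x.1.1 = f.length + 1
    · rcases x.2 with h' | h' | h'
      · have := pos_of_factorAt_ne h'
        omega
      · rw [hx] at h'
        simp at h'
      · exact .inl ⟨h'.2, modelNext_leaf x h⟩
    · exact .inr ⟨x.2.moved h, by rw [modelNext_in x h hx],
        by rw [modelNext_in x h hx]; simp⟩
  inj x y h1 h2 h3 := Subtype.ext (Prod.ext h1 (Prod.ext h2 h3))
  source i := ⟨⟨(0, i, true), .inr (.inl ⟨rfl, rfl⟩)⟩, rfl, rfl, rfl⟩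
  sink i := ⟨⟨(f.length + 1, i, false), .inr (.inr ⟨rfl, rfl⟩)⟩, rfl, rfl, rfl⟩
  inner s i h := ⟨⟨(s, i, false), .inl h⟩, rfl, rfl, rfl⟩

end Model

end Drawing

/-- The map of a transitive factorization. -/
noncomputable def modelMap {n : ℕ} [NeZero n] (f : List (Equiv.Perm (Fin n)))
    (hf : IsTransitive f) : SurfaceMap where
  Dart := Drawing.ModelDart f
  nonempty := ⟨⟨(0, 0, true), .inr (.inl ⟨rfl, rfl⟩)⟩⟩
  next := Drawing.modelNext f
  opp := Drawing.modelOpp f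
  opp_opp := (Drawing.model f).op_op
  opp_ne x h := by
    have := (Drawing.model f).out_op x
    rw [h] at this
    simp at this
  connected := (Drawing.model f).connected_of_isTransitive hf

/-- The drawing of a transitive factorization on its map. -/
noncomputable def modelDrawing {n : ℕ} [NeZero n] (f : List (Equiv.Perm (Fin n)))
    (hf : IsTransitive f) : Drawing (modelMap f hf).next (modelMap f hf).opp f :=
  Drawing.model f

/-! ### Orientations and odd corners -/

/-- A finite relation without directed cycles is contained in a linear order. -/
theorem exists_linear_extension {V : Type*} [Finite V] (R : V → V → Prop)
    (h : ∀ a b, Relation.ReflTransGen R a b → Relation.ReflTransGen R b a → a = b) :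
    ∃ (N : ℕ) (e : V ≃ Fin N), ∀ a b, R a b → e a ≤ e b := by
  classical
  have hp : IsPartialOrder V (Relation.ReflTransGen R) :=
    { refl := fun _ => .refl
      trans := fun _ _ _ => Relation.ReflTransGen.trans
      antisymm := h }
  obtain ⟨s, hs, hle⟩ := extend_partialOrder (Relation.ReflTransGen R)
  let _ : LinearOrder V :=
    { le := s
      le_refl := hs.refl
      le_trans := hs.trans
      le_antisymm := hs.antisymm
      le_total := hs.total
      toDecidableLE := Classical.decRel _ }
  have := Fintype.ofFinite V
  let e := (Fintype.orderIsoFinOfCardEq V rfl).symm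
  exact ⟨_, e.toEquiv, fun a b hab => e.monotone (hle _ _ (.single hab))⟩

namespace SurfaceMap

variable (M : SurfaceMap)

/-- The darts around each vertex of degree at least two have alternating values of `θ`. -/
def Alternates (θ : M.Dart → ZMod 2) : Prop :=
  ∀ x, M.next x ≠ x → θ (M.next x) = θ x + 1

variable {M}

theorem Alternates.zpow {θ : M.Dart → ZMod 2} (h : M.Alternates θ) {x : M.Dart}
    (hx : M.next x ≠ x) (k : ℕ) : θ ((M.next ^ k) x) = θ x + k := by
  induction k with
  | zero => simp
  | succ k ih =>
    rw [pow_succ', Equiv.Perm.mul_apply, h, ih]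
    · push_cast; ring
    · rw [← Equiv.Perm.mul_apply, ← pow_succ', pow_succ, Equiv.Perm.mul_apply]
      exact fun hh => hx ((M.next ^ k).injective hh)

/-- A corner is odd if and only if its two darts have equal values, since their distance in the
rotation is one more than the number of darts between them. -/
theorem Alternates.isOddCorner_iff {θ : M.Dart → ZMod 2} (h : M.Alternates θ) {x y : M.Dart}
    (hv : M.vertexOf x = M.vertexOf y) (hxy : x ≠ y) : M.IsOddCorner x y ↔ θ x = θ y := by
  classical
  have := M.finite
  have hs := M.vertexOf_eq_iff.1 hv
  have hx : M.next x ≠ x := fun hh => by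
    obtain ⟨k, hk⟩ := hs
    exact hxy ((zpow_apply_eq_self_of_apply_eq_self hh k).symm.trans hk)
  have hodd : ∀ k, Odd k → (M.next ^ (k + 1)) x = y → θ x = θ y := by
    intro k hk hy
    rw [← hy, h.zpow hx, (ZMod.natCast_eq_zero_iff_even).2 hk.add_one, add_zero]
  constructor
  · rintro ⟨k, hk, hy, -⟩
    exact hodd k hk hy
  · intro hθ
    have hex : ∃ k, (M.next ^ (k + 1)) x = y := by
      obtain ⟨k, hk, -, hk'⟩ := hs.exists_pow_eq''
      exact ⟨k - 1, by rw [Nat.sub_add_cancel hk]; exact hk'⟩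
    refine ⟨Nat.find hex, ?_, Nat.find_spec hex, fun i hi => Nat.find_min hex hi⟩
    have h1 := h.zpow hx (Nat.find hex + 1)
    rw [Nat.find_spec hex, hθ, left_eq_add, ZMod.natCast_eq_zero_iff_even] at h1
    exact Nat.not_even_iff_odd.1 (Nat.even_add_one.1 h1)

section Corners

variable {l : ℕ} [NeZero l] {c : Fin l → M.Dart}

theorem IsCycle.opp_ne (hc : M.IsCycle c) (i : Fin l) : M.opp (c i) ≠ c (i + 1) := by
  intro h
  have h1 : M.edgeOf (c i) = M.edgeOf (c (i + 1)) := by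
    rw [M.edgeOf_eq_iff, ← h]
    exact sameCycle_apply_right.2 (.refl _ _)
  have h2 := hc.edge_injective h1
  rw [← h2] at h
  exact M.opp_ne _ h

theorem Alternates.isOddCorner_cycle_iff {θ : M.Dart → ZMod 2} (h : M.Alternates θ)
    (hc : M.IsCycle c) (i : Fin l) :
    M.IsOddCorner (M.opp (c i)) (c (i + 1)) ↔ θ (M.opp (c i)) = θ (c (i + 1)) :=
  h.isOddCorner_iff (hc.walk i) (hc.opp_ne i)

/-- The parity of the number of odd corners is additive over the edges of the cycle: each dart of
the cycle occurs in one corner as `c i` and its opposite in one corner as `M.opp (c i)`. -/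
theorem Alternates.numOddCorners_eq_sum {θ : M.Dart → ZMod 2} (h : M.Alternates θ)
    (hc : M.IsCycle c) :
    (M.numOddCorners c : ZMod 2) = ∑ i, (θ (c i) + θ (M.opp (c i)) + 1) := by
  classical
  have h1 : (M.numOddCorners c : ZMod 2) = ∑ i, (θ (M.opp (c i)) + θ (c (i + 1)) + 1) := by
    rw [numOddCorners, Nat.card_eq_fintype_card, Fintype.card_subtype, Finset.card_filter]
    push_cast
    refine Finset.sum_congr rfl fun i _ => ?_
    rw [h.isOddCorner_cycle_iff hc]
    have key : ∀ a b : ZMod 2, (a = b → 1 = a + b + 1) ∧ (a ≠ b → 0 = a + b + 1) := by decide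
    split_ifs with hab
    · exact (key _ _).1 hab
    · exact (key _ _).2 hab
  have h2 : ∑ i, θ (c (i + 1)) = ∑ i, θ (c i) :=
    Equiv.sum_comp (Equiv.addRight (1 : Fin l)) fun i => θ (c i)
  rw [h1]
  simp only [Finset.sum_add_distrib]
  rw [h2]
  ring

end Corners

/-! ### Walks and cycles -/

variable (M) in
/-- The darts of the list form a walk from the vertex `u` to the vertex `v`. -/
def IsWalk : M.Vertex → List M.Dart → M.Vertex → Prop
  | u, [], v => u = v
  | u, x :: l, v => M.vertexOf x = u ∧ IsWalk (M.vertexOf (M.opp x)) l v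

theorem isWalk_append {a b : List M.Dart} {u v : M.Vertex} :
    M.IsWalk u (a ++ b) v ↔ ∃ w, M.IsWalk u a w ∧ M.IsWalk w b v := by
  induction a generalizing u with
  | nil => simp [IsWalk]
  | cons x a ih =>
    simp only [List.cons_append, IsWalk, ih]
    constructor
    · rintro ⟨h, w, h1, h2⟩
      exact ⟨w, ⟨h, h1⟩, h2⟩
    · rintro ⟨w, ⟨h, h1⟩, h2⟩
      exact ⟨h, w, h1, h2⟩

theorem IsWalk.reverse {l : List M.Dart} {u v : M.Vertex} (h : M.IsWalk u l v) :
    ∃ l', M.IsWalk v l' u := by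
  induction l generalizing u with
  | nil => exact ⟨[], Eq.symm h⟩
  | cons x l ih =>
    obtain ⟨h1, h2⟩ := h
    obtain ⟨l', hl'⟩ := ih h2
    exact ⟨l' ++ [M.opp x], isWalk_append.2 ⟨_, hl', rfl, by rw [M.opp_opp]; exact h1⟩⟩

theorem exists_isWalk (u v : M.Vertex) : ∃ l, M.IsWalk u l v := by
  obtain ⟨x, rfl⟩ := M.exists_vertexOf u
  obtain ⟨y, rfl⟩ := M.exists_vertexOf v
  refine Linked.induct (S := {M.next, M.opp})
    (r := fun x y => ∃ l, M.IsWalk (M.vertexOf x) l (M.vertexOf y)) ⟨?_, ?_, ?_⟩ ?_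
    (M.connected x y)
  · exact fun x => ⟨[], rfl⟩
  · rintro x y ⟨l, hl⟩
    exact hl.reverse
  · rintro x y z ⟨l, hl⟩ ⟨l', hl'⟩
    exact ⟨l ++ l', isWalk_append.2 ⟨_, hl, hl'⟩⟩
  · rintro ρ hρ x
    rcases hρ with rfl | rfl
    · exact ⟨[], (M.vertexOf_next x).symm⟩
    · exact ⟨[x], rfl, rfl⟩

/-- A list with a repeated value of `v` can be cut at two places where the values agree. -/
theorem exists_split_of_not_nodup {X Y : Type*} (v : X → Y) (l : List X)
    (h : ¬ (l.map v).Nodup) : ∃ p x q y r, l = p ++ (x :: q) ++ (y :: r) ∧ v x = v y := by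
  induction l with
  | nil => simp at h
  | cons a t ih =>
    by_cases ha : v a ∈ t.map v
    · obtain ⟨y, hy, hv⟩ := List.mem_map.1 ha
      obtain ⟨q, r, rfl⟩ := List.append_of_mem hy
      exact ⟨[], a, q, y, r, by simp, hv.symm⟩
    · rw [List.map_cons, List.nodup_cons] at h
      obtain ⟨p, x, q, y, r, rfl, hv⟩ := ih fun hh => h ⟨ha, hh⟩
      exact ⟨a :: p, x, q, y, r, by simp, hv⟩

/-- A property of closed walks which is inherited by one of the parts whenever a closed walk is cut
at a repeated vertex holds for a closed walk that repeats no vertex. -/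
theorem exists_nodup_walk (Q : List M.Dart → Prop)
    (hQ : ∀ p q r, Q (p ++ q ++ r) → Q q ∨ Q (p ++ r)) (l : List M.Dart) (u : M.Vertex)
    (hl : M.IsWalk u l u) (hQl : Q l) :
    ∃ l u, M.IsWalk u l u ∧ Q l ∧ (l.map M.vertexOf).Nodup := by
  induction hn : l.length using Nat.strong_induction_on generalizing l u with
  | _ N ih =>
    by_cases hd : (l.map M.vertexOf).Nodup
    · exact ⟨l, u, hl, hQl, hd⟩
    obtain ⟨p, x, q, y, r, rfl, hv⟩ := exists_split_of_not_nodup _ _ hd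
    obtain ⟨w, hw, hy, hr⟩ := isWalk_append.1 hl
    obtain ⟨w', hp, hx, hq⟩ := isWalk_append.1 hw
    subst hy hx
    simp only [List.length_append, List.length_cons] at hn
    rcases hQ _ _ _ hQl with h | h
    · exact ih _ (by simp only [List.length_cons]; omega) (x :: q) (M.vertexOf x)
        ⟨rfl, hv ▸ hq⟩ h rfl
    · exact ih _ (by simp only [List.length_append, List.length_cons]; omega) (p ++ y :: r) u
        (isWalk_append.2 ⟨_, hp, hv.symm, hr⟩) h rfl

theorem IsWalk.getElem {l : List M.Dart} {u v : M.Vertex} (h : M.IsWalk u l v) :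
    (∀ h0 : 0 < l.length, M.vertexOf l[0] = u) ∧
    (∀ i (hi : i + 1 < l.length), M.vertexOf (M.opp l[i]) = M.vertexOf l[i + 1]) ∧
    (∀ i (hi : i + 1 = l.length), M.vertexOf (M.opp l[i]) = v) := by
  induction l generalizing u with
  | nil => simp
  | cons x l ih =>
    obtain ⟨h1, h2⟩ := h
    obtain ⟨i1, i2, i3⟩ := ih h2
    refine ⟨fun _ => h1, fun i hi => ?_, fun i hi => ?_⟩
    · rcases i with _ | i
      · exact (i1 (by simpa using hi)).symm
      · exact i2 i (by simpa using hi)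
    · rcases i with _ | i
      · obtain rfl : l = [] := List.eq_nil_of_length_eq_zero (by simpa using hi.symm)
        exact h2
      · exact i3 i (by simpa using hi)

/-- A closed walk that repeats no vertex is a cycle, unless it traverses one edge back and forth. -/
theorem exists_isCycle (Q : List M.Dart → Prop)
    (hQ : ∀ p q r, Q (p ++ q ++ r) → Q q ∨ Q (p ++ r)) (hnil : ¬ Q [])
    (hback : ∀ x, ¬ Q [x, M.opp x]) (l : List M.Dart) (u : M.Vertex)
    (hl : M.IsWalk u l u) (hQl : Q l) :
    ∃ (l : List M.Dart) (_ : NeZero l.length), Q l ∧ M.IsCycle (fun i : Fin l.length => l[i]) := by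
  obtain ⟨l, u, hl, hQl, hd⟩ := exists_nodup_walk Q hQ l u hl hQl
  have hne : l ≠ [] := by
    rintro rfl
    exact hnil hQl
  have hpos : 0 < l.length := List.length_pos_iff.2 hne
  have hz : NeZero l.length := ⟨hpos.ne'⟩
  obtain ⟨w1, w2, w3⟩ := hl.getElem
  have hval : ∀ i : Fin l.length, (i + 1).val = (i.val + 1) % l.length := by
    intro i
    rw [Fin.val_add, Fin.val_one', Nat.add_mod_mod]
  have hwalk : ∀ i : Fin l.length, M.vertexOf (M.opp l[i]) = M.vertexOf l[i + 1] := by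
    intro i
    have hi := i.2
    by_cases h : i.val + 1 < l.length
    · have h1 := hval i
      rw [Nat.mod_eq_of_lt h] at h1
      rw [Fin.getElem_fin, Fin.getElem_fin, w2 i h]
      simp only [h1]
    · have h1 := hval i
      rw [show i.val + 1 = l.length by omega, Nat.mod_self] at h1
      rw [Fin.getElem_fin, Fin.getElem_fin, w3 i (by omega)]
      simp only [h1]
      exact (w1 hpos).symm
  have hinj : Function.Injective fun i : Fin l.length => M.vertexOf l[i] := by
    intro i j h
    have := (List.nodup_iff_injective_get.1 hd)
      (a₁ := ⟨i, by simp⟩) (a₂ := ⟨j, by simp⟩) (by simpa using h)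
    exact Fin.ext (by simpa using this)
  refine ⟨l, hz, hQl, hwalk, hinj, fun i j h => ?_⟩
  by_contra hij
  have hop : M.opp l[i] = l[j] := by
    obtain ⟨k, hk⟩ := M.edgeOf_eq_iff.1 h
    have h2 : M.opp ^ (2 : ℤ) = 1 := by
      ext z; rw [zpow_two]; exact M.opp_opp z
    rcases Int.even_or_odd' k with ⟨a, rfl | rfl⟩
    · rw [zpow_mul, h2, one_zpow] at hk
      exact absurd (hinj (congrArg M.vertexOf hk)) hij
    · rwa [zpow_add, zpow_mul, h2, one_zpow, one_mul, zpow_one] at hk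
  have hop' : M.opp l[j] = l[i] := by rw [← hop, M.opp_opp]
  -- An edge traversed in both directions has its ends at consecutive places in both orders, so
  -- that the walk has length two.
  have h1 : i + 1 = j := hinj (by
    change M.vertexOf l[i + 1] = M.vertexOf l[j]
    rw [← hwalk, hop])
  have h2 : j + 1 = i := hinj (by
    change M.vertexOf l[j + 1] = M.vertexOf l[i]
    rw [← hwalk, hop'])
  have e1 := hval i
  have e2 := hval j
  rw [h1] at e1
  rw [h2] at e2
  have hi := i.2
  have hj := j.2
  have hij' : i.val ≠ j.val := fun h => hij (Fin.ext h)
  have hlen : l.length = 2 := by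
    rcases Nat.lt_or_ge (i.val + 1) l.length with a | a <;>
      rcases Nat.lt_or_ge (j.val + 1) l.length with b | b
    · rw [Nat.mod_eq_of_lt a] at e1
      rw [Nat.mod_eq_of_lt b] at e2
      omega
    · rw [show j.val + 1 = l.length by omega, Nat.mod_self] at e2
      rw [Nat.mod_eq_of_lt a] at e1
      omega
    · rw [show i.val + 1 = l.length by omega, Nat.mod_self] at e1
      rw [Nat.mod_eq_of_lt b] at e2
      omega
    · omega
  obtain ⟨x, y, rfl⟩ := List.length_eq_two.1 hlen
  have hxy : M.opp x = y := by
    simp only [List.length_cons, List.length_nil] at hi hj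
    simp only [Fin.getElem_fin] at hop hop'
    rcases (show i.val = 0 ∧ j.val = 1 ∨ i.val = 1 ∧ j.val = 0 by omega) with ⟨a, b⟩ | ⟨a, b⟩
    · simpa [a, b] using hop
    · simpa [a, b] using hop'
  exact hback x (hxy ▸ hQl)

/-! ### Orientations -/

theorem degree_eq_minimalPeriod (x : M.Dart) :
    M.degree (M.vertexOf x) = Function.minimalPeriod (M.next • ·) x := by
  have := M.finite
  exact (Nat.card_congr (Equiv.subtypeEquivRight fun y => M.vertexOf_eq_iff)).trans
    (natCard_sameCycle M.next x)

/-- Around a vertex of even degree, an alternating function is given by the parity of the distance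
from a chosen dart. -/
theorem exists_alternates (hdeg : ∀ v, M.degree v = 1 ∨ Even (M.degree v)) :
    ∃ θ, M.Alternates θ := by
  have h1 : ∀ x, ∃ k : ℤ, (M.next ^ k) (Quotient.out (M.vertexOf x)) = x := fun x =>
    M.vertexOf_eq_iff.1 (Quotient.out_eq (M.vertexOf x))
  choose k hk using h1
  refine ⟨fun x => (k x : ZMod 2), fun x hx => ?_⟩
  have h2 := hk (M.next x)
  rw [M.vertexOf_next] at h2
  set b := Quotient.out (M.vertexOf x) with hb
  have hvb : M.vertexOf b = M.vertexOf x := Quotient.out_eq _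
  have h3 : (M.next ^ (k (M.next x) - (k x + 1))) b = b := by
    have h4 : (M.next ^ (k x + 1)) b = M.next x := by
      rw [add_comm, zpow_add, zpow_one, Equiv.Perm.mul_apply, hk x]
    rw [sub_eq_neg_add, zpow_add, Equiv.Perm.mul_apply, h2, ← h4, zpow_neg]
    simp
  have h5 : Even (M.degree (M.vertexOf b)) := by
    rcases hdeg (M.vertexOf b) with h | h
    · rw [hvb] at h
      exact absurd ((M.isLeafDart_iff x).1 h) hx
    · exact h
  have h6 := (MulAction.zpow_smul_eq_iff_minimalPeriod_dvd (a := M.next) (b := b)).1 h3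
  rw [← degree_eq_minimalPeriod] at h6
  have h7 : (2 : ℤ) ∣ k (M.next x) - (k x + 1) :=
    (Int.natCast_dvd_natCast.2 h5.two_dvd).trans h6
  have h8 := (ZMod.intCast_zmod_eq_zero_iff_dvd _ 2).2 h7
  push_cast at h8
  exact sub_eq_zero.1 h8

theorem sum_fin_getElem {X : Type*} (l : List X) (w : X → ZMod 2) :
    ∑ i : Fin l.length, w l[i] = (l.map w).sum :=
  Fin.sum_univ_fun_getElem l w

variable (M) in
/-- A consistent orientation of the edges: the two darts of an edge have different values of `o`,
and the values alternate around each vertex of degree at least two. -/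
structure IsOrientation (o : M.Dart → Bool) : Prop where
  opp : ∀ x, o (M.opp x) = !o x
  next : ∀ x, M.next x ≠ x → o (M.next x) = !o x

/-- If all cycles have an even number of odd corners, a consistent orientation exists: an
alternating choice at each vertex fails along edges of total weight zero on every cycle,
and so can be corrected by flipping vertices. -/
theorem exists_isOrientation (hdeg : ∀ v, M.degree v = 1 ∨ Even (M.degree v))
    (hcyc : ∀ (l : ℕ) [NeZero l] (c : Fin l → M.Dart), M.IsCycle c → Even (M.numOddCorners c)) :
    ∃ o, M.IsOrientation o := by
  obtain ⟨θ, hθ⟩ := exists_alternates hdeg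
  -- The weight of an edge is nonzero if `θ` fails to distinguish its two darts.
  set w : M.Dart → ZMod 2 := fun x => θ x + θ (M.opp x) + 1 with hw
  have hwop : ∀ x, w (M.opp x) = w x := fun x => by
    simp only [hw, M.opp_opp]; ring
  have hclosed : ∀ l u, M.IsWalk u l u → (l.map w).sum = 0 := by
    intro l u hl
    by_contra hne
    obtain ⟨l, hz, hQ, hc⟩ := exists_isCycle (fun l => (l.map w).sum ≠ 0) (by
      intro p q r h
      by_contra! hh
      apply h
      have := hh.2
      simp only [List.map_append, List.sum_append] at this ⊢
      rw [hh.1, add_zero, this]) (by simp) (by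
      intro x
      simp only [List.map_cons, List.map_nil, List.sum_cons, List.sum_nil, hwop, add_zero, ne_eq,
        not_not]
      exact CharTwo.add_self_eq_zero _) l u hl hne
    apply hQ
    rw [← sum_fin_getElem, ← hθ.numOddCorners_eq_sum hc]
    exact ZMod.natCast_eq_zero_iff_even.2 (hcyc _ _ hc)
  have hrev : ∀ u l v, M.IsWalk u l v → ∃ l', M.IsWalk v l' u ∧ (l'.map w).sum = (l.map w).sum := by
    intro u l v h
    obtain ⟨l', hl'⟩ := h.reverse
    refine ⟨l', hl', ?_⟩
    have := hclosed (l ++ l') u (isWalk_append.2 ⟨_, h, hl'⟩)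
    rw [List.map_append, List.sum_append] at this
    exact (CharTwo.add_eq_zero.1 this).symm
  obtain ⟨x₀⟩ := M.nonempty
  choose p hp using fun v => exists_isWalk (M.vertexOf x₀) v
  -- The vertices `v` with `s v = 1` are those to be flipped.
  set s : M.Vertex → ZMod 2 := fun v => ((p v).map w).sum with hs
  have hstep : ∀ x, s (M.vertexOf (M.opp x)) = s (M.vertexOf x) + w x := by
    intro x
    obtain ⟨l', hl', hsum⟩ := hrev _ _ _ (hp (M.vertexOf (M.opp x)))
    have := hclosed (p (M.vertexOf x) ++ (x :: l')) _
      (isWalk_append.2 ⟨_, hp _, rfl, hl'⟩)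
    simp only [List.map_append, List.sum_append, List.map_cons, List.sum_cons, hsum] at this
    rw [← add_assoc] at this
    exact (CharTwo.add_eq_zero.1 this).symm
  have hdec : ∀ a : ZMod 2, decide (a + 1 = 0) = !decide (a = 0) := by decide
  refine ⟨fun x => decide (θ x + s (M.vertexOf x) = 0), fun x => ?_, fun x hx => ?_⟩
  · rw [← hdec, hstep]
    have : θ (M.opp x) + (s (M.vertexOf x) + w x) = θ x + s (M.vertexOf x) + 1 := by
      simp only [hw]
      linear_combination CharTwo.add_self_eq_zero (θ (M.opp x))
    rw [this]
  · rw [← hdec, M.vertexOf_next, hθ x hx]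
    congr 2
    ring

theorem IsOrientation.alternates {o : M.Dart → Bool} (h : M.IsOrientation o) :
    M.Alternates (fun x => if o x then 0 else 1) := by
  intro x hx
  simp only [h.next x hx]
  cases o x <;> decide

/-- If all cycles have an odd corner, then the orientation has no directed cycles. -/
theorem IsOrientation.acyclic {o : M.Dart → Bool} (h : M.IsOrientation o)
    (hcyc : ∀ (l : ℕ) [NeZero l] (c : Fin l → M.Dart), M.IsCycle c → 0 < M.numOddCorners c)
    (l : List M.Dart) (u : M.Vertex) (hl : M.IsWalk u l u) (ho : ∀ x ∈ l, o x = true) : l = [] := by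
  by_contra hne
  obtain ⟨l, hz, hQ, hc⟩ := exists_isCycle (fun l => l ≠ [] ∧ ∀ x ∈ l, o x = true) (by
    rintro p q r ⟨h1, h2⟩
    by_cases hq : q = []
    · subst hq
      right
      exact ⟨by simpa using h1, fun x hx => h2 x (by simpa using hx)⟩
    · exact .inl ⟨hq, fun x hx => h2 x (by simp [hx])⟩) (by simp) (by
    rintro x ⟨-, h2⟩
    have h3 := h2 x (by simp)
    have h4 := h2 (M.opp x) (by simp)
    rw [h.opp, h3] at h4
    simp at h4) l u hl ⟨hne, ho⟩
  have hpos := hcyc _ _ hc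
  rw [numOddCorners, Nat.card_pos_iff] at hpos
  obtain ⟨⟨⟨i, hi⟩⟩, -⟩ := hpos
  rw [h.alternates.isOddCorner_cycle_iff hc] at hi
  have h1 : o l[i] = true := hQ.2 _ (List.getElem_mem _)
  have h2 : o l[i + 1] = true := hQ.2 _ (List.getElem_mem _)
  simp only [h.opp, h1, h2] at hi
  exact absurd hi (by decide)

end SurfaceMap

namespace Drawing

variable {M : SurfaceMap} {n : ℕ} {f : List (Equiv.Perm (Fin n))} (d : Drawing M.next M.opp f)

theorem isOrientation : M.IsOrientation d.out := by
  refine ⟨d.out_op, fun x hx => ?_⟩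
  rw [ne_eq, d.nx_eq_self_iff] at hx
  push Not at hx
  exact d.out_nx hx.1 hx.2

/-- The directions of a drawing alternate around the vertices and admit no directed cycle, as the
time increases along every edge. -/
theorem cycles (d : Drawing M.next M.opp f) {l : ℕ} [NeZero l] (c : Fin l → M.Dart)
    (hc : M.IsCycle c) : 0 < M.numOddCorners c ∧ Even (M.numOddCorners c) := by
  have ha := d.isOrientation.alternates
  constructor
  · by_contra hz
    have hno : ∀ i, ¬ M.IsOddCorner (M.opp (c i)) (c (i + 1)) := by
      intro i hi
      exact hz (Nat.card_pos_iff.2 ⟨⟨⟨i, hi⟩⟩, inferInstance⟩)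
    have hsame : ∀ i, d.out (c (i + 1)) = d.out (c i) := by
      intro i
      have := hno i
      rw [ha.isOddCorner_cycle_iff hc, d.out_op] at this
      revert this
      cases d.out (c i) <;> cases d.out (c (i + 1)) <;> simp
    have htime : ∀ i, d.time (M.opp (c i)) = d.time (c (i + 1)) := fun i =>
      d.time_eq_of_sameCycle (M.vertexOf_eq_iff.1 (hc.walk i))
    -- Without odd corners, all directions agree, and the times along the cycle are monotone.
    by_cases hall : ∃ i, d.out (c i) = true
    · obtain ⟨i₀, hi₀⟩ := hall
      obtain ⟨i, hi, hmax⟩ := Finset.exists_max_image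
        (Finset.univ.filter fun i => d.out (c i) = true) (fun i => d.time (c i)) ⟨i₀, by simpa⟩
      rw [Finset.mem_filter] at hi
      have h1 := d.time_lt _ hi.2
      have h2 := hmax (i + 1) (by simp [hsame, hi.2])
      rw [htime] at h1
      omega
    · push Not at hall
      obtain ⟨i, -, hmin⟩ := Finset.exists_min_image Finset.univ (fun i => d.time (c i))
        ⟨0, Finset.mem_univ _⟩
      have h1 := d.time_op_lt (Bool.eq_false_iff.2 (hall i))
      have h2 := hmin (i + 1) (Finset.mem_univ _)
      rw [htime] at h1
      omega
  · rw [← ZMod.natCast_eq_zero_iff_even, ha.numOddCorners_eq_sum hc]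
    refine Finset.sum_eq_zero fun i _ => ?_
    rw [d.out_op]
    cases d.out (c i) <;> decide

end Drawing

/-! ### From an oriented map to a factorization -/

namespace SurfaceMap

/-- The values of `H` follow the faces of the oriented map `M`: they change only at the sinks, where
`π⁻¹` is applied. -/
def IsLabelling {n : ℕ} (M : SurfaceMap) (o : M.Dart → Bool) (π : Equiv.Perm (Fin n))
    (H : M.Dart → Fin n) : Prop :=
  ∀ x, H x = if o x = true ∧ o (M.faceNext x) = false then π (H (M.faceNext x))
    else H (M.faceNext x)

variable {M : SurfaceMap} {n : ℕ} {o : M.Dart → Bool} {π : Equiv.Perm (Fin n)}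
  {H : M.Dart → Fin n}

namespace IsLabelling

theorem next_of_out (hH : M.IsLabelling o π H) (ho : M.IsOrientation o) {x : M.Dart}
    (hx : o x = true) : H (M.next x) = H (M.opp x) := by
  have := hH (M.opp x)
  simpa [ho.opp, hx, faceNext, M.opp_opp] using this.symm

theorem next_of_in (hH : M.IsLabelling o π H) (ho : M.IsOrientation o) {x : M.Dart}
    (hx : o x = false) (hn : M.next x ≠ x) : H (M.next x) = H (M.opp x) := by
  have := hH (M.opp x)
  simpa [ho.opp, hx, faceNext, M.opp_opp, ho.next x hn] using this.symm

theorem opp_sink (hH : M.IsLabelling o π H) (ho : M.IsOrientation o) {x : M.Dart}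
    (hx : o x = false) (hn : M.next x = x) : H (M.opp x) = π (H x) := by
  have := hH (M.opp x)
  simpa [ho.opp, hx, faceNext, M.opp_opp, hn] using this

end IsLabelling

/-- The lines of an oriented map with positions `p` and times `t`. -/
structure IsLines (M : SurfaceMap) (o : M.Dart → Bool) (p : M.Dart → Fin n) (t : M.Dart → ℕ) :
    Prop where
  orient : M.IsOrientation o
  opp : ∀ x, p (M.opp x) = p x
  next : ∀ x, o x = true → M.next x ≠ x → p (M.next x) = p x
  time_next : ∀ x, t (M.next x) = t x
  time_opp : ∀ x, o x = true → t x < t (M.opp x)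
  time_source : ∀ x, o x = true → (t x = 0 ↔ M.next x = x)
  source_inj : ∀ x y, o x = true → o y = true → M.next x = x → M.next y = y → p x = p y → x = y

namespace IsLines

variable {p : M.Dart → Fin n} {t : M.Dart → ℕ}

/-- A dart that leaves an inner vertex is preceded on its line by one that leaves earlier. -/
theorem exists_pred (h : M.IsLines o p t) {x : M.Dart} (hx : o x = true) (ht : t x ≠ 0) :
    ∃ z, o z = true ∧ p z = p x ∧ t z < t x ∧ M.opp z = M.next x := by
  have hn : M.next x ≠ x := fun hh => ht ((h.time_source x hx).2 hh)
  have h1 : o (M.next x) = false := by rw [h.orient.next x hn, hx]; rfl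
  have h2 : o (M.opp (M.next x)) = true := by rw [h.orient.opp, h1]; rfl
  refine ⟨M.opp (M.next x), h2, by rw [h.opp, h.next x hx hn], ?_, M.opp_opp _⟩
  have := h.time_opp _ h2
  rwa [M.opp_opp, h.time_next] at this

/-- Along a line no vertex is skipped, and a vertex is visited at most once. -/
theorem compare (h : M.IsLines o p t) (x y : M.Dart) (hx : o x = true) (hy : o y = true)
    (hp : p x = p y) : (t x = t y → x = y) ∧ (t x < t y → t (M.opp x) ≤ t y) := by
  induction hN : t x + t y using Nat.strong_induction_on generalizing x y with
  | _ N ih =>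
    subst hN
    constructor
    · intro ht
      by_cases h0 : t y = 0
      · exact h.source_inj x y hx hy ((h.time_source x hx).1 (ht.trans h0))
          ((h.time_source y hy).1 h0) hp
      obtain ⟨a, a1, a2, a3, a4⟩ := h.exists_pred hx (ht ▸ h0)
      obtain ⟨b, b1, b2, b3, b4⟩ := h.exists_pred hy h0
      have hab := ih (t a + t b) (by omega) a b a1 b1 (by rw [a2, b2, hp]) rfl
      have hba := ih (t b + t a) (by omega) b a b1 a1 (by rw [a2, b2, hp]) rfl
      rcases lt_trichotomy (t a) (t b) with hlt | heq | hgt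
      · have := hab.2 hlt
        rw [a4, h.time_next] at this
        omega
      · have := hab.1 heq
        rw [this, b4] at a4
        exact (M.next.injective a4).symm
      · have := hba.2 hgt
        rw [b4, h.time_next] at this
        omega
    · intro ht
      obtain ⟨b, b1, b2, b3, b4⟩ := h.exists_pred hy (by omega)
      have hxb := ih (t x + t b) (by omega) x b hx b1 (by rw [b2, hp]) rfl
      have hbx := ih (t b + t x) (by omega) b x b1 hx (by rw [b2, hp]) rfl
      rcases lt_trichotomy (t x) (t b) with hlt | heq | hgt
      · exact (hxb.2 hlt).trans b3.le
      · rw [hxb.1 heq, b4, h.time_next]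
      · have := hbx.2 hgt
        rw [b4, h.time_next] at this
        omega

theorem symm_of_in (h : M.IsLines o p t) {x : M.Dart} (hx : o x = false) (hn : M.next x ≠ x) :
    o (M.next.symm x) = true ∧ p (M.next.symm x) = p x ∧ t (M.next.symm x) = t x := by
  have hn' : M.next (M.next.symm x) ≠ M.next.symm x := by
    rw [Equiv.apply_symm_apply]
    intro hh
    apply hn
    conv_lhs => rw [hh]
    rw [Equiv.apply_symm_apply]
  have h1 := h.orient.next _ hn'
  rw [Equiv.apply_symm_apply, hx] at h1
  have h2 : o (M.next.symm x) = true := by simpa using h1.symm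
  have h3 := h.next _ h2 hn'
  have h4 := h.time_next (M.next.symm x)
  rw [Equiv.apply_symm_apply] at h3 h4
  exact ⟨h2, h3.symm, h4.symm⟩

theorem inj (h : M.IsLines o p t) {N : ℕ}
    (hs : ∀ x, o x = false → (t x = N + 1 ↔ M.next x = x))
    (x y : M.Dart) (ht : t x = t y) (hp : p x = p y) (ho : o x = o y) : x = y := by
  rcases hx : o x
  · have hy : o y = false := ho ▸ hx
    by_cases hn : M.next x = x
    · have h1 := (hs x hx).2 hn
      have hox : o (M.opp x) = true := by rw [h.orient.opp, hx]; rfl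
      have hoy : o (M.opp y) = true := by rw [h.orient.opp, hy]; rfl
      have hxy := h.compare _ _ hox hoy (by rw [h.opp, h.opp, hp])
      have hyx := h.compare _ _ hoy hox (by rw [h.opp, h.opp, hp])
      have hlx := h.time_opp _ hox
      have hly := h.time_opp _ hoy
      rw [M.opp_opp] at hlx hly hxy hyx
      rcases lt_trichotomy (t (M.opp x)) (t (M.opp y)) with hlt | heq | hgt
      · have := hxy.2 hlt
        omega
      · exact M.opp.injective (hxy.1 heq)
      · have := hyx.2 hgt
        omega
    · have hn' : M.next y ≠ y := by
        rw [ne_eq, ← hs y hy, ← ht, hs x hx]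
        exact hn
      obtain ⟨a1, a2, a3⟩ := h.symm_of_in hx hn
      obtain ⟨b1, b2, b3⟩ := h.symm_of_in hy hn'
      exact M.next.symm.injective
        ((h.compare _ _ a1 b1 (by rw [a2, b2, hp])).1 (by rw [a3, b3, ht]))
  · exact (h.compare x y hx (ho ▸ hx) hp).1 ht

/-- Every line has a sink: the end of its last edge. -/
theorem exists_sink (h : M.IsLines o p t) {i : Fin n} (hi : ∃ x, o x = true ∧ p x = i) :
    ∃ x, o x = false ∧ M.next x = x ∧ p x = i := by
  classical
  have := M.finite
  have := Fintype.ofFinite M.Dart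
  obtain ⟨x₀, hx₀⟩ := hi
  obtain ⟨x, hx, hmax⟩ := Finset.exists_max_image
    (Finset.univ.filter fun x => o x = true ∧ p x = i) t ⟨x₀, by simpa using hx₀⟩
  rw [Finset.mem_filter] at hx
  have h1 : o (M.opp x) = false := by rw [h.orient.opp, hx.2.1]; rfl
  refine ⟨M.opp x, h1, ?_, by rw [h.opp, hx.2.2]⟩
  by_contra hn
  obtain ⟨a1, a2, a3⟩ := h.symm_of_in h1 hn
  have := hmax (M.next.symm (M.opp x)) (by simp [a1, a2, h.opp, hx.2.2])
  have := h.time_opp x hx.2.1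
  omega

end IsLines

/-- The cyclic permutation that is read off around a vertex `v` of an oriented map with positions
`p`. -/
theorem exists_vertex_cycle (ho : M.IsOrientation o) (p : M.Dart → Fin n)
    (hp : ∀ x, o x = true → M.next x ≠ x → p (M.next x) = p x) (v : M.Vertex)
    (hv : 4 ≤ M.degree v)
    (hinj : ∀ x y, M.vertexOf x = v → M.vertexOf y = v → o x = false → o y = false →
      p x = p y → x = y) :
    ∃ σ : Equiv.Perm (Fin n), σ.IsCycle ∧
      (∀ x, M.vertexOf x = v → o x = false → σ (p (M.next x)) = p x ∧ σ (p x) ≠ p x) ∧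
      ∀ i, σ i ≠ i → ∃ x, M.vertexOf x = v ∧ o x = false ∧ p x = i := by
  classical
  have := M.finite
  have hn : ∀ x, M.vertexOf x = v → M.next x ≠ x := by
    rintro x rfl hx
    have := (M.isLeafDart_iff x).2 hx
    rw [IsLeafDart] at this
    omega
  let P : M.Dart → Prop := fun x => M.vertexOf x = v ∧ o x = false
  have hoo : ∀ x, M.vertexOf x = v → o (M.next (M.next x)) = o x := fun x hx => by
    rw [ho.next _ (hn _ ((M.vertexOf_next x).trans hx)), ho.next _ (hn x hx), Bool.not_not]
  have hP : ∀ x, P ((M.next * M.next) x) ↔ P x := by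
    intro x
    simp only [P, Equiv.Perm.mul_apply, M.vertexOf_next]
    constructor
    · rintro ⟨h1, h2⟩
      exact ⟨h1, by rwa [hoo x h1] at h2⟩
    · rintro ⟨h1, h2⟩
      exact ⟨h1, by rwa [hoo x h1]⟩
  -- Two steps of the rotation lead from one arriving line to the next.
  let ν : Equiv.Perm {x // P x} := (M.next * M.next).subtypePerm hP
  have hν : ∀ x, (ν x).1 = M.next (M.next x.1) := fun x => rfl
  have hpow : ∀ (k : ℕ) x, ((ν ^ k) x).1 = (M.next ^ (2 * k)) x.1 := by
    intro k
    induction k with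
    | zero => simp
    | succ k ih =>
      intro x
      rw [pow_succ', Equiv.Perm.mul_apply, hν, ih, show 2 * (k + 1) = 1 + 1 + 2 * k by ring,
        pow_add, pow_add]
      rfl
  have hinj' : Function.Injective fun x : {x // P x} => p x.1 := fun x y h =>
    Subtype.ext (hinj x.1 y.1 x.2.1 y.2.1 x.2.2 y.2.2 h)
  let F : {x // P x} ≃ {i // i ∈ Set.range fun x : {x // P x} => p x.1} :=
    Equiv.ofInjective _ hinj'
  have hνne : ∀ x, ν x ≠ x := by
    intro x hx
    have h1 : M.next (M.next x.1) = x.1 := congrArg Subtype.val hx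
    have h2 : (M.next ^ (2 : ℤ)) x.1 = x.1 := h1
    have h3 := (MulAction.zpow_smul_eq_iff_minimalPeriod_dvd (a := M.next) (b := x.1)).1 h2
    rw [← degree_eq_minimalPeriod, x.2.1] at h3
    have := Int.le_of_dvd (by norm_num) h3
    omega
  have hne : ∃ x, P x := by
    obtain ⟨x, hx⟩ := M.exists_vertexOf v
    rcases h : o x
    · exact ⟨x, hx, h⟩
    · exact ⟨M.next x, (M.vertexOf_next x).trans hx, by rw [ho.next x (hn x hx), h]; rfl⟩
  have hcyc : ν.IsCycle := by
    obtain ⟨x, hx⟩ := hne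
    refine ⟨⟨x, hx⟩, hνne _, fun y _ => ?_⟩
    obtain ⟨k, -, -, hk⟩ :=
      (M.vertexOf_eq_iff.1 (hx.1.trans y.2.1.symm)).exists_pow_eq''
    have h1 := ho.alternates.zpow (hn x hx.1) k
    simp only [hk, hx.2, y.2.2] at h1
    have h2 : Even k := by
      rw [← ZMod.natCast_eq_zero_iff_even]
      exact left_eq_add.1 h1
    obtain ⟨j, rfl⟩ := h2
    refine ⟨j, Subtype.ext ?_⟩
    rw [zpow_natCast, hpow, two_mul, hk]
  have happ : ∀ x : {x // P x}, (ν.extendDomain F) (p x.1) = p (ν x).1 := fun x =>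
    Equiv.Perm.extendDomain_apply_image ν F x
  refine ⟨(ν.extendDomain F)⁻¹, (hcyc.extendDomain F).inv, ?_, ?_⟩
  · intro x hx hxo
    have h1 := happ ⟨x, hx, hxo⟩
    have h2 : p (M.next (M.next x)) = p (M.next x) := by
      refine hp _ ?_ (hn _ ((M.vertexOf_next x).trans hx))
      rw [ho.next x (hn x hx), hxo]; rfl
    rw [hν, h2] at h1
    refine ⟨by rw [Equiv.Perm.inv_eq_iff_eq, h1], fun hh => ?_⟩
    rw [Equiv.Perm.inv_eq_iff_eq] at hh
    exact hνne ⟨x, hx, hxo⟩ (hinj' (hh.trans (happ ⟨x, hx, hxo⟩)).symm)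
  · intro i hi
    by_contra! hc
    apply hi
    rw [Equiv.Perm.inv_eq_iff_eq]
    refine (Equiv.Perm.extendDomain_apply_not_subtype ν F ?_).symm
    rintro ⟨x, rfl⟩
    exact hc x.1 x.2.1 x.2.2 rfl

/-- An oriented map without directed cycles, labelled in accordance with `π`, is drawn by a cycle
factorization of `π`: the vertices are ordered in a way compatible with the directions of the edges,
and give one factor each. -/
theorem exists_drawing (ho : M.IsOrientation o)
    (hdeg : ∀ v, M.degree v = 1 ∨ 4 ≤ M.degree v)
    (hac : ∀ l u, M.IsWalk u l u → (∀ x ∈ l, o x = true) → l = [])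
    (hH : M.IsLabelling o π H)
    (hsrc : ∀ i, ∃ x, o x = true ∧ M.next x = x ∧ H x = i)
    (hinj : ∀ x y, o x = true → o y = true → M.next x = x → M.next y = y → H x = H y → x = y) :
    ∃ f : List (Equiv.Perm (Fin n)), IsCycleFactorization π f ∧
      ∃ d : Drawing M.next M.opp f, d.out = o ∧ d.label = H := by
  classical
  -- The vertices of degree at least four, in an order compatible with the orientation.
  let I := {v : M.Vertex // M.degree v ≠ 1}
  let R : I → I → Prop := fun a b =>
    ∃ x, o x = true ∧ M.vertexOf x = a.1 ∧ M.vertexOf (M.opp x) = b.1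
  have hwalk : ∀ a b, Relation.ReflTransGen R a b →
      ∃ l, M.IsWalk a.1 l b.1 ∧ ∀ x ∈ l, o x = true := by
    intro a b h
    induction h with
    | refl => exact ⟨[], rfl, by simp⟩
    | tail _ hbc ih =>
      obtain ⟨l, h1, h2⟩ := ih
      obtain ⟨x, h3, h4, h5⟩ := hbc
      refine ⟨l ++ [x], isWalk_append.2 ⟨_, h1, h4, h5⟩, fun y hy => ?_⟩
      rcases List.mem_append.1 hy with hy | hy
      · exact h2 y hy
      · rw [List.mem_singleton.1 hy, h3]
  obtain ⟨N, e, he⟩ := exists_linear_extension R (by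
    intro a b hab hba
    obtain ⟨l, h1, h2⟩ := hwalk a b hab
    obtain ⟨l', h1', h2'⟩ := hwalk b a hba
    have := hac (l ++ l') a.1 (isWalk_append.2 ⟨_, h1, h1'⟩) (fun x hx => by
      rcases List.mem_append.1 hx with hx | hx
      · exact h2 x hx
      · exact h2' x hx)
    rw [(List.append_eq_nil_iff.1 this).1] at h1
    exact Subtype.ext h1)
  have hin : ∀ x, M.next x ≠ x → M.degree (M.vertexOf x) ≠ 1 := fun x hx hh =>
    hx ((M.isLeafDart_iff x).1 hh)
  have hvn : ∀ x, M.next (M.next x) = M.next x ↔ M.next x = x := fun x =>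
    M.next.injective.eq_iff
  -- Time `0` is left to the sources and time `N + 1` to the sinks.
  let t : M.Dart → ℕ := fun x => if h : M.next x = x then (if o x = true then 0 else N + 1) else
    (e ⟨M.vertexOf x, hin x h⟩).val + 1
  have ht_in : ∀ x (h : M.next x ≠ x), t x = (e ⟨M.vertexOf x, hin x h⟩).val + 1 := fun x h => by
    simp only [t, h, dite_false]
  have ht_src : ∀ x, M.next x = x → o x = true → t x = 0 := fun x h h' => by
    simp only [t, h, dite_true, h', if_true]
  have ht_snk : ∀ x, M.next x = x → o x = false → t x = N + 1 := fun x h h' => by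
    simp only [t, h, dite_true, h']; rfl
  let p : M.Dart → Fin n := fun x => if o x = true then H (M.opp x) else H x
  have hp_out : ∀ x, o x = true → p x = H (M.opp x) := fun x hx => by simp [p, hx]
  have hp_in : ∀ x, o x = false → p x = H x := fun x hx => by simp [p, hx]
  have hp_src : ∀ x, o x = true → M.next x = x → p x = H x := fun x hx hn => by
    rw [hp_out x hx, ← hH.next_of_out ho hx, hn]
  have hL : M.IsLines o p t :=
    { orient := ho
      opp := fun x => by
        rcases hx : o x
        · rw [hp_out _ (by rw [ho.opp, hx]; rfl), M.opp_opp, hp_in x hx]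
        · rw [hp_in _ (by rw [ho.opp, hx]; rfl), hp_out x hx]
      next := fun x hx hn => by
        rw [hp_in _ (by rw [ho.next x hn, hx]; rfl), hp_out x hx, hH.next_of_out ho hx]
      time_next := fun x => by
        by_cases hn : M.next x = x
        · rw [hn]
        · rw [ht_in x hn, ht_in (M.next x) ((hvn x).not.2 hn)]
          simp only [M.vertexOf_next]
      time_opp := fun x hx => by
        have hx' : o (M.opp x) = false := by rw [ho.opp, hx]; rfl
        by_cases hn : M.next x = x
        · rw [ht_src x hn hx]
          by_cases hn' : M.next (M.opp x) = M.opp x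
          · rw [ht_snk _ hn' hx']; omega
          · rw [ht_in _ hn']; omega
        · rw [ht_in x hn]
          by_cases hn' : M.next (M.opp x) = M.opp x
          · rw [ht_snk _ hn' hx']; omega
          · rw [ht_in _ hn']
            have h1 := he ⟨M.vertexOf x, hin x hn⟩ ⟨M.vertexOf (M.opp x), hin _ hn'⟩
              ⟨x, hx, rfl, rfl⟩
            refine Nat.add_lt_add_right (lt_of_le_of_ne h1 fun hh => ?_) 1
            have h2 := congrArg Subtype.val (e.injective (Fin.ext hh))
            have := hac [x] (M.vertexOf x) ⟨rfl, Eq.symm h2⟩ (by simpa using hx)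
            simp at this
      time_source := fun x hx => by
        constructor
        · intro h
          by_contra hn
          rw [ht_in x hn] at h
          omega
        · intro hn
          exact ht_src x hn hx
      source_inj := fun x y hx hy hxn hyn h => by
        rw [hp_src x hx hxn, hp_src y hy hyn] at h
        exact hinj x y hx hy hxn hyn h }
  have hsink : ∀ x, o x = false → (t x = N + 1 ↔ M.next x = x) := fun x hx => by
    refine ⟨fun h => ?_, fun hn => ht_snk x hn hx⟩
    by_contra hn
    rw [ht_in x hn] at h
    omega
  have htv : ∀ x y, M.vertexOf x = M.vertexOf y → M.next x ≠ x → t x = t y := by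
    intro x y hxy hn
    have hn' : M.next y ≠ y := fun hh => hin x hn (by
      rw [hxy]; exact (M.isLeafDart_iff y).2 hh)
    rw [ht_in x hn, ht_in y hn']
    simp only [hxy]
  have hI : ∀ v : I, ∀ x, M.vertexOf x = v.1 → M.next x ≠ x := by
    rintro ⟨v, hv⟩ x rfl hx
    exact hv ((M.isLeafDart_iff x).2 hx)
  -- The factors are read off around the vertices.
  choose σ hσ1 hσ2 hσ3 using fun v : I => exists_vertex_cycle ho p hL.next v.1
    ((hdeg v.1).resolve_left v.2) fun x y hx hy hxo hyo hpe =>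
      hL.inj hsink x y (htv x y (hx.trans hy.symm) (hI v x hx)) hpe (hxo.trans hyo.symm)
  let f : List (Equiv.Perm (Fin n)) := List.ofFn fun s : Fin N => σ (e.symm s)
  have hlen : f.length = N := List.length_ofFn
  have hfac : ∀ x (h : M.next x ≠ x), factorAt f (t x) = σ ⟨M.vertexOf x, hin x h⟩ := by
    intro x h
    have h2 := (e ⟨M.vertexOf x, hin x h⟩).2
    rw [ht_in x h, factorAt_of_lt f _ (by omega)]
    simp [f]
  have hp_next : ∀ x, o x = false → M.next x ≠ x →
      factorAt f (t x) (p (M.next x)) = p x ∧ factorAt f (t x) (p x) ≠ p x := by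
    intro x hx hn
    rw [hfac x hn]
    exact hσ2 _ x rfl hx
  let d : Drawing M.next M.opp f :=
    { time := t
      pos := p
      out := o
      op_op := M.opp_opp
      out_op := ho.opp
      pos_op := hL.opp
      time_lt := hL.time_opp
      time_nx := hL.time_next
      nx_of_out := fun x hx => by
        by_cases hn : M.next x = x
        · exact .inl ⟨ht_src x hn hx, hn⟩
        · have h1 : o (M.next x) = false := by rw [ho.next x hn, hx]; rfl
          have h2 := (hp_next (M.next x) h1 ((hvn x).not.2 hn)).2
          rw [hL.time_next, hL.next x hx hn] at h2
          exact .inr ⟨h2, h1, hL.next x hx hn⟩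
      nx_of_in := fun x hx => by
        by_cases hn : M.next x = x
        · exact .inl ⟨by rw [hlen]; exact ht_snk x hn hx, hn⟩
        · have h1 : o (M.next x) = true := by rw [ho.next x hn, hx]; rfl
          have h2 := hp_next x hx hn
          exact .inr ⟨h2.2, h1, h2.1⟩
      inj := hL.inj hsink
      source := fun i => by
        obtain ⟨x, h1, h2, h3⟩ := hsrc i
        exact ⟨x, h1, ht_src x h2 h1, by rw [hp_src x h1 h2, h3]⟩
      sink := fun i => by
        obtain ⟨x, h1, h2, h3⟩ := hsrc i
        obtain ⟨y, h4, h5, h6⟩ := hL.exists_sink ⟨x, h1, (hp_src x h1 h2).trans h3⟩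
        exact ⟨y, h4, by rw [hlen]; exact ht_snk y h5 h4, h6⟩
      inner := fun s i hi => by
        obtain ⟨h0, h1⟩ := pos_of_factorAt_ne hi
        obtain ⟨s, rfl⟩ : ∃ k, s = k + 1 := ⟨s - 1, by omega⟩
        rw [factorAt_of_lt f s (by omega)] at hi
        have hs : s < N := by omega
        have h2 : f[s] = σ (e.symm ⟨s, hs⟩) := by simp [f]
        rw [h2] at hi
        obtain ⟨x, h3, h4, h5⟩ := hσ3 _ i hi
        refine ⟨x, h4, ?_, h5⟩
        rw [ht_in x (hI _ x h3)]
        simp only [h3, Subtype.coe_eta, Equiv.apply_symm_apply] }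
  have hdt : d.time = t := rfl
  have hdo : d.out = o := rfl
  have hdp : d.pos = p := rfl
  -- Labels agree on darts directed into their vertices by the choice of the positions, and are
  -- carried along the faces to the others.
  have hlab : ∀ x, d.label x = H x := by
    intro x
    induction hT : d.time x using Nat.strong_induction_on generalizing x with
    | _ T ih =>
      subst hT
      rcases hx : o x
      · rw [d.label_of_in hx]
        exact hp_in x hx
      · by_cases hn : M.next x = x
        · rw [d.label_source (ht_src x hn hx)]
          exact hp_src x hx hn
        · set z := M.next.symm x with hz
          have hxz : M.next z = x := by simp [hz]
          have hzn : M.next z ≠ z := fun hh => hn (by rw [← hxz, hvn]; exact hh)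
          have hzo : o z = false := by
            have := ho.next z hzn
            rw [hxz, hx] at this
            simpa using this.symm
          have h1 := d.label_nx_of_in (x := z) hzo (by
            rw [hlen]; exact (hsink z hzo).not.2 hzn)
          rw [hxz] at h1
          have h2 := hH.next_of_in ho hzo hzn
          rw [hxz] at h2
          have h3 : d.time (M.opp z) < d.time x := by
            rw [← hxz, d.time_nx]
            exact d.time_op_lt hzo
          rw [h1, h2]
          exact ih _ h3 _ rfl
  refine ⟨f, ⟨?_, ?_⟩, d, hdo, funext hlab⟩
  · intro τ hτ
    obtain ⟨s, rfl⟩ := (List.mem_ofFn' _ _).1 hτ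
    exact hσ1 _
  · ext1 i
    obtain ⟨y, h1, h2, h3⟩ := d.sink i
    have h4 := d.label_op_sink h2
    rw [hlab, hlab, hH.opp_sink ho h1 (d.nx_sink h2)] at h4
    have h5 : H y = i := by rw [← hlab, d.label_of_in h1, h3]
    rw [h5] at h4
    exact h4.symm

end SurfaceMap

/-! ### Drawings with equal lines -/

namespace Drawing

variable {D : Type} {n : ℕ} {nx op : Equiv.Perm D} {f f' : List (Equiv.Perm (Fin n))}

theorem time_eq_zero_iff (d : Drawing nx op f) {x : D} (hx : d.out x = true) :
    d.time x = 0 ↔ nx x = x := by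
  rw [d.nx_eq_self_iff]
  have := d.time_le_of_out hx
  omega

theorem time_eq_last_iff (d : Drawing nx op f) {x : D} (hx : d.out x = false) :
    d.time x = f.length + 1 ↔ nx x = x := by
  rw [d.nx_eq_self_iff]
  have := d.time_pos_of_in hx
  omega

/-- The factor at a vertex can be read off from the positions of the darts. -/
theorem factorAt_eq (d : Drawing nx op f) (d' : Drawing nx op f') (hc : ∀ σ ∈ f, σ.IsCycle)
    (hc' : ∀ σ ∈ f', σ.IsCycle) (hp : d.pos = d'.pos) (ho : d.out = d'.out) {x : D}
    (hx : nx x ≠ x) : factorAt f (d.time x) = factorAt f' (d'.time x) := by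
  have key : ∀ {g g' : List (Equiv.Perm (Fin n))} (e : Drawing nx op g) (e' : Drawing nx op g')
      (_ : ∀ σ ∈ g, σ.IsCycle) (_ : e.pos = e'.pos) (_ : e.out = e'.out) (i : Fin n),
      factorAt g (e.time x) i ≠ i → factorAt g' (e'.time x) i = factorAt g (e.time x) i ∧
        factorAt g' (e'.time x) i ≠ i := by
    intro g g' e e' hg hp ho i hi
    have hx1 := hx
    have hx2 := hx
    rw [ne_eq, e.nx_eq_self_iff, not_or] at hx1
    rw [ne_eq, e'.nx_eq_self_iff, not_or] at hx2
    have h1 : ∀ i, factorAt g (e.time x) i ≠ i →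
        ∃ y, e.out y = false ∧ e.time y = e.time x ∧ e.pos y = i ∧ e'.time y = e'.time x := by
      intro i hi
      obtain ⟨y, y1, y2, y3⟩ := e.inner _ i hi
      exact ⟨y, y1, y2, y3, e'.time_eq_of_sameCycle
        (e.sameCycle_nx_of_time_eq hg y2 (by rw [y2]; exact hx1.1) (by rw [y2]; exact hx1.2))⟩
    obtain ⟨z, z1, z2, z3, z4⟩ := h1 (factorAt g (e.time x) i)
      fun hh => hi ((factorAt g (e.time x)).injective hh)
    have h2 := (e.in_inner z1 (by rw [z2]; exact hx1.2)).2.2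
    have h3 := (e'.in_inner (ho ▸ z1) (by rw [z4]; exact hx2.2)).2.2
    rw [z2, z3] at h2
    rw [z4, ← hp, z3, (factorAt g (e.time x)).injective h2] at h3
    exact ⟨h3, by rw [h3]; exact hi⟩
  ext1 i
  by_cases hi : factorAt f (d.time x) i = i
  · by_contra hh
    have hi' : factorAt f' (d'.time x) i ≠ i := fun h => hh (hi.trans h.symm)
    exact (key d' d hc' hp.symm ho.symm i hi').2 hi
  · exact (key d d' hc hp ho i hi).1.symm

/-- The factors that move a point up to the vertex where its line arrives are those up to the
previous vertex on the line. -/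
theorem word_take_op (d : Drawing nx op f) {y : D} (hy : d.out y = false) :
    word (f.take (d.time y - 1)) (d.pos y) = word (f.take (d.time (op y))) (d.pos y) := by
  have h1 := d.time_op_lt hy
  refine word_take_eq f _ (by omega) fun u h2 h3 => ?_
  have := d.fixed_between (d.out_op_of_in hy) h2 (by rw [d.op_op]; omega)
  rwa [d.pos_op] at this

theorem word_take_out (d : Drawing nx op f) {x : D} (hx : d.out x = true) (hn : nx x ≠ x) :
    word (f.take (d.time x)) (d.pos x) =
      word (f.take (d.time (op (nx x)))) (d.pos x) ++ [factorAt f (d.time x)] := by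
  have h0 := (d.time_eq_zero_iff hx).not.2 hn
  obtain ⟨m, h1, h2⟩ := d.out_inner hx h0
  have h3 := d.word_take_op h1
  rw [h2, d.time_nx] at h3
  rw [take_factorAt f (pos_of_factorAt_ne m).1 (pos_of_factorAt_ne m).2, word, List.filter_append]
  simp only [word] at h3
  rw [h3]
  simp [word, m]

/-- If two factorizations are drawn on the same map with the same lines, then they are
equivalent. -/
theorem eqvGen_of_pos_eq (d : Drawing nx op f) (d' : Drawing nx op f') (hc : ∀ σ ∈ f, σ.IsCycle)
    (hc' : ∀ σ ∈ f', σ.IsCycle) (hp : d.pos = d'.pos) (ho : d.out = d'.out) :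
    Relation.EqvGen SwapStep f f' := by
  refine eqvGen_of_word_eq f f' (fun σ h => (hc σ h).ne_one) (fun σ h => (hc' σ h).ne_one)
    fun i => ?_
  have key : ∀ x, d.out x = true →
      word (f.take (d.time x)) (d.pos x) = word (f'.take (d'.time x)) (d.pos x) := by
    intro x
    induction ht : d.time x using Nat.strong_induction_on generalizing x with
    | _ t ih =>
      subst ht
      intro hx
      by_cases hn : nx x = x
      · rw [(d.time_eq_zero_iff hx).2 hn, (d'.time_eq_zero_iff (ho ▸ hx)).2 hn]
        rfl
      · have h0 := (d.time_eq_zero_iff hx).not.2 hn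
        have h2 := d.out_inner hx h0
        have h1 := d.time_op_lt h2.2.1
        rw [d.time_nx] at h1
        have h3 := ih _ h1 (op (nx x)) rfl (d.out_op_of_in h2.2.1)
        rw [d.pos_op, h2.2.2] at h3
        rw [d.word_take_out hx hn, h3]
        have h4 := d'.word_take_out (x := x) (ho ▸ hx) hn
        rw [← hp] at h4
        rw [h4, d.factorAt_eq d' hc hc' hp ho hn]
  obtain ⟨y, y1, y2, rfl⟩ := d.sink i
  have hn := (d.time_eq_last_iff y1).1 y2
  have y1' : d'.out y = false := ho ▸ y1
  have y2' := (d'.time_eq_last_iff y1').2 hn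
  have h1 := d.word_take_op y1
  have h2 := d'.word_take_op y1'
  rw [y2, Nat.add_sub_cancel, List.take_length] at h1
  rw [y2', Nat.add_sub_cancel, List.take_length, ← hp] at h2
  rw [h1, h2]
  have := key (op y) (d.out_op_of_in y1)
  rwa [d.pos_op] at this

end Drawing

/-! ### Equivariant labellings of cycles -/

section Twisted

variable {X Y : Type} (φ : Equiv.Perm X) (u : X → Prop) [DecidablePred u]

/-- The number of points satisfying `u` among the first `k` points of the orbit of `x`. -/
def visits (k : ℕ) (x : X) : ℕ := ∑ i ∈ Finset.range k, if u (φ^[i] x) then 1 else 0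

theorem visits_succ (k : ℕ) (x : X) :
    visits φ u (k + 1) x = visits φ u k (φ x) + if u x then 1 else 0 := by
  rw [visits, Finset.sum_range_succ']
  rfl

theorem visits_add (k k' : ℕ) (x : X) :
    visits φ u (k + k') x = visits φ u k x + visits φ u k' (φ^[k] x) := by
  rw [visits, Finset.sum_range_add, visits, visits]
  congr 1
  refine Finset.sum_congr rfl fun i _ => ?_
  rw [← Function.iterate_add_apply, add_comm]

variable {φ u}

theorem visits_mul {p : ℕ} {x : X} (h : φ^[p] x = x) (q : ℕ) :
    visits φ u (p * q) x = q * visits φ u p x := by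
  induction q with
  | zero => simp [visits]
  | succ q ih =>
    have : φ^[p * q] x = x := (Function.IsPeriodicPt.const_mul h q) |> fun hh => by
      rw [mul_comm]; exact hh
    rw [mul_add, mul_one, visits_add, this, ih]
    ring

/-- Once around its cycle, a point meets every point of the cycle exactly once. -/
theorem visits_minimalPeriod [Finite X] (x : X) :
    visits φ u (Function.minimalPeriod φ x) x = Nat.card {y // φ.SameCycle y x ∧ u y} := by
  classical
  have := Fintype.ofFinite X
  rw [visits, ← Finset.card_filter, Nat.card_eq_fintype_card, Fintype.card_subtype]
  refine Finset.card_bij (fun i _ => φ^[i] x) ?_ ?_ ?_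
  · intro i hi
    rw [Finset.mem_filter] at hi ⊢
    refine ⟨Finset.mem_univ _, SameCycle.symm ⟨i, ?_⟩, hi.2⟩
    rw [zpow_natCast, Equiv.Perm.iterate_eq_pow]
  · intro i hi j hj h
    simp only [Finset.mem_filter, Finset.mem_range] at hi hj
    exact Function.iterate_injOn_Iio_minimalPeriod hi.1 hj.1 h
  · intro y hy
    rw [Finset.mem_filter] at hy
    obtain ⟨k, -, -, hk⟩ := hy.2.1.symm.exists_pow_eq''
    rw [← Equiv.Perm.iterate_eq_pow] at hk
    have hpos : 0 < Function.minimalPeriod φ x := by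
      rw [← natCard_sameCycle]
      exact Nat.card_pos_iff.2 ⟨⟨⟨x, .refl _ _⟩⟩, inferInstance⟩
    have hk' : φ^[k % Function.minimalPeriod φ x] x = y := by
      rw [Function.iterate_mod_minimalPeriod_eq, hk]
    refine ⟨_, Finset.mem_filter.2 ⟨Finset.mem_range.2 (Nat.mod_lt _ hpos), ?_⟩, hk'⟩
    rw [hk']
    exact hy.2.2

/-- Functions that commute with two permutations, up to a twist by `ψ` at the points that satisfy
`u`, can be prescribed at one point of every cycle, provided that the cycle of the value has as many
elements as the given cycle has points satisfying `u`. -/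
theorem natCard_twisted [Finite X] [Finite Y] {m : ℕ} (ψ : Equiv.Perm Y) (lX : X → Fin m)
    (lY : Y → Fin m) (hX : ∀ x y, lX x = lX y ↔ φ.SameCycle x y)
    (hY : ∀ x y, lY x = lY y ↔ ψ.SameCycle x y) (α : Fin m → ℕ)
    (hsX : Function.Surjective lX) (huX : ∀ j, Nat.card {x // lX x = j ∧ u x} = α j)
    (hcY : ∀ j, Nat.card {y // lY y = j} = α j) (x₀ : X) (y₀ : Y) (h₀ : lY y₀ = lX x₀) :
    Nat.card {H : X → Y // (∀ x, H x = if u x then ψ (H (φ x)) else H (φ x)) ∧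
      (∀ x, lY (H x) = lX x) ∧ H x₀ = y₀} = ∏ j ∈ Finset.univ.erase (lX x₀), α j := by
  classical
  have hbase : ∃ b : Fin m → X, (∀ j, lX (b j) = j) ∧ b (lX x₀) = x₀ := by
    choose b hb using hsX
    refine ⟨Function.update b (lX x₀) x₀, fun j => ?_, by simp⟩
    by_cases hj : j = lX x₀
    · subst hj; simp
    · simp [hj, hb]
  obtain ⟨b, hb, hb0⟩ := hbase
  have hit : ∀ x, ∃ k : ℕ, φ^[k] x = b (lX x) := by
    intro x
    obtain ⟨k, -, -, hk⟩ := ((hX x (b (lX x))).1 (hb _).symm).exists_pow_eq''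
    exact ⟨k, by rw [Equiv.Perm.iterate_eq_pow]; exact hk⟩
  choose k hk using hit
  have htw : ∀ H : X → Y, (∀ x, H x = if u x then ψ (H (φ x)) else H (φ x)) →
      ∀ k x, H x = ψ^[visits φ u k x] (H (φ^[k] x)) := by
    intro H hH k
    induction k with
    | zero => intro x; rfl
    | succ k ih =>
      intro x
      rw [hH x, visits_succ, Function.iterate_succ_apply, ih (φ x)]
      split_ifs
      · rw [Function.iterate_succ_apply']
      · rfl
  have hper : ∀ y, ψ^[α (lY y)] y = y := by
    intro y
    have : α (lY y) = Function.minimalPeriod ψ y := by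
      rw [← natCard_sameCycle, ← hcY]
      exact Nat.card_congr (Equiv.subtypeEquivRight fun z => hY z y)
    rw [this]
    exact Function.iterate_minimalPeriod
  -- A full turn of the cycle of `x` twists by the `α j`-th power of `ψ`, which is trivial on the
  -- cycle of the values; so the twist does not depend on the chosen number of steps.
  have hwd : ∀ (y : Y) (k k' : ℕ) (x : X), k ≤ k' → φ^[k] x = φ^[k'] x → lX x = lY y →
      ψ^[visits φ u k' x] y = ψ^[visits φ u k x] y := by
    intro y k k' x hkk heq hl
    obtain ⟨c, rfl⟩ := Nat.exists_eq_add_of_le hkk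
    rw [add_comm k c, Function.iterate_add_apply] at heq
    set z := φ^[k] x with hz
    have hzl : lX z = lX x := by
      rw [hX]
      refine SameCycle.symm ⟨k, ?_⟩
      rw [hz, zpow_natCast, Equiv.Perm.iterate_eq_pow]
    obtain ⟨q, rfl⟩ := Function.IsPeriodicPt.minimalPeriod_dvd (f := φ) (x := z) heq.symm
    have hα' : visits φ u (Function.minimalPeriod φ z) z = α (lY y) := by
      rw [visits_minimalPeriod, ← hl, ← hzl, ← huX]
      exact Nat.card_congr (Equiv.subtypeEquivRight fun y => by rw [hX])
    rw [visits_add, ← hz, visits_mul Function.iterate_minimalPeriod, hα',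
      Function.iterate_add_apply]
    congr 1
    exact (Function.IsPeriodicPt.const_mul (hper y) q)
  have hdet : ∀ H H' : X → Y, (∀ x, H x = if u x then ψ (H (φ x)) else H (φ x)) →
      (∀ x, H' x = if u x then ψ (H' (φ x)) else H' (φ x)) → (∀ j, H (b j) = H' (b j)) →
      H = H' := by
    intro H H' hH hH' hbb
    funext x
    rw [htw H hH (k x) x, htw H' hH' (k x) x, hk, hbb]
  rw [Nat.card_eq_of_bijective (fun H : {H : X → Y //
      (∀ x, H x = if u x then ψ (H (φ x)) else H (φ x)) ∧ (∀ x, lY (H x) = lX x) ∧ H x₀ = y₀} =>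
    ((fun j => ⟨H.1 (b j.1), (H.2.2.1 _).trans (hb _)⟩) :
      (j : {j : Fin m // j ≠ lX x₀}) → {y // lY y = j.1})) ⟨?_, ?_⟩]
  · rw [Nat.card_pi]
    simp only [hcY]
    rw [← Finset.prod_subtype (Finset.univ.erase (lX x₀)) (fun j => by simp) α]
  · rintro ⟨H, hH, hl, h0⟩ ⟨H', hH', hl', h0'⟩ h
    refine Subtype.ext (hdet H H' hH hH' fun j => ?_)
    by_cases hj : j = lX x₀
    · rw [hj, hb0, h0, h0']
    · simpa using congrFun h ⟨j, hj⟩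
  · intro a
    let a' : Fin m → Y := fun j => if hj : j = lX x₀ then y₀ else (a ⟨j, hj⟩).1
    have ha' : ∀ j, lY (a' j) = j := by
      intro j
      by_cases hj : j = lX x₀
      · simp only [a', hj, dite_true]; exact h₀
      · simp only [a', hj, dite_false]; exact (a ⟨j, hj⟩).2
    let H : X → Y := fun x => ψ^[visits φ u (k x) x] (a' (lX x))
    have hHk : ∀ x k', φ^[k'] x = b (lX x) → H x = ψ^[visits φ u k' x] (a' (lX x)) := by
      intro x k' hk'
      have h1 : φ^[k x] x = φ^[k'] x := by rw [hk, hk']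
      rcases le_total (k x) k' with h | h
      · exact (hwd _ _ _ x h h1 (ha' _).symm).symm
      · exact hwd _ _ _ x h h1.symm (ha' _).symm
    have hφ : ∀ x, lX (φ x) = lX x := fun x => (hX _ _).2 (sameCycle_apply_left.2 (.refl _ _))
    have hHb : ∀ j, H (b j) = a' j := by
      intro j
      have h1 : φ^[0] (b j) = b (lX (b j)) := by rw [hb]; rfl
      rw [hHk (b j) 0 h1, hb]
      rfl
    refine ⟨⟨H, fun x => ?_, fun x => ?_, ?_⟩, ?_⟩
    · have h1 : φ^[k (φ x) + 1] x = b (lX x) := by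
        rw [Function.iterate_succ_apply, hk, hφ]
      rw [hHk x _ h1, visits_succ]
      simp only [H, hφ]
      split_ifs
      · rw [Function.iterate_succ_apply']
      · rfl
    · rw [← ha' (lX x)]
      simp only [ha']
      conv_rhs => rw [← ha' (lX x)]
      rw [hY]
      refine SameCycle.symm ⟨(visits φ u (k x) x : ℕ), ?_⟩
      rw [zpow_natCast, ← Equiv.Perm.iterate_eq_pow]
    · rw [← hb0, hHb]
      simp [a']
    · funext j
      refine Subtype.ext ((hHb j.1).trans ?_)
      simp only [a', j.2, dite_false]

end Twisted

/-! ### Labelling the cycles of a permutation -/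

/-- Two families with the same multiset of values differ by a bijection of the index types. -/
theorem exists_equiv_of_map_eq {A B : Type*} [Fintype A] [Fintype B] (s : A → ℕ) (t : B → ℕ)
    (h : Finset.univ.val.map s = Finset.univ.val.map t) : ∃ e : A ≃ B, ∀ a, t (e a) = s a := by
  classical
  have hk : ∀ k, Nonempty ({a // s a = k} ≃ {b // t b = k}) := by
    intro k
    rw [← Fintype.card_eq, Fintype.card_subtype, Fintype.card_subtype]
    have := congrArg (Multiset.count k) h
    rw [Multiset.count_map, Multiset.count_map] at this
    simpa [Finset.card_def, eq_comm] using this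
  let e := fun k => (hk k).some
  refine ⟨(Equiv.sigmaFiberEquiv s).symm.trans ((Equiv.sigmaCongrRight e).trans
    (Equiv.sigmaFiberEquiv t)), fun a => ?_⟩
  exact (e (s a) ⟨a, rfl⟩).2

/-- The cycles of a permutation of cycle type `α` can be labelled so that the cycle with label `j`
has `α j` elements. -/
theorem exists_cycle_labels {m n : ℕ} {π : Equiv.Perm (Fin n)} {α : Fin m → ℕ}
    (hπ : HasCycleType π α) : ∃ lam : Fin n → Fin m,
      (∀ i j, lam i = lam j ↔ π.SameCycle i j) ∧ ∀ j, Nat.card {i // lam i = j} = α j := by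
  classical
  -- The cycles, fixed points included, and their lengths.
  let size : {c // c ∈ π.cycleFactorsFinset} ⊕ {i // π i = i} → ℕ :=
    Sum.elim (fun c => c.1.support.card) fun _ => 1
  have hsize : Finset.univ.val.map size = Finset.univ.val.map α := by
    rw [← hπ, parts_partition, ← Finset.univ_disjSum_univ, Finset.val_disjSum,
      Multiset.map_disjSum]
    congr 1
    · rw [cycleType_def]
      exact Multiset.attach_map_val' π.cycleFactorsFinset.1 (fun c => c.support.card)
    · change Multiset.map (fun _ => 1) _ = _
      rw [Multiset.map_const']
      congr 1
      rw [← Finset.card_def, Finset.card_univ, Fintype.card_subtype, ← Finset.card_compl]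
      congr 1
      ext i
      simp
  obtain ⟨e, he⟩ := exists_equiv_of_map_eq _ _ hsize
  let cyc : Fin n → {c // c ∈ π.cycleFactorsFinset} ⊕ {i // π i = i} := fun i =>
    if h : π i = i then .inr ⟨i, h⟩ else
      .inl ⟨π.cycleOf i, cycleOf_mem_cycleFactorsFinset_iff.2 (Equiv.Perm.mem_support.2 h)⟩
  have hf : ∀ i (h : π i = i), cyc i = .inr ⟨i, h⟩ := fun i h => by simp [cyc, h]
  have hm : ∀ i (h : π i ≠ i), cyc i =
      .inl ⟨π.cycleOf i, cycleOf_mem_cycleFactorsFinset_iff.2 (Equiv.Perm.mem_support.2 h)⟩ :=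
    fun i h => by simp [cyc, h]
  have hfix : ∀ i j, π i = i → π.SameCycle i j → i = j := by
    rintro i j h ⟨k, rfl⟩
    exact (zpow_apply_eq_self_of_apply_eq_self h k).symm
  have hcyc : ∀ i j, cyc i = cyc j ↔ π.SameCycle i j := by
    intro i j
    by_cases hi : π i = i <;> by_cases hj : π j = j
    · rw [hf i hi, hf j hj]
      constructor
      · intro h
        have : i = j := by simpa using h
        exact this ▸ .refl _ _
      · intro h
        simpa using hfix i j hi h
    · rw [hf i hi, hm j hj]
      simp only [reduceCtorEq, false_iff]
      intro h
      exact hj (hfix i j hi h ▸ hi)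
    · rw [hm i hi, hf j hj]
      simp only [reduceCtorEq, false_iff]
      intro h
      exact hi (hfix j i hj h.symm ▸ hj)
    · rw [hm i hi, hm j hj, Sum.inl.injEq, Subtype.mk.injEq]
      exact (sameCycle_iff_cycleOf_eq_of_mem_support (Equiv.Perm.mem_support.2 hi)
        (Equiv.Perm.mem_support.2 hj)).symm
  refine ⟨fun i => e (cyc i), fun i j => by rw [e.injective.eq_iff, hcyc], fun j => ?_⟩
  obtain ⟨k, rfl⟩ := e.surjective j
  rw [he]
  have h1 : Nat.card {i // e (cyc i) = e k} = Nat.card {i // cyc i = k} :=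
    Nat.card_congr (Equiv.subtypeEquivRight fun i => e.injective.eq_iff)
  rw [h1]
  rcases k with ⟨c, hc⟩ | ⟨i, hi⟩
  · change _ = c.support.card
    rw [← Fintype.card_coe, ← Nat.card_eq_fintype_card]
    refine Nat.card_congr (Equiv.subtypeEquivRight fun i => ?_)
    constructor
    · intro h
      by_cases hi : π i = i
      · rw [hf i hi] at h
        simp at h
      · rw [hm i hi, Sum.inl.injEq, Subtype.mk.injEq] at h
        rw [← h, mem_support_cycleOf_iff]
        exact ⟨.refl _ _, Equiv.Perm.mem_support.2 hi⟩
    · intro h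
      have h2 := cycle_is_cycleOf h hc
      have h3 : π i ≠ i := Equiv.Perm.mem_support.1 (mem_cycleFactorsFinset_support_le hc h)
      rw [hm i h3, Sum.inl.injEq, Subtype.mk.injEq, h2]
  · change _ = 1
    rw [Nat.card_eq_one_iff_unique]
    refine ⟨⟨?_⟩, ⟨⟨i, hf i hi⟩⟩⟩
    have key : ∀ a, cyc a = .inr ⟨i, hi⟩ → a = i := by
      intro a ha
      rw [← hf i hi, hcyc] at ha
      exact (hfix i a hi ha.symm).symm
    rintro ⟨a, ha⟩ ⟨b, hb⟩
    exact Subtype.ext ((key a ha).trans (key b hb).symm)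

theorem numCycles_eq {m n : ℕ} {π : Equiv.Perm (Fin n)} {α : Fin m → ℕ}
    (hπ : HasCycleType π α) : numCycles π = m := by
  rw [numCycles, hπ]
  simp

/-! ### Sources and sinks of the faces -/

namespace SurfaceMap

variable {M : SurfaceMap} {n m : ℕ} {o : M.Dart → Bool} {π : Equiv.Perm (Fin n)}
  {H : M.Dart → Fin n} {F : M.Dart → Fin m} {α : Fin m → ℕ} {lam : Fin n → Fin m}

theorem face_faceNext (hF : ∀ x y, F x = F y ↔ M.faceNext.SameCycle x y) (x : M.Dart) :
    F (M.faceNext x) = F x :=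
  (hF _ _).2 (sameCycle_apply_left.2 (.refl _ _))

theorem faceNext_of_sink_turn (ho : M.IsOrientation o) {x : M.Dart} (h1 : o x = true)
    (h2 : o (M.faceNext x) = false) : M.faceNext x = M.opp x := by
  by_contra hn
  have := ho.next (M.opp x) hn
  rw [ho.opp, h1] at this
  exact absurd (h2.symm.trans this) (by simp)

theorem faceNext_of_source_turn (ho : M.IsOrientation o) {x : M.Dart} (h1 : o x = false)
    (h2 : o (M.faceNext x) = true) : M.faceNext x = M.opp x := by
  by_contra hn
  have := ho.next (M.opp x) hn
  rw [ho.opp, h1] at this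
  exact absurd (h2.symm.trans this) (by simp)

theorem faceNext_opp (x : M.Dart) : M.faceNext (M.opp x) = M.next x := by
  rw [faceNext, Equiv.Perm.mul_apply, M.opp_opp]

/-- Along a face, sources and sinks alternate; hence half of the leaves are of either kind. -/
theorem card_turns (ho : M.IsOrientation o) (hF : ∀ x y, F x = F y ↔ M.faceNext.SameCycle x y)
    (hl : ∀ j, Nat.card {x // M.IsLeafDart x ∧ F x = j} = 2 * α j) (j : Fin m) :
    Nat.card {x // F x = j ∧ (o x = true ∧ o (M.faceNext x) = false)} = α j ∧
      Nat.card {x // F x = j ∧ (o x = true ∧ M.next x = x)} = α j := by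
  classical
  have := M.finite
  have := Fintype.ofFinite M.Dart
  have hFn := face_faceNext hF
  have hFo : ∀ x, M.next (M.opp x) = M.opp x → F (M.opp x) = F x := by
    intro x hx
    rw [← hFn x, faceNext, Equiv.Perm.mul_apply, hx]
  let S : Finset M.Dart := Finset.univ.filter fun x => F x = j
  -- In a face, as many darts `x` have direction `out` as have a successor with direction `out`.
  have hAB : (S.filter fun x => o (M.faceNext x) = true).card =
      (S.filter fun x => o x = true).card := by
    refine Finset.card_bij (fun x _ => M.faceNext x) ?_ (fun a _ b _ h => M.faceNext.injective h) ?_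
    · intro x hx
      simpa [S, hFn] using hx
    · intro y hy
      refine ⟨M.faceNext.symm y, ?_, by simp⟩
      have := hFn (M.faceNext.symm y)
      rw [Equiv.apply_symm_apply] at this
      simpa [S, ← this] using hy
  have hsd := Finset.card_sdiff_comm hAB
  have e1 : (S.filter fun x => o x = true) \ (S.filter fun x => o (M.faceNext x) = true) =
      Finset.univ.filter fun x => F x = j ∧ (o x = true ∧ o (M.faceNext x) = false) := by
    ext x; simp [S]; tauto
  have e2 : (S.filter fun x => o (M.faceNext x) = true) \ (S.filter fun x => o x = true) =
      Finset.univ.filter fun x => F x = j ∧ (o x = false ∧ o (M.faceNext x) = true) := by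
    ext x; simp [S]; tauto
  rw [e1, e2] at hsd
  have c1 : (Finset.univ.filter fun x => F x = j ∧ (o x = true ∧ o (M.faceNext x) = false)).card =
      (Finset.univ.filter fun x => F x = j ∧ (o x = false ∧ M.next x = x)).card := by
    refine Finset.card_bij (fun x _ => M.faceNext x) ?_ (fun a _ b _ h => M.faceNext.injective h) ?_
    · intro x hx
      rw [Finset.mem_filter] at hx
      obtain ⟨-, h1, h2, h3⟩ := hx
      have h4 := faceNext_of_sink_turn ho h2 h3
      refine Finset.mem_filter.2 ⟨Finset.mem_univ _, (hFn x).trans h1, h3, ?_⟩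
      rw [h4]
      exact h4
    · intro y hy
      rw [Finset.mem_filter] at hy
      obtain ⟨-, h1, h2, h3⟩ := hy
      have h4 : M.faceNext (M.opp y) = y := (faceNext_opp y).trans h3
      refine ⟨M.opp y, Finset.mem_filter.2 ⟨Finset.mem_univ _, ?_, ?_, ?_⟩, h4⟩
      · rw [← hFn, h4, h1]
      · rw [ho.opp, h2]; rfl
      · rw [h4, h2]
  have c2 : (Finset.univ.filter fun x => F x = j ∧ (o x = false ∧ o (M.faceNext x) = true)).card =
      (Finset.univ.filter fun x => F x = j ∧ (o x = true ∧ M.next x = x)).card := by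
    refine Finset.card_bij (fun x _ => M.faceNext x) ?_ (fun a _ b _ h => M.faceNext.injective h) ?_
    · intro x hx
      rw [Finset.mem_filter] at hx
      obtain ⟨-, h1, h2, h3⟩ := hx
      have h4 := faceNext_of_source_turn ho h2 h3
      refine Finset.mem_filter.2 ⟨Finset.mem_univ _, (hFn x).trans h1, h3, ?_⟩
      rw [h4]
      exact h4
    · intro y hy
      rw [Finset.mem_filter] at hy
      obtain ⟨-, h1, h2, h3⟩ := hy
      have h4 : M.faceNext (M.opp y) = y := (faceNext_opp y).trans h3
      refine ⟨M.opp y, Finset.mem_filter.2 ⟨Finset.mem_univ _, ?_, ?_, ?_⟩, h4⟩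
      · rw [← hFn, h4, h1]
      · rw [ho.opp, h2]; rfl
      · rw [h4, h2]
  have c3 : (Finset.univ.filter fun x => F x = j ∧ (o x = true ∧ M.next x = x)).card +
      (Finset.univ.filter fun x => F x = j ∧ (o x = false ∧ M.next x = x)).card = 2 * α j := by
    rw [← hl j, Nat.card_eq_fintype_card, Fintype.card_subtype, ← Finset.card_union_of_disjoint]
    · congr 1
      ext x
      simp only [Finset.mem_union, Finset.mem_filter, Finset.mem_univ, true_and, M.isLeafDart_iff]
      cases o x <;> simp <;> tauto
    · rw [Finset.disjoint_filter]
      rintro x - ⟨-, h, -⟩ ⟨-, h', -⟩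
      rw [h] at h'
      simp at h'
  rw [Nat.card_eq_fintype_card, Fintype.card_subtype, Nat.card_eq_fintype_card,
    Fintype.card_subtype]
  omega

/-- Every label is the label of a unique source: from any dart, one comes along the face first to a
sink, where `π⁻¹` is applied, and then to a source. -/
theorem IsLabelling.sources (hH : M.IsLabelling o π H) (ho : M.IsOrientation o)
    (hF : ∀ x y, F x = F y ↔ M.faceNext.SameCycle x y) (hFs : Function.Surjective F)
    (hl : ∀ j, Nat.card {x // M.IsLeafDart x ∧ F x = j} = 2 * α j) (hα : ∀ j, 0 < α j)
    (hn : ∑ j, α j = n) (hlam : ∀ i j, lam i = lam j ↔ π.SameCycle i j)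
    (hHF : ∀ x, lam (H x) = F x) :
    (∀ i, ∃ x, o x = true ∧ M.next x = x ∧ H x = i) ∧
      ∀ x y, o x = true → o y = true → M.next x = x → M.next y = y → H x = H y → x = y := by
  classical
  have := M.finite
  have := Fintype.ofFinite M.Dart
  have hFn := face_faceNext hF
  have reach : ∀ x, ∃ y, (o y = true ∧ o (M.faceNext y) = false) ∧ ∃ k, M.faceNext^[k] x = y := by
    intro x
    have h1 := (card_turns ho hF hl (F x)).1
    have h2 := hα (F x)
    rw [← h1, Nat.card_pos_iff] at h2
    obtain ⟨⟨y, h3, h4⟩⟩ := h2.1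
    obtain ⟨k, -, -, hk⟩ := ((hF y x).1 h3).symm.exists_pow_eq''
    exact ⟨y, h4, k, by rw [Equiv.Perm.iterate_eq_pow]; exact hk⟩
  have toSink : ∀ x, ∃ z, o z = false ∧ F z = F x ∧ H x = π (H z) := by
    intro x
    obtain ⟨y, hy, k, hk⟩ := reach x
    induction k generalizing x with
    | zero =>
      obtain rfl : x = y := hk
      exact ⟨M.faceNext x, hy.2, hFn x, by rw [hH x, if_pos hy]⟩
    | succ k ih =>
      by_cases hx : o x = true ∧ o (M.faceNext x) = false
      · exact ⟨M.faceNext x, hx.2, hFn x, by rw [hH x, if_pos hx]⟩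
      · obtain ⟨z, z1, z2, z3⟩ := ih (M.faceNext x) hk
        exact ⟨z, z1, z2.trans (hFn x), by rw [hH x, if_neg hx, z3]⟩
  have toSource : ∀ z, o z = false →
      ∃ s, o s = true ∧ M.next s = s ∧ F s = F z ∧ H s = H z := by
    intro z hz
    obtain ⟨y, hy, k, hk⟩ := reach z
    induction k generalizing z with
    | zero =>
      obtain rfl : z = y := hk
      exact absurd (hz.symm.trans hy.1) (by simp)
    | succ k ih =>
      have h1 : H z = H (M.faceNext z) := by rw [hH z, if_neg (by simp [hz])]
      rcases h2 : o (M.faceNext z)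
      · obtain ⟨s, s1, s2, s3, s4⟩ := ih (M.faceNext z) h2 hk
        exact ⟨s, s1, s2, s3.trans (hFn z), s4.trans h1.symm⟩
      · have h3 := faceNext_of_source_turn ho hz h2
        refine ⟨M.faceNext z, h2, ?_, hFn z, h1.symm⟩
        rw [h3]
        exact h3
  have hsurj : ∀ i, ∃ x, o x = true ∧ M.next x = x ∧ H x = i := by
    intro i
    have key : ∀ k x, π^[k + 1] i = H x → ∃ s, o s = true ∧ M.next s = s ∧ H s = i := by
      intro k
      induction k with
      | zero =>
        intro x hx
        obtain ⟨z, z1, -, z3⟩ := toSink x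
        obtain ⟨s, s1, s2, -, s4⟩ := toSource z z1
        exact ⟨s, s1, s2, s4.trans (π.injective (z3.symm.trans hx.symm))⟩
      | succ k ih =>
        intro x hx
        obtain ⟨z, z1, -, z3⟩ := toSink x
        rw [Function.iterate_succ_apply'] at hx
        exact ih z (π.injective (hx.trans z3))
    obtain ⟨x, hx⟩ := hFs (lam i)
    rw [← hHF x, eq_comm, hlam] at hx
    obtain ⟨k, hk, -, hk'⟩ := hx.exists_pow_eq''
    refine key (k - 1) x ?_
    rw [Nat.sub_add_cancel hk, Equiv.Perm.iterate_eq_pow, hk']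
  refine ⟨hsurj, ?_⟩
  have hcard : Fintype.card {x // o x = true ∧ M.next x = x} = Fintype.card (Fin n) := by
    rw [Fintype.card_subtype, Fintype.card_fin, ← hn,
      Finset.card_eq_sum_card_fiberwise (f := F) (t := Finset.univ) (fun _ _ => Finset.mem_univ _)]
    refine Finset.sum_congr rfl fun j _ => ?_
    rw [← (card_turns ho hF hl j).2, Nat.card_eq_fintype_card, Fintype.card_subtype,
      Finset.filter_filter]
    congr 1
    ext x
    simp only [Finset.mem_filter]
    tauto
  have hb := (Fintype.bijective_iff_surjective_and_card
    (fun x : {x // o x = true ∧ M.next x = x} => H x.1)).2 ⟨fun i => by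
      obtain ⟨x, h1, h2, h3⟩ := hsurj i
      exact ⟨⟨x, h1, h2⟩, h3⟩, hcard⟩
  intro x y hx hy hxn hyn h
  have := hb.1 (a₁ := ⟨x, hx, hxn⟩) (a₂ := ⟨y, hy, hyn⟩) h
  simpa using this

end SurfaceMap

/-! ### The correspondence -/

namespace Drawing

variable {D E : Type} {n : ℕ} {nx op : Equiv.Perm D} {nx' op' : Equiv.Perm E}
  {f f' : List (Equiv.Perm (Fin n))}

/-- Positions and directions determine the labels. -/
theorem label_eq_of_pos_eq (d : Drawing nx op f) (d' : Drawing nx op f') (hp : d.pos = d'.pos)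
    (ho : d.out = d'.out) : d.label = d'.label := by
  funext x
  induction ht : d.time x using Nat.strong_induction_on generalizing x with
  | _ t ih =>
    subst ht
    rcases hx : d.out x
    · rw [d.label_of_in hx, d'.label_of_in (ho ▸ hx), hp]
    · have hx' : d'.out x = true := ho ▸ hx
      by_cases hn : nx x = x
      · rw [d.label_source ((d.time_eq_zero_iff hx).2 hn),
          d'.label_source ((d'.time_eq_zero_iff hx').2 hn), hp]
      · set z := nx.symm x with hz
        have hxz : nx z = x := by simp [hz]
        have hzn : nx z ≠ z := fun hh => hn (by rw [← hxz]; exact congrArg nx hh)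
        have hzo : d.out z = false := by
          have h1 := hzn
          rw [ne_eq, d.nx_eq_self_iff, not_or] at h1
          have := d.out_nx h1.1 h1.2
          rw [hxz, hx] at this
          simpa using this.symm
        have hzo' : d'.out z = false := ho ▸ hzo
        have h1 := d.label_nx_of_in hzo ((d.time_eq_last_iff hzo).not.2 hzn)
        have h2 := d'.label_nx_of_in hzo' ((d'.time_eq_last_iff hzo').not.2 hzn)
        rw [hxz] at h1 h2
        rw [h1, h2]
        refine ih _ ?_ _ rfl
        rw [← hxz, d.time_nx]
        exact d.time_op_lt hzo

/-- Labels and directions determine the positions. -/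
theorem pos_eq_of_label_eq (d : Drawing nx op f) (d' : Drawing nx op f')
    (hl : d.label = d'.label) (ho : d.out = d'.out) : d.pos = d'.pos := by
  funext x
  rcases hx : d.out x
  · rw [← d.label_of_in hx, ← d'.label_of_in (ho ▸ hx), hl]
  · have h := d.out_op_of_out hx
    rw [← d.pos_op, ← d'.pos_op, ← d.label_of_in h, ← d'.label_of_in (ho ▸ h), hl]

theorem label_eq_of_coord_eq (d : Drawing nx op f) (e : Drawing nx' op' f) {x : D} {y : E}
    (ht : e.time y = d.time x) (hp : e.pos y = d.pos x) (ho : e.out y = d.out x) :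
    e.label y = d.label x := by
  simp [label, ht, hp, ho]

end Drawing

namespace SurfaceMap

variable {M : SurfaceMap} {n : ℕ} {f : List (Equiv.Perm (Fin n))}

/-- An orientation is determined by the direction of one dart. -/
theorem IsOrientation.eq {o o' : M.Dart → Bool} (h : M.IsOrientation o) (h' : M.IsOrientation o')
    (x₀ : M.Dart) (h₀ : o x₀ = o' x₀) : o = o' := by
  funext x
  refine (Linked.induct (S := {M.next, M.opp}) (r := fun x y => o x = o' x ↔ o y = o' y)
    ⟨fun _ => Iff.rfl, Iff.symm, Iff.trans⟩ ?_ (M.connected x₀ x)).1 h₀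
  rintro ρ hρ y
  rcases hρ with rfl | rfl
  · by_cases hy : M.next y = y
    · rw [hy]
    · rw [h.next y hy, h'.next y hy, Bool.not_inj_iff]
  · rw [h.opp, h'.opp, Bool.not_inj_iff]

theorem IsOrientation.not {o : M.Dart → Bool} (h : M.IsOrientation o) :
    M.IsOrientation fun x => !o x :=
  ⟨fun x => by rw [h.opp], fun x hx => by rw [h.next x hx]⟩

/-- An automorphism of a connected map that fixes a dart is trivial. -/
theorem automorphism_eq_id (φ : M.Dart → M.Dart) (hn : ∀ x, φ (M.next x) = M.next (φ x))
    (ho : ∀ x, φ (M.opp x) = M.opp (φ x)) (x₀ : M.Dart) (h₀ : φ x₀ = x₀) (x : M.Dart) :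
    φ x = x := by
  refine (Linked.induct (S := {M.next, M.opp}) (r := fun x y => φ x = x ↔ φ y = y)
    ⟨fun _ => Iff.rfl, Iff.symm, Iff.trans⟩ ?_ (M.connected x₀ x)).1 h₀
  rintro ρ hρ y
  rcases hρ with rfl | rfl
  · rw [hn, M.next.injective.eq_iff]
  · rw [ho, M.opp.injective.eq_iff]

end SurfaceMap

namespace LabelledMap

variable {m n : ℕ} [NeZero m]

/-- The factorization `f` is drawn on `M` with labels `H`, the distinguished leaf being a source. -/
def IsDrawn (M : LabelledMap m) (f : List (Equiv.Perm (Fin n))) (H : M.Dart → Fin n) : Prop :=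
  ∃ d : Drawing M.next M.opp f, d.out M.root = true ∧ d.label = H

/-- The labels `H` agree with the labels `lam` of the cycles and with the root `i₀`. -/
structure Fits (M : LabelledMap m) (lam : Fin n → Fin m) (i₀ : Fin n) (H : M.Dart → Fin n) :
    Prop where
  face : ∀ x, lam (H x) = M.faceLabel (M.faceOf x)
  root : H M.root = i₀

variable {M N : LabelledMap m} {lam : Fin n → Fin m} {i₀ : Fin n} {f f' : List (Equiv.Perm (Fin n))}
  {H : M.Dart → Fin n} {H' : N.Dart → Fin n}

theorem next_root (M : LabelledMap m) : M.next M.root = M.root :=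
  (M.isLeafDart_iff _).1 M.root_leaf

theorem IsDrawn.of_swapStep (h : SwapStep f f') (hd : M.IsDrawn f H) : M.IsDrawn f' H := by
  obtain ⟨d, h1, rfl⟩ := hd
  obtain ⟨d', hp, ho⟩ := Drawing.exists_swap h d
  exact ⟨d', by rw [ho, h1], d'.label_eq_of_pos_eq d hp ho⟩

theorem isDrawn_iff_of_eqvGen (h : Relation.EqvGen SwapStep f f') :
    M.IsDrawn f H ↔ M.IsDrawn f' H := by
  induction h with
  | rel f f' h =>
    refine ⟨IsDrawn.of_swapStep h, IsDrawn.of_swapStep ?_⟩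
    obtain ⟨l₁, l₂, σ, τ, hd⟩ := h
    exact SwapStep.swap l₁ l₂ τ σ hd.symm
  | refl f => exact Iff.rfl
  | symm f f' _ ih => exact ih.symm
  | trans f f' f'' _ _ ih ih' => exact ih.trans ih'

/-- Two drawings of the same factorization are isomorphic, with equal labels. -/
theorem IsDrawn.exists_equiv (hd : M.IsDrawn f H) (hd' : N.IsDrawn f H')
    (hr : H M.root = H' N.root) : ∃ φ : M.Dart ≃ N.Dart, (∀ x, φ (M.next x) = N.next (φ x)) ∧
      (∀ x, φ (M.opp x) = N.opp (φ x)) ∧ (∀ x, H' (φ x) = H x) ∧ φ M.root = N.root := by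
  obtain ⟨d, h1, rfl⟩ := hd
  obtain ⟨e, h2, rfl⟩ := hd'
  obtain ⟨φ, hn, ho, ht, hp, hb⟩ := d.exists_equiv e
  have hl : ∀ x, e.label (φ x) = d.label x := fun x =>
    d.label_eq_of_coord_eq e (ht x) (hp x) (hb x)
  have t1 : d.time M.root = 0 := (d.time_eq_zero_iff h1).2 M.next_root
  have t2 : e.time N.root = 0 := (e.time_eq_zero_iff h2).2 N.next_root
  refine ⟨φ, hn, ho, hl, e.inj _ _ ?_ ?_ ?_⟩
  · rw [ht, t1, t2]
  · rw [hp, ← d.label_source t1, ← e.label_source t2, hr]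
  · rw [hb, h1, h2]

theorem IsDrawn.nonempty_iso (hd : M.IsDrawn f H) (hd' : N.IsDrawn f H') (hf : M.Fits lam i₀ H)
    (hf' : N.Fits lam i₀ H') : Nonempty (Iso M N) := by
  obtain ⟨φ, hn, ho, hl, hr⟩ := hd.exists_equiv hd' (hf.root.trans hf'.root.symm)
  exact ⟨⟨φ, hn, ho, fun x => by rw [← hf'.face, ← hf.face, hl], hr⟩⟩

theorem IsDrawn.of_iso (e : Iso M N) (hd : M.IsDrawn f H) (hf : M.Fits lam i₀ H) :
    ∃ H', N.IsDrawn f H' ∧ N.Fits lam i₀ H' := by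
  obtain ⟨d, h1, rfl⟩ := hd
  have hr : e.toEquiv.symm N.root = M.root := by rw [Equiv.symm_apply_eq, e.map_root]
  refine ⟨fun y => d.label (e.toEquiv.symm y), ⟨d.map e.toEquiv e.map_next e.map_opp, ?_, rfl⟩,
    fun y => ?_, ?_⟩
  · change d.out (e.toEquiv.symm N.root) = true
    rw [hr, h1]
  · rw [hf.face, ← e.map_face, Equiv.apply_symm_apply]
  · rw [hr, hf.root]

/-- Labels are determined by the equivalence class of the factorization. -/
theorem IsDrawn.label_unique {H' : M.Dart → Fin n} (hd : M.IsDrawn f H) (hd' : M.IsDrawn f H')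
    (hr : H M.root = H' M.root) : H = H' := by
  obtain ⟨φ, hn, ho, hl, hφ⟩ := hd.exists_equiv hd' hr
  funext x
  rw [← hl, SurfaceMap.automorphism_eq_id φ hn ho M.root hφ]

/-- The equivalence class of the factorization is determined by the labels. -/
theorem IsDrawn.eqvGen (hd : M.IsDrawn f H) (hd' : M.IsDrawn f' H) (hc : ∀ σ ∈ f, σ.IsCycle)
    (hc' : ∀ σ ∈ f', σ.IsCycle) : Relation.EqvGen SwapStep f f' := by
  obtain ⟨d, h1, rfl⟩ := hd
  obtain ⟨d', h2, h3⟩ := hd'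
  have ho : d.out = d'.out := d.isOrientation.eq d'.isOrientation M.root (h1.trans h2.symm)
  exact d.eqvGen_of_pos_eq d' hc hc' (d.pos_eq_of_label_eq d' h3.symm ho) ho

section Correspondence

variable {π : Equiv.Perm (Fin n)} {α : Fin m → ℕ} {β : ℕ →₀ ℕ} {g : ℕ}

theorem card_face (M : LabelledMap m) : Nat.card M.Face = m := by
  rw [Nat.card_congr M.faceLabel, Nat.card_fin]

theorem face_eq_iff (M : LabelledMap m) (x y : M.Dart) :
    M.faceLabel (M.faceOf x) = M.faceLabel (M.faceOf y) ↔ M.faceNext.SameCycle x y := by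
  rw [M.faceLabel.injective.eq_iff, M.faceOf_eq_iff]

theorem surjective_face (M : LabelledMap m) :
    Function.Surjective fun x => M.faceLabel (M.faceOf x) := by
  intro j
  obtain ⟨x, hx⟩ := M.exists_faceOf (M.faceLabel.symm j)
  exact ⟨x, by simp [hx]⟩

theorem IsDrawn.isAdmissible (hπ : HasCycleType π α)
    (hcard : ∀ j, Nat.card {i // lam i = j} = α j) (φ : Factorization π β g)
    (hd : M.IsDrawn φ.1 H) (hf : M.Fits lam i₀ H) : M.IsAdmissible α β g := by
  obtain ⟨f, ⟨hc, rfl⟩, hg, hs⟩ := φ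
  obtain ⟨d, h1, rfl⟩ := hd
  refine ⟨(d.hasGenus_iff hc (M.card_face.trans (numCycles_eq hπ).symm) g).2 hg, d.degrees hc,
    fun j => ?_, fun k hk => (d.card_vertex_degree hc k hk).trans (hs k hk),
    fun l _ c hcy => d.cycles c hcy⟩
  rw [← hcard j, ← d.card_leaves j]
  exact Nat.card_congr (Equiv.subtypeEquivRight fun x => by rw [hf.face])

/-- Every factorization can be drawn. -/
theorem exists_isDrawn (hlam : ∀ i j, lam i = lam j ↔ π.SameCycle i j)
    (hs : Function.Surjective lam) (h₀ : lam i₀ = 0) (φ : Factorization π β g) :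
    ∃ (M : LabelledMap m) (H : M.Dart → Fin n), M.IsDrawn φ.1 H ∧ M.Fits lam i₀ H := by
  obtain ⟨f, ⟨hc, rfl⟩, hg, -⟩ := φ
  have : NeZero n := ⟨fun h => (h ▸ i₀).elim0⟩
  let d := modelDrawing f hg.1
  choose x h1 h2 h3 using d.source i₀
  have hl : d.label x = i₀ := (d.label_source h2).trans h3
  let M : LabelledMap m :=
    { toSurfaceMap := modelMap f hg.1
      faceLabel := d.faceEquiv hlam hs
      root := x
      root_leaf := (d.isLeafDart_iff x).2 (.inl h2)
      root_face := by rw [d.faceEquiv_faceOf, hl, h₀] }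
  exact ⟨M, d.label, ⟨d, h1, rfl⟩, fun y => (d.faceEquiv_faceOf hlam hs y).symm, hl⟩

theorem IsAdmissible.exists_isOrientation (hM : M.IsAdmissible α β g) :
    ∃ o, M.IsOrientation o ∧ o M.root = true := by
  obtain ⟨o, ho⟩ := SurfaceMap.exists_isOrientation (M := M.toSurfaceMap)
    (fun v => (hM.degrees v).imp_right And.left) fun l _ c hc => (hM.cycles l c hc).2
  rcases h : o M.root
  · exact ⟨_, ho.not, by simp [h]⟩
  · exact ⟨o, ho, h⟩

/-- A drawing of a factorization of `π` has labels that follow the faces. -/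
theorem IsDrawn.isLabelling {o : M.Dart → Bool} (ho : M.IsOrientation o) (hr : o M.root = true)
    (hd : M.IsDrawn f H) : M.IsLabelling o f.prod H := by
  obtain ⟨d, h1, rfl⟩ := hd
  obtain rfl : d.out = o := d.isOrientation.eq ho M.root (h1.trans hr.symm)
  exact d.label_eq

/-- Labels that follow the faces of an admissible map come from a factorization. -/
theorem IsAdmissible.exists_factorization (hM : M.IsAdmissible α β g) (hα : ∀ j, 0 < α j)
    (hn : ∑ j, α j = n) (hπ : HasCycleType π α) (hlam : ∀ i j, lam i = lam j ↔ π.SameCycle i j)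
    {o : M.Dart → Bool} (ho : M.IsOrientation o) (hr : o M.root = true)
    (hH : M.IsLabelling o π H) (hf : M.Fits lam i₀ H) :
    ∃ φ : Factorization π β g, M.IsDrawn φ.1 H := by
  obtain ⟨hsrc, hinj⟩ := hH.sources ho M.face_eq_iff M.surjective_face hM.leaves hα hn hlam hf.face
  obtain ⟨f, hfac, d, rfl, rfl⟩ := SurfaceMap.exists_drawing ho
    (fun v => (hM.degrees v).imp_right And.right)
    (ho.acyclic fun l _ c hc => (hM.cycles l c hc).1) hH hsrc hinj
  obtain ⟨hc, rfl⟩ := hfac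
  exact ⟨⟨f, ⟨hc, rfl⟩,
    (d.hasGenus_iff hc (M.card_face.trans (numCycles_eq hπ).symm) g).1 hM.genus,
    fun k hk => (d.card_vertex_degree hc k hk).symm.trans (hM.vertices k hk)⟩, d, hr, rfl⟩

/-- The number of ways to label an admissible map: the label of one dart in each face can be chosen
freely, except in the face of the distinguished leaf. -/
theorem IsAdmissible.card_labellings (hM : M.IsAdmissible α β g)
    (hlam : ∀ i j, lam i = lam j ↔ π.SameCycle i j)
    (hcard : ∀ j, Nat.card {i // lam i = j} = α j) (h₀ : lam i₀ = 0)
    {o : M.Dart → Bool} (ho : M.IsOrientation o) :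
    Nat.card {H : M.Dart → Fin n // M.IsLabelling o π H ∧ M.Fits lam i₀ H} =
      ∏ j ∈ Finset.univ.erase (0 : Fin m), α j := by
  have := M.finite
  rw [← M.root_face]
  rw [← natCard_twisted (φ := M.faceNext) (u := fun x => o x = true ∧ o (M.faceNext x) = false)
    π (fun x => M.faceLabel (M.faceOf x)) lam M.face_eq_iff hlam α M.surjective_face
    (fun j => (SurfaceMap.card_turns ho M.face_eq_iff hM.leaves j).1) hcard M.root i₀
    (h₀.trans M.root_face.symm)]
  refine Nat.card_congr (Equiv.subtypeEquivRight fun H => ⟨fun h => ⟨h.1, h.2.face, h.2.root⟩,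
    fun h => ⟨h.1, h.2.1, h.2.2⟩⟩)

end Correspondence

end LabelledMap

end CycleMaps

open CycleMaps CycleMaps.LabelledMap

theorem theorem4p3 {m n : ℕ} [NeZero m] (α : Fin m → ℕ) (hα : ∀ i, 0 < α i)
    (hn : ∑ i, α i = n) (π : Equiv.Perm (Fin n)) (hπ : CycleMaps.HasCycleType π α)
    (β : ℕ →₀ ℕ) (g : ℕ) :
    ∃ F : CycleMaps.InequivalentFactorization π β g → CycleMaps.MapClass α β g,
      CycleMaps.IsToOne (∏ i ∈ Finset.univ.erase (0 : Fin m), α i) F := by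
  obtain ⟨lam, hlam, hcard⟩ := exists_cycle_labels hπ
  have hs : Function.Surjective lam := by
    intro j
    have h := hα j
    rw [← hcard j, Nat.card_pos_iff] at h
    obtain ⟨⟨i, hi⟩⟩ := h.1
    exact ⟨i, hi⟩
  obtain ⟨i₀, h₀⟩ := hs 0
  choose N H hNd hNf using exists_isDrawn (β := β) (g := g) hlam hs h₀
  let F : InequivalentFactorization π β g → MapClass α β g := fun q =>
    Quotient.mk _ ⟨N (Quotient.out q), (hNd _).isAdmissible hπ hcard _ (hNf _)⟩
  refine ⟨F, fun y => ?_⟩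
  obtain ⟨⟨M, hM⟩, hy⟩ : ∃ M, (Quotient.mk _ M : MapClass α β g) = y := Quotient.exists_rep y
  obtain ⟨o, ho, hr⟩ := hM.exists_isOrientation
  -- The fibre over `M` is the injective image of the set `L` of labellings of `M`.
  let L := {H : M.Dart → Fin n // M.IsLabelling o π H ∧ M.Fits lam i₀ H}
  choose φ hφ using fun H : L => hM.exists_factorization hα hn hπ hlam ho hr H.2.1 H.2.2
  let Ψ : L → InequivalentFactorization π β g := fun H => Quotient.mk _ (φ H)
  have hout : ∀ (H : L) (f : Factorization π β g), Ψ H = Quotient.mk _ f → M.IsDrawn f.1 H.1 :=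
    fun H f h => (isDrawn_iff_of_eqvGen (Quotient.exact h)).1 (hφ H)
  have hinj : Function.Injective Ψ := fun H H' h =>
    Subtype.ext ((hout H (φ H') h).label_unique (hφ H') (H.2.2.root.trans H'.2.2.root.symm))
  have hrange : F ⁻¹' {y} = Set.range Ψ := by
    ext q
    rw [Set.mem_preimage, Set.mem_singleton_iff, ← hy]
    constructor
    · intro h
      obtain ⟨e⟩ : Nonempty (Iso (N (Quotient.out q)) M) := Quotient.exact h
      obtain ⟨H', h1, h2⟩ := (hNd (Quotient.out q)).of_iso e (hNf _)
      have h3 := h1.isLabelling ho hr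
      rw [(Quotient.out q).2.1.prod_eq] at h3
      refine ⟨⟨H', h3, h2⟩, ?_⟩
      rw [← Quotient.out_eq q]
      exact Quotient.sound ((hφ ⟨H', h3, h2⟩).eqvGen h1 (φ ⟨H', h3, h2⟩).2.1.isCycle
        (Quotient.out q).2.1.isCycle)
    · rintro ⟨H', rfl⟩
      refine Quotient.sound ?_
      exact (hNd _).nonempty_iso (hout H' _ (Quotient.out_eq _).symm) (hNf _) H'.2.2
  have := M.finite
  have hL : Finite L := Subtype.finite
  rw [hrange]
  refine ⟨Set.finite_range Ψ, ?_⟩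
  rw [← Nat.card_coe_set_eq, Nat.card_range_of_injective hinj]
  exact hM.card_labellings hlam hcard h₀ ho
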